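/- Let $G$ be a compact Lie group with Lie algebra $\mathfrak g$, let $\pi:P\to M$ be a smooth principal $G$-bundle ($G$ acting on the left, finite-dimensional manifolds without boundary), let $h$ be a smooth (pseudo-)Riemannian metric on $M$, $K$ an $\mathrm{Ad}$-invariant (positive definite) inner product on $\mathfrak g$, and $\omega$ a smooth connection form on $P$, i.e. a smooth $\mathfrak g$-valued one-form with $\omega(X_P)=X$ for every $X\in\mathfrak g$, where $X_P(p)=\frac{d}{dt}\big|_{t=0}\exp(tX)\cdot p$, and $g^*\omega=\mathrm{Ad}(g)\circ\omega$ for every $g\in G$. Equip $P$ with the bundle metric $\alpha=\pi^*h+K\circ\omega$, that is $$\alpha(u,v)=h(d\pi\,u,d\pi\,v)+K(\omega(u),\omega(v)),$$ and $G$ with the bi-invariant metric that equals $K$ on $\mathfrak g=T_eG$. Let $\Omega(u,v)=d\omega(\widehat H u,\widehat H v)$ be the curvature of $\omega$, where $\widehat H$ is the projection of $TP$ onto the horizontal bundle $\ker\omega$ along the vertical one and $d\omega(X,Y)=X(\omega(Y))-Y(\omega(X))-\omega([X,Y])$. For $p\in P$ let $\|\Omega\|^2(p)$ be the squared norm of $\Omega_p$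 as a $\mathfrak g$-valued two-form on $T_{\pi(p)}M$ (by horizontal lifts): if $(X_i)$ is an $h$-orthonormal basis of $T_{\pi(p)}M$, $\varepsilon_i=h(X_i,X_i)=\pm1$, and $e_i\in T_pP$ is the horizontal lift of $X_i$, then $$\|\Omega\|^2(p)=\sum_{i<j}\varepsilon_i\varepsilon_j\,K\big(\Omega_p(e_i,e_j),\Omega_p(e_i,e_j)\big).$$ Let ${}^PR,{}^MR,{}^GR$ be the scalar curvatures of the Levi-Civita connections of $\alpha$, of $h$ and of the bi-invariant metric on $G$ (with the sign for which round spheres have positive scalar curvature). Then for all $p\in P$ and $g\in G$, $${}^PR(p)={}^MR(\pi(p))-\tfrac12\|\Omega\|^2(p)+{}^GR(g).$$ -/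

import Mathlib

open scoped Manifold ContDiff
open Bundle

noncomputable section

namespace KaluzaKlein

/-! ### Linear algebra -/

section LinearAlgebra

/-- The pull-back `(u, v) ↦ B (D u) (D v)` of a bilinear form `B` by a linear map `D`. -/
def pullbackForm {V W : Type*}
    [AddCommGroup V] [Module ℝ V] [TopologicalSpace V] [IsTopologicalAddGroup V]
    [ContinuousSMul ℝ V]
    [AddCommGroup W] [Module ℝ W] [TopologicalSpace W] [IsTopologicalAddGroup W]
    [ContinuousSMul ℝ W]
    (B : W →L[ℝ] W →L[ℝ] ℝ) (D : V →L[ℝ] W) : V →L[ℝ] V →L[ℝ] ℝ :=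
  (ContinuousLinearMap.precomp ℝ D) ∘L B ∘L D

theorem pullbackForm_apply {V W : Type*}
    [AddCommGroup V] [Module ℝ V] [TopologicalSpace V] [IsTopologicalAddGroup V]
    [ContinuousSMul ℝ V]
    [AddCommGroup W] [Module ℝ W] [TopologicalSpace W] [IsTopologicalAddGroup W]
    [ContinuousSMul ℝ W]
    (B : W →L[ℝ] W →L[ℝ] ℝ) (D : V →L[ℝ] W) (u v : V) :
    pullbackForm B D u v = B (D u) (D v) := rfl

/-- The trace `g^{ij} B_{ij}` of a bilinear form `B` on a finite-dimensional real vector space with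
respect to a nondegenerate symmetric bilinear form `g`, where `(g^{ij})` is the inverse of the Gram
matrix of `g`; it does not depend on the basis in which it is computed. -/
def metricTrace {V : Type*} [AddCommGroup V] [Module ℝ V] [FiniteDimensional ℝ V]
    (g B : V → V → ℝ) : ℝ :=
  let b := Module.finBasis ℝ V
  ∑ i, ∑ j, (Matrix.of fun k l => g (b k) (b l))⁻¹ i j * B (b i) (b j)

end LinearAlgebra

/-! ### Curvature of a metric on (an open subset of) a vector space -/

section VectorSpace

variable {E : Type*} [NormedAddCommGroup E] [NormedSpace ℝ E]

/-- The Christoffel symbols `Γ(u, v)` at `y` of a metric `g` on `E`: the vector with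
`2 g(Γ(u, v), w) = ∂_u g(v, w) + ∂_v g(u, w) - ∂_w g(u, v)` for all `w`. -/
def christoffel (g : E → E →L[ℝ] E →L[ℝ] ℝ) (y u v : E) : E :=
  (g y).inverse ((1 / 2 : ℝ) •
    (fderiv ℝ g y u v + fderiv ℝ g y v u - ((fderiv ℝ g y).flip u).flip v))

/-- The Riemann curvature tensor of the Levi-Civita connection `∇_u v = ∂_u v + Γ(u, v)`:
`R(u, v) w = ∂_u Γ(v, w) - ∂_v Γ(u, w) + Γ(u, Γ(v, w)) - Γ(v, Γ(u, w))`,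
that is `R(X, Y) = ∇_X ∇_Y - ∇_Y ∇_X - ∇_[X, Y]`. -/
def riemannTensor (g : E → E →L[ℝ] E →L[ℝ] ℝ) (y u v w : E) : E :=
  fderiv ℝ (fun z => christoffel g z v w) y u - fderiv ℝ (fun z => christoffel g z u w) y v
    + christoffel g y u (christoffel g y v w) - christoffel g y v (christoffel g y u w)

variable [FiniteDimensional ℝ E]

/-- The Ricci tensor `Ric(v, w)`, the trace of `u ↦ R(u, v) w`. -/
def ricciTensor (g : E → E →L[ℝ] E →L[ℝ] ℝ) (y v w : E) : ℝ :=
  ∑ i, (Module.finBasis ℝ E).coord i (riemannTensor g y (Module.finBasis ℝ E i) v w)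

/-- The scalar curvature `g^{ij} Ric_{ij}` at `y`. -/
def scalarCurvatureVec (g : E → E →L[ℝ] E →L[ℝ] ℝ) (y : E) : ℝ :=
  metricTrace (fun v w => g y v w) (ricciTensor g y)

end VectorSpace

/-! ### Metrics, scalar curvature and exterior derivative on manifolds -/

section Manifold

variable {E : Type*} [NormedAddCommGroup E] [NormedSpace ℝ E]
  {H : Type*} [TopologicalSpace H] (I : ModelWithCorners ℝ E H)
  {M : Type*} [TopologicalSpace M] [ChartedSpace H M]

instance tangentSpaceFiniteDimensional [FiniteDimensional ℝ E] (x : M) :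
    FiniteDimensional ℝ (TangentSpace I x) :=
  inferInstanceAs (FiniteDimensional ℝ E)

variable (M) in
/-- A smooth pseudo-Riemannian metric on `M` (of arbitrary signature; Riemannian metrics are the
positive definite ones). -/
structure PseudoRiemannianMetric [IsManifold I ∞ M] where
  /-- The scalar product on each tangent space. -/
  inner (x : M) : TangentSpace I x →L[ℝ] TangentSpace I x →L[ℝ] ℝ
  symm (x : M) (v w : TangentSpace I x) : inner x v w = inner x w v
  nondegenerate (x : M) (v : TangentSpace I x) (hv : ∀ w, inner x v w = 0) : v = 0
  contMDiff : ContMDiff I (I.prod 𝓘(ℝ, E →L[ℝ] E →L[ℝ] ℝ)) ∞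
    (fun x => TotalSpace.mk' (E →L[ℝ] E →L[ℝ] ℝ)
      (E := fun x : M => TangentSpace I x →L[ℝ] TangentSpace I x →L[ℝ] ℝ) x (inner x))

/-- A field of bilinear forms on the tangent spaces of `M`, read in the chart at `x₀`:
its components `y ↦ g_{ij}(y)` as a bilinear form on the model vector space. -/
def metricInChart (g : ∀ x : M, TangentSpace I x →L[ℝ] TangentSpace I x →L[ℝ] ℝ) (x₀ : M)
    (y : E) : E →L[ℝ] E →L[ℝ] ℝ :=
  pullbackForm (V := E) (g ((extChartAt I x₀).symm y))
    (mfderiv 𝓘(ℝ, E) I (extChartAt I x₀).symm y)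

/-- The scalar curvature at `x` of a metric `g` on `M`, computed in the chart at `x`. -/
def scalarCurvature [FiniteDimensional ℝ E]
    (g : ∀ x : M, TangentSpace I x →L[ℝ] TangentSpace I x →L[ℝ] ℝ) (x : M) : ℝ :=
  scalarCurvatureVec (metricInChart I g x) (extChartAt I x x)

/-- A vector-valued one-form on `M`, read in the chart at `x₀`. -/
def oneFormInChart {F : Type*} [NormedAddCommGroup F] [NormedSpace ℝ F]
    (θ : ∀ x : M, TangentSpace I x →L[ℝ] F) (x₀ : M) (y : E) : E →L[ℝ] F :=
  (θ ((extChartAt I x₀).symm y)) ∘L (mfderiv 𝓘(ℝ, E) I (extChartAt I x₀).symm y)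

/-- The exterior derivative of a vector-valued one-form at `x`, computed in the chart at `x`:
`dθ(u, v) = ∂_u (θ v) - ∂_v (θ u)`, that is
`dθ(X, Y) = X (θ Y) - Y (θ X) - θ [X, Y]` on vector fields. -/
def extDerivOneForm {F : Type*} [NormedAddCommGroup F] [NormedSpace ℝ F]
    (θ : ∀ x : M, TangentSpace I x →L[ℝ] F) (x : M) (u v : TangentSpace I x) : F :=
  let y : E := extChartAt I x x
  let u' : E := mfderiv I 𝓘(ℝ, E) (extChartAt I x) x u
  let v' : E := mfderiv I 𝓘(ℝ, E) (extChartAt I x) x v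
  fderiv ℝ (oneFormInChart I θ x) y u' v' - fderiv ℝ (oneFormInChart I θ x) y v' u'

end Manifold

/-! ### Ad-invariant inner products and bi-invariant metrics -/

section Group

variable {E : Type*} [NormedAddCommGroup E] [NormedSpace ℝ E]
  {H : Type*} [TopologicalSpace H] (I : ModelWithCorners ℝ E H)
  {G : Type*} [TopologicalSpace G] [ChartedSpace H G] [Group G]

/-- The adjoint representation: `Ad g` is the derivative at `1` of `a ↦ g a g⁻¹`. -/
def adjointRep (g : G) : GroupLieAlgebra I G →L[ℝ] GroupLieAlgebra I G :=
  (mfderiv I I (fun a : G => g * a * g⁻¹) 1 : E →L[ℝ] E)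

/-- `K` is a (positive definite) `Ad`-invariant inner product on the Lie algebra. -/
structure IsAdInvariantInner (K : GroupLieAlgebra I G →L[ℝ] GroupLieAlgebra I G →L[ℝ] ℝ) :
    Prop where
  symm : ∀ X Y, K X Y = K Y X
  pos : ∀ X, X ≠ 0 → 0 < K X X
  ad_invariant : ∀ (g : G) X Y, K (adjointRep I g X) (adjointRep I g Y) = K X Y

/-- The metric on `G` obtained from `K` by left translations
(it is bi-invariant when `K` is `Ad`-invariant). -/
def groupMetric (K : GroupLieAlgebra I G →L[ℝ] GroupLieAlgebra I G →L[ℝ] ℝ) (g : G) :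
    TangentSpace I g →L[ℝ] TangentSpace I g →L[ℝ] ℝ :=
  pullbackForm K
    (show TangentSpace I g →L[ℝ] GroupLieAlgebra I G from
      (mfderiv I I (fun a : G => g⁻¹ * a) g : E →L[ℝ] E))

end Group

/-! ### Principal bundles, connections and the bundle metric -/

section Bundle

variable {EP : Type*} [NormedAddCommGroup EP] [NormedSpace ℝ EP]
  {HP : Type*} [TopologicalSpace HP] (IP : ModelWithCorners ℝ EP HP)
  {EM : Type*} [NormedAddCommGroup EM] [NormedSpace ℝ EM]
  {HM : Type*} [TopologicalSpace HM] (IM : ModelWithCorners ℝ EM HM)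
  {EG : Type*} [NormedAddCommGroup EG] [NormedSpace ℝ EG]
  {HG : Type*} [TopologicalSpace HG] (IG : ModelWithCorners ℝ EG HG)
  {P : Type*} [TopologicalSpace P] [ChartedSpace HP P]
  {M : Type*} [TopologicalSpace M] [ChartedSpace HM M]
  {G : Type*} [TopologicalSpace G] [ChartedSpace HG G] [Group G] [MulAction G P]

variable (G) in
/-- `proj : P → M` is a smooth principal `G`-bundle, with `G` acting on `P` from the left: the action
and the projection are smooth, and over a neighbourhood `U` of every point of `M` there is a
diffeomorphism `proj⁻¹ U ≃ U × G` over `U` that takes the action to left multiplication on `G`. In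
particular the action is free and its orbits are exactly the fibres of `proj`. -/
structure IsPrincipalBundle (proj : P → M) : Prop where
  contMDiff_smul : ContMDiff (IG.prod IP) IP ∞ (fun q : G × P => q.1 • q.2)
  contMDiff_proj : ContMDiff IP IM ∞ proj
  proj_smul : ∀ (g : G) (p : P), proj (g • p) = proj p
  exists_trivialization : ∀ x : M, ∃ (U : Set M) (Φ : OpenPartialHomeomorph P (M × G)),
    IsOpen U ∧ x ∈ U ∧ Φ.source = proj ⁻¹' U ∧ Φ.target = U ×ˢ Set.univ ∧
    ContMDiffOn IP (IM.prod IG) ∞ Φ Φ.source ∧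
    ContMDiffOn (IM.prod IG) IP ∞ Φ.symm Φ.target ∧
    (∀ p ∈ Φ.source, (Φ p).1 = proj p) ∧
    (∀ p ∈ Φ.source, ∀ g : G, (Φ (g • p)).2 = g * (Φ p).2)

/-- The infinitesimal action `𝔤 → T_p P`, the derivative at `1` of `g ↦ g • p`. -/
def fundamental (p : P) : GroupLieAlgebra IG G →L[ℝ] TangentSpace IP p :=
  (mfderiv IG IP (fun g : G => g • p) 1 : EG →L[ℝ] EP)

/-- `conn` is (the `𝔤`-valued one-form of) a connection on the principal bundle `P`: it is smooth, it
inverts the infinitesimal action on vertical vectors, and `g^* conn = Ad(g) ∘ conn`. -/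
structure IsConnectionForm [IsManifold IP ∞ P]
    (conn : ∀ p : P, TangentSpace IP p →L[ℝ] GroupLieAlgebra IG G) :
    Prop where
  contMDiff : ContMDiff (M' := EG) IP.tangent 𝓘(ℝ, EG) ∞
    (fun v : TangentBundle IP P => conn v.proj v.snd)
  apply_fundamental : ∀ (p : P) (X : GroupLieAlgebra IG G), conn p (fundamental IP IG p X) = X
  equivariant : ∀ (g : G) (p : P) (v : TangentSpace IP p),
    conn (g • p) (mfderiv IP IP (fun q : P => g • q) p v) = adjointRep IG g (conn p v)

/-- The bundle metric `α = π^* h + K ∘ ω`, that is `α(u, v) = h(dπ u, dπ v) + K(ω u, ω v)`,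
where `π` is the projection `proj` and `ω` the connection form `conn`. -/
def bundleMetric (proj : P → M)
    (h : ∀ x : M, TangentSpace IM x →L[ℝ] TangentSpace IM x →L[ℝ] ℝ)
    (K : GroupLieAlgebra IG G →L[ℝ] GroupLieAlgebra IG G →L[ℝ] ℝ)
    (conn : ∀ p : P, TangentSpace IP p →L[ℝ] GroupLieAlgebra IG G) (p : P) :
    TangentSpace IP p →L[ℝ] TangentSpace IP p →L[ℝ] ℝ :=
  pullbackForm (h (proj p)) (mfderiv IP IM proj p) + pullbackForm K (conn p)

/-- The projection of `T_p P` onto the horizontal space `ker ω_p` along the vertical one. -/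
def horizontalProj (conn : ∀ p : P, TangentSpace IP p →L[ℝ] GroupLieAlgebra IG G) (p : P)
    (v : TangentSpace IP p) : TangentSpace IP p :=
  v - fundamental IP IG p (conn p v)

/-- The curvature form `Ω(u, v) = dω(Ĥ u, Ĥ v)` of a connection. -/
def curvatureForm (conn : ∀ p : P, TangentSpace IP p →L[ℝ] GroupLieAlgebra IG G) (p : P)
    (u v : TangentSpace IP p) : GroupLieAlgebra IG G :=
  extDerivOneForm IP (F := EG) conn p (horizontalProj IP IG conn p u) (horizontalProj IP IG conn p v)

/-- The horizontal lift to `p` of a tangent vector of the base at `π p`: the vector `v` in `T_p P`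
with `dπ v = u` and `ω v = 0`. -/
def horizontalLift (proj : P → M) (conn : ∀ p : P, TangentSpace IP p →L[ℝ] GroupLieAlgebra IG G)
    (p : P) (u : TangentSpace IM (proj p)) : TangentSpace IP p :=
  ((mfderiv IP IM proj p).prod (conn p)).inverse (u, 0)

/-- The squared norm `‖Ω‖²` at `p` of the curvature, regarded as a two-form on `T_{π p} M` with
values in `𝔤` by means of horizontal lifts, with respect to `h` and `K`:
`‖Ω‖² = ½ h^{ik} h^{jl} K(Ω_{ij}, Ω_{kl})`. In an `h`-orthonormal basis this is the sum over `i < j`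
of `ε_i ε_j K(Ω_{ij}, Ω_{ij})`, the norm for which the `e^i ∧ e^j` with `i < j` are orthonormal. -/
def curvatureNormSq [FiniteDimensional ℝ EM] (proj : P → M)
    (h : ∀ x : M, TangentSpace IM x →L[ℝ] TangentSpace IM x →L[ℝ] ℝ)
    (K : GroupLieAlgebra IG G →L[ℝ] GroupLieAlgebra IG G →L[ℝ] ℝ)
    (conn : ∀ p : P, TangentSpace IP p →L[ℝ] GroupLieAlgebra IG G) (p : P) : ℝ :=
  let F := fun u v : TangentSpace IM (proj p) =>
    curvatureForm IP IG conn p (horizontalLift IP IM IG proj conn p u) (horizontalLift IP IM IG proj conn p v)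
  (1 / 2) * metricTrace (fun u u' => h (proj p) u u')
    (fun u u' => metricTrace (fun v v' => h (proj p) v v') (fun v v' => K (F u v) (F u' v')))

end Bundle

end KaluzaKlein

end

noncomputable section

namespace KaluzaKlein

/-! ### Traces in orthogonal bases -/

section Traces

variable {V : Type*} [AddCommGroup V] [Module ℝ V]

/-! The pair (dπ, ω) identifies each tangent space of P with the sum of a tangent space of M and 𝔤,
and in this coframe the bundle metric is the block form h ⊕ K, whose second block is constant. All
the twisting sits in the structure equation dω = F + B(ω, ω), with F the curvature on horizontal
lifts and B (`adjointBracket`) the derivative of Ad at 1. It holds because dω(X_P, v) is the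
derivative of Ad along X applied to ω(v) (`extDeriv_of_action`). Ad-invariance of K makes B skew for
K, and dω(u, u) = 0 makes B alternating; nothing else about the Lie bracket is needed.

The Levi-Civita connection in this frame can then be written down (`bundleConnection`): the
Christoffel symbols of h, the terms -½F and -½B in the fibre component, and ½F* terms in the base
component, where F* is the adjoint of F. Any torsion-free metric connection in a frame gives the
Christoffel symbols (`IsLeviCivitaFrame.christoffel_eq`), so its curvature computes the Riemann
tensor (`riemannTensor_frame`).

In an orthogonal basis of horizontal and vertical vectors, the numbers α(R(u, v)v, u) are O'Neill's:
h(R(a, b)b, a) - ¾|F(a, b)|² for two horizontal vectors, ¼|F*(a, b)|² for a mixed pair, ¼|B(a, b)|²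
for two vertical ones. F and F* have the same total square norm and mixed pairs occur in both
orders, so F contributes -¾ + 2·¼ = -¼ of the sum over all (i, j), which is -½‖Ω‖².

What is left is ¼ of the total square norm of B. This is the scalar curvature of G by the same local
computation: G with its right Maurer-Cartan form is a left bundle over a point, with the same B and
no horizontal directions (`scalarCurvature_groupMetric`). -/

/-- `b` is an orthogonal basis of non-isotropic vectors for the form `g`. -/
structure IsOrthogonalBasis {ι : Type*} (g : V → V → ℝ) (b : Module.Basis ι ℝ V) : Prop where
  ortho : ∀ i j, i ≠ j → g (b i) (b j) = 0
  self_ne : ∀ i, g (b i) (b i) ≠ 0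

theorem IsOrthogonalBasis.coord_eq {ι : Type*} [Fintype ι] {g : V →ₗ[ℝ] V →ₗ[ℝ] ℝ}
    {b : Module.Basis ι ℝ V} (hb : IsOrthogonalBasis (fun v w => g v w) b) (i : ι) (x : V) :
    b.coord i x = (g (b i) (b i))⁻¹ * g x (b i) := by
  classical
  have h1 : g x (b i) = b.repr x i * g (b i) (b i) := by
    conv_lhs => rw [← b.sum_repr x]
    rw [map_sum, LinearMap.sum_apply, Finset.sum_eq_single i]
    · simp
    · intro j _ hj
      have := hb.ortho j i hj
      simp [this]
    · simp
  have h2 := hb.self_ne i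
  rw [h1, Module.Basis.coord_apply]
  field_simp

theorem IsOrthogonalBasis.apply_eq_sum {ι : Type*} [Fintype ι] {g : V →ₗ[ℝ] V →ₗ[ℝ] ℝ}
    {b : Module.Basis ι ℝ V} (hb : IsOrthogonalBasis (fun v w => g v w) b) (x y : V) :
    g x y = ∑ i, (g (b i) (b i))⁻¹ * (g x (b i) * g y (b i)) := by
  classical
  conv_lhs => rw [← b.sum_repr y]
  rw [map_sum]
  refine Finset.sum_congr rfl fun i _ => ?_
  have := hb.coord_eq i y
  rw [Module.Basis.coord_apply] at this
  rw [map_smul, smul_eq_mul, this]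
  ring

theorem sum_coord_eq_trace {ι : Type*} [Fintype ι] (b : Module.Basis ι ℝ V) (T : V →ₗ[ℝ] V) :
    ∑ i, b.coord i (T (b i)) = LinearMap.trace ℝ V T := by
  classical
  rw [LinearMap.trace_eq_matrix_trace ℝ b, Matrix.trace]
  refine Finset.sum_congr rfl fun i _ => ?_
  rw [Matrix.diag_apply, LinearMap.toMatrix_apply, Module.Basis.coord_apply]

variable [FiniteDimensional ℝ V]

/-- The form may be indefinite, so Gram-Schmidt is not available; a symmetric form is diagonalised
instead, and nondegeneracy excludes isotropic basis vectors. No normalisation is made: the signs ε_i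
of an orthonormal basis become the factors `(g (b i) (b i))⁻¹`. -/
theorem exists_isOrthogonalBasis (g : V →ₗ[ℝ] V →ₗ[ℝ] ℝ) (hs : ∀ v w, g v w = g w v)
    (hn : ∀ v, (∀ w, g v w = 0) → v = 0) :
    ∃ b : Module.Basis (Fin (Module.finrank ℝ V)) ℝ V,
      IsOrthogonalBasis (fun v w => g v w) b := by
  have : Invertible (2 : ℝ) := invertibleOfNonzero two_ne_zero
  obtain ⟨b, hb⟩ := LinearMap.BilinForm.exists_orthogonal_basis (B := g) ⟨fun v w => hs v w⟩
  refine ⟨b, fun i j hij => hb hij, fun i => ?_⟩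
  exact hb.not_isOrtho_basis_self_of_separatingLeft (fun v hv => hn v hv) i

/-- With P the change of basis and Q its inverse, the Gram matrix is Pᵀ D P with D diagonal, so its
inverse is Q D⁻¹ Qᵀ; cyclicity of the trace then removes P and Q. -/
theorem metricTrace_eq_sum {ι : Type*} [Fintype ι] (g B : V →ₗ[ℝ] V →ₗ[ℝ] ℝ)
    {b : Module.Basis ι ℝ V} (hb : IsOrthogonalBasis (fun v w => g v w) b) :
    metricTrace (fun v w => g v w) (fun v w => B v w)
      = ∑ i, (g (b i) (b i))⁻¹ * B (b i) (b i) := by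
  classical
  set f := Module.finBasis ℝ V
  set D : Matrix ι ι ℝ := Matrix.diagonal fun i => g (b i) (b i) with hD
  set P := b.toMatrix f with hP
  set Q := f.toMatrix b with hQ
  have hQP : Q * P = 1 := Module.Basis.toMatrix_mul_toMatrix_flip _ _
  have hPQ : P * Q = 1 := Module.Basis.toMatrix_mul_toMatrix_flip _ _
  have hDg : LinearMap.toMatrix₂ b b g = D := by
    ext i j
    rw [LinearMap.toMatrix₂_apply, hD]
    by_cases hij : i = j
    · subst hij; simp
    · rw [Matrix.diagonal_apply_ne _ hij]; exact hb.ortho i j hij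
  have hG : (Matrix.of fun k l => g (f k) (f l)) = P.transpose * D * P := by
    rw [← hDg, hP, LinearMap.toMatrix₂_mul_basis_toMatrix]
    ext i j
    simp [LinearMap.toMatrix₂_apply]
  have hBf : (Matrix.of fun k l => B (f k) (f l))
      = P.transpose * LinearMap.toMatrix₂ b b B * P := by
    rw [hP, LinearMap.toMatrix₂_mul_basis_toMatrix]
    ext i j
    simp [LinearMap.toMatrix₂_apply]
  set D' : Matrix ι ι ℝ := Matrix.diagonal fun i => (g (b i) (b i))⁻¹ with hD'
  have hDD : D * D' = 1 := by
    rw [hD, hD', Matrix.diagonal_mul_diagonal, ← Matrix.diagonal_one]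
    congr 1
    ext i
    exact mul_inv_cancel₀ (hb.self_ne i)
  have hinv : (Matrix.of fun k l => g (f k) (f l))⁻¹ = Q * D' * Q.transpose := by
    apply Matrix.inv_eq_right_inv
    rw [hG]
    calc P.transpose * D * P * (Q * D' * Q.transpose)
        = P.transpose * D * (P * Q) * D' * Q.transpose := by simp only [Matrix.mul_assoc]
      _ = P.transpose * (D * D') * Q.transpose := by
        rw [hPQ]; simp only [Matrix.mul_assoc, Matrix.one_mul]
      _ = (Q * P).transpose := by rw [hDD, Matrix.mul_one, Matrix.transpose_mul]
      _ = 1 := by rw [hQP, Matrix.transpose_one]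
  have h1 : metricTrace (fun v w => g v w) (fun v w => B v w)
      = Matrix.trace ((Matrix.of fun k l => g (f k) (f l))⁻¹
        * (Matrix.of fun k l => B (f k) (f l)).transpose) := by
    simp [metricTrace, Matrix.trace, Matrix.mul_apply, f]
  rw [h1, hinv, hBf]
  calc Matrix.trace (Q * D' * Q.transpose * (P.transpose * LinearMap.toMatrix₂ b b B * P).transpose)
      = Matrix.trace (Q * D' * ((P * Q).transpose * (LinearMap.toMatrix₂ b b B).transpose * P)) := by
        simp only [Matrix.transpose_mul, Matrix.transpose_transpose, Matrix.mul_assoc]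
    _ = Matrix.trace (Q * (D' * (LinearMap.toMatrix₂ b b B).transpose * P)) := by
        rw [hPQ, Matrix.transpose_one, Matrix.one_mul]; simp only [Matrix.mul_assoc]
    _ = Matrix.trace (D' * (LinearMap.toMatrix₂ b b B).transpose * (P * Q)) := by
        rw [Matrix.trace_mul_comm, Matrix.mul_assoc]
    _ = _ := by
        rw [hPQ, Matrix.mul_one, Matrix.trace]
        refine Finset.sum_congr rfl fun i _ => ?_
        rw [hD', Matrix.diag_apply, Matrix.diagonal_mul, Matrix.transpose_apply,
          LinearMap.toMatrix₂_apply]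

end Traces

/-- The scalar curvature in an orthogonal basis, as the sum of the (unnormalised) sectional
curvatures. -/
theorem scalarCurvatureVec_eq_sum {E : Type*} [NormedAddCommGroup E] [NormedSpace ℝ E]
    [FiniteDimensional ℝ E] {g : E → E →L[ℝ] E →L[ℝ] ℝ} {y : E}
    (h₁ : ∀ v w, IsLinearMap ℝ fun u => riemannTensor g y u v w)
    (h₂ : ∀ u w, IsLinearMap ℝ fun v => riemannTensor g y u v w)
    (h₃ : ∀ u v, IsLinearMap ℝ fun w => riemannTensor g y u v w)
    {ι : Type*} [Fintype ι] {b : Module.Basis ι ℝ E}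
    (hb : IsOrthogonalBasis (fun v w => g y v w) b) :
    scalarCurvatureVec g y = ∑ j, ∑ i, (g y (b j) (b j))⁻¹ * (g y (b i) (b i))⁻¹ *
      g y (riemannTensor g y (b i) (b j) (b j)) (b i) := by
  let g' : E →ₗ[ℝ] E →ₗ[ℝ] ℝ := (ContinuousLinearMap.coeLM ℝ) ∘ₗ (g y).toLinearMap
  have hb' : IsOrthogonalBasis (fun v w => g' v w) b := hb
  let Ric : E →ₗ[ℝ] E →ₗ[ℝ] ℝ := LinearMap.mk₂ ℝ
    (ricciTensor g y)
    (fun v v' w => by simp [ricciTensor, (h₂ _ _).map_add, Finset.sum_add_distrib])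
    (fun c v w => by simp [ricciTensor, (h₂ _ _).map_smul, Finset.mul_sum])
    (fun v w w' => by simp [ricciTensor, (h₃ _ _).map_add, Finset.sum_add_distrib])
    (fun c v w => by simp [ricciTensor, (h₃ _ _).map_smul, Finset.mul_sum])
  have hRic : ricciTensor g y = fun v w => Ric v w := rfl
  rw [scalarCurvatureVec, hRic]
  refine (metricTrace_eq_sum g' Ric hb').trans ?_
  refine Finset.sum_congr rfl fun j _ => ?_
  let T : E →ₗ[ℝ] E :=
    (h₁ (b j) (b j)).mk' _
  -- `ricciTensor` is a coordinate sum in `Module.finBasis`; being the trace of a linear map, it can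
  -- be computed in `b`.
  have hT : Ric (b j) (b j) = ∑ i, b.coord i (T (b i)) := by
    rw [sum_coord_eq_trace b, ← sum_coord_eq_trace (Module.finBasis ℝ E)]
    rfl
  rw [hT, Finset.mul_sum]
  refine Finset.sum_congr rfl fun i _ => ?_
  rw [hb'.coord_eq]
  simp [g', T, mul_assoc]

/-! ### The Levi-Civita connection in a moving frame -/

section Frame
open Filter Topology

set_option maxSynthPendingDepth 3

theorem eq_add_sub_of_sub_eq_sub {A : Type*} [AddCommGroup A] {a b c d : A}
    (h : a - b = c - d) : b = a + d - c := by
  rw [sub_eq_iff_eq_add] at h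
  rw [h]
  abel

/-- `ContinuousLinearMap.inverse` is 0 by default on maps that are not invertible, so `christoffel`
has its meaning only once this is known. Injectivity suffices because `E` and its dual have the same
dimension. -/
theorem isInvertible_of_nondegenerate {E : Type*} [NormedAddCommGroup E] [NormedSpace ℝ E]
    [FiniteDimensional ℝ E] {g : E →L[ℝ] E →L[ℝ] ℝ} (hg : ∀ v, (∀ w, g v w = 0) → v = 0) :
    g.IsInvertible := by
  have hinj : Function.Injective g.toLinearMap := by
    rw [← LinearMap.ker_eq_bot, LinearMap.ker_eq_bot']
    intro v hv
    refine hg v fun w => ?_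
    have : g v = 0 := hv
    simp [this]
  have hd : Module.finrank ℝ E = Module.finrank ℝ (E →L[ℝ] ℝ) := by
    rw [← (LinearMap.toContinuousLinearMap (𝕜 := ℝ) (E := E) (F' := ℝ)).finrank_eq]
    exact (Subspace.dual_finrank_eq (K := ℝ) (V := E)).symm
  have hsurj := (LinearMap.injective_iff_surjective_of_finrank_eq_finrank hd).1 hinj
  exact ⟨(LinearEquiv.ofBijective g.toLinearMap ⟨hinj, hsurj⟩).toContinuousLinearEquiv, by
    ext; rfl⟩

theorem isInvertible_of_bijective {E V : Type*} [NormedAddCommGroup E] [NormedSpace ℝ E]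
    [NormedAddCommGroup V] [NormedSpace ℝ V] [FiniteDimensional ℝ E] {f : E →L[ℝ] V}
    (hf : Function.Bijective f) : f.IsInvertible :=
  ⟨(LinearEquiv.ofBijective f.toLinearMap hf).toContinuousLinearEquiv, by ext; rfl⟩

/-- A basis of the finite-dimensional `E` identifies operators with tuples of their values, so
regularity can be tested on one vector at a time. -/
theorem differentiableAt_clm_of_apply {D E F : Type*} [NormedAddCommGroup D] [NormedSpace ℝ D]
    [NormedAddCommGroup E] [NormedSpace ℝ E] [FiniteDimensional ℝ E]
    [NormedAddCommGroup F] [NormedSpace ℝ F] {f : D → E →L[ℝ] F} {x : D}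
    (hf : ∀ v, DifferentiableAt ℝ (fun z => f z v) x) : DifferentiableAt ℝ f x := by
  let d := Module.finrank ℝ E
  have hd : d = Module.finrank ℝ (Fin d → ℝ) := (Module.finrank_fin_fun ℝ).symm
  let e₁ := ContinuousLinearEquiv.ofFinrankEq hd
  let e₂ := (e₁.arrowCongr (1 : F ≃L[ℝ] F)).trans (ContinuousLinearEquiv.piRing (Fin d))
  rw [← Function.id_comp f, ← e₂.symm_comp_self]
  exact e₂.symm.differentiableAt.comp x (differentiableAt_pi.mpr fun i => hf _)

theorem contDiffAt_clm_of_apply {D E F : Type*} [NormedAddCommGroup D] [NormedSpace ℝ D]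
    [NormedAddCommGroup E] [NormedSpace ℝ E] [FiniteDimensional ℝ E]
    [NormedAddCommGroup F] [NormedSpace ℝ F] {n : ℕ∞ω} {f : D → E →L[ℝ] F} {x : D}
    (hf : ∀ v, ContDiffAt ℝ n (fun z => f z v) x) : ContDiffAt ℝ n f x := by
  let d := Module.finrank ℝ E
  have hd : d = Module.finrank ℝ (Fin d → ℝ) := (Module.finrank_fin_fun ℝ).symm
  let e₁ := ContinuousLinearEquiv.ofFinrankEq hd
  let e₂ := (e₁.arrowCongr (1 : F ≃L[ℝ] F)).trans (ContinuousLinearEquiv.piRing (Fin d))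
  rw [← Function.id_comp f, ← e₂.symm_comp_self]
  exact e₂.symm.contDiff.contDiffAt.comp x (contDiffAt_pi.mpr fun i => hf _)

variable {E : Type*} [NormedAddCommGroup E] [NormedSpace ℝ E]
  {V : Type*} [NormedAddCommGroup V] [NormedSpace ℝ V]

theorem apply_inverse_of_isInvertible {f : E →L[ℝ] V} (hf : f.IsInvertible) (x : V) :
    f (f.inverse x) = x :=
  ((hf.inverse_apply_eq (y := x)).1 rfl).symm

theorem two_mul_apply_christoffel {g : E → E →L[ℝ] E →L[ℝ] ℝ} {y : E} (hg : (g y).IsInvertible)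
    (u v w : E) : 2 * g y (christoffel g y u v) w
      = fderiv ℝ g y u v w + fderiv ℝ g y v u w - fderiv ℝ g y w u v := by
  have h := (hg.inverse_apply_eq (x := christoffel g y u v)).1 rfl
  rw [← h]
  simp

/-- Uniqueness in the Koszul formula: this is how a guessed expression is recognised as the
Christoffel symbol. -/
theorem christoffel_eq {g : E → E →L[ℝ] E →L[ℝ] ℝ} {y : E} (hg : (g y).IsInvertible)
    {u v x : E} (h : ∀ w, 2 * g y x w
      = fderiv ℝ g y u v w + fderiv ℝ g y v u w - fderiv ℝ g y w u v) :
    christoffel g y u v = x := by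
  rw [christoffel, hg.inverse_apply_eq]
  ext w
  have := h w
  simp
  linarith

/-- The curvature of a connection in a moving frame, as an algebraic expression in the connection
`G`, its derivative `T`, the frame `e` and its exterior derivative `d`, is trilinear. -/
theorem isLinearMap_frameCurvature (G : V →L[ℝ] V →L[ℝ] V) (T : E →L[ℝ] V →L[ℝ] V →L[ℝ] V)
    (e : E →L[ℝ] V) (d : E →L[ℝ] E →L[ℝ] V) {R : E → E → E → V}
    (hR : ∀ u v w, R u v w = T u (e v) (e w) - T v (e u) (e w) + G (e u) (G (e v) (e w))
      - G (e v) (G (e u) (e w)) + G (d u v - d v u) (e w)) :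
    (∀ v w, IsLinearMap ℝ fun u => R u v w) ∧ (∀ u w, IsLinearMap ℝ fun v => R u v w) ∧
    (∀ u v, IsLinearMap ℝ fun w => R u v w) := by
  have T₁ : ∀ u u' a b, T (u + u') a b = T u a b + T u' a b := fun u u' a b => by
    rw [T.map_add]; rfl
  have T₁' : ∀ (c : ℝ) u a b, T (c • u) a b = c • T u a b := fun c u a b => by
    rw [T.map_smul]; rfl
  have T₂ : ∀ u a a' b, T u (a + a') b = T u a b + T u a' b := fun u a a' b => by
    rw [(T u).map_add]; rfl
  have T₂' : ∀ (c : ℝ) u a b, T u (c • a) b = c • T u a b := fun c u a b => by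
    rw [(T u).map_smul]; rfl
  have T₃ : ∀ u a b b', T u a (b + b') = T u a b + T u a b' := fun u a => (T u a).map_add
  have T₃' : ∀ (c : ℝ) u a b, T u a (c • b) = c • T u a b := fun c u a => (T u a).map_smul c
  have G₁ : ∀ a a' b, G (a + a') b = G a b + G a' b := fun a a' b => by rw [G.map_add]; rfl
  have G₁' : ∀ (c : ℝ) a b, G (c • a) b = c • G a b := fun c a b => by rw [G.map_smul]; rfl
  have G₁'' : ∀ a a' b, G (a - a') b = G a b - G a' b := fun a a' b => by rw [G.map_sub]; rfl
  have G₂ : ∀ a b b', G a (b + b') = G a b + G a b' := fun a => (G a).map_add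
  have G₂' : ∀ (c : ℝ) a b, G a (c • b) = c • G a b := fun c a => (G a).map_smul c
  have d₁ : ∀ a a' b, d (a + a') b = d a b + d a' b := fun a a' b => by rw [d.map_add]; rfl
  have d₁' : ∀ (c : ℝ) a b, d (c • a) b = c • d a b := fun c a b => by rw [d.map_smul]; rfl
  have d₂ : ∀ a b b', d a (b + b') = d a b + d a b' := fun a => (d a).map_add
  have d₂' : ∀ (c : ℝ) a b, d a (c • b) = c • d a b := fun c a => (d a).map_smul c
  have e₁ := e.map_add
  have e₁' := e.map_smul
  refine ⟨fun v w => ⟨fun a b => ?_, fun c a => ?_⟩, fun u w => ⟨fun a b => ?_, fun c a => ?_⟩,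
    fun u v => ⟨fun a b => ?_, fun c a => ?_⟩⟩
  · rw [hR, hR, hR, e₁, d₁, d₂, T₁, T₂, G₁, G₁, G₂, G₁'', G₁'', G₁'', G₁, G₁]; abel
  · rw [hR, hR, e₁', d₁', d₂', T₁', T₂', G₁', G₁', G₂', G₁'', G₁'', G₁', G₁']; module
  · rw [hR, hR, hR, e₁, d₁, d₂, T₁, T₂, G₁, G₁, G₂, G₁'', G₁'', G₁'', G₁, G₁]; abel
  · rw [hR, hR, e₁', d₁', d₂', T₁', T₂', G₁', G₁', G₂', G₁'', G₁'', G₁', G₁']; module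
  · rw [hR, hR, hR, e₁, T₃, T₃, G₂, G₂, G₂, G₂, G₂]; abel
  · rw [hR, hR, e₁', T₃', T₃', G₂', G₂', G₂', G₂', G₂']; module

variable [FiniteDimensional ℝ E]

/-- A frame `τ` with a connection `γ` that is torsion free and compatible with the metric `ĝ`. -/
structure IsLeviCivitaFrame (g : E → E →L[ℝ] E →L[ℝ] ℝ) (τ : E → E →L[ℝ] V)
    (ĝ : E → V →L[ℝ] V →L[ℝ] ℝ) (γ : E → V →L[ℝ] V →L[ℝ] V) (z : E) : Prop where
  differentiableAt_metric : DifferentiableAt ℝ ĝ z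
  differentiableAt_frame : DifferentiableAt ℝ τ z
  isInvertible : (τ z).IsInvertible
  symm : ∀ a b, ĝ z a b = ĝ z b a
  nondegenerate : ∀ a, (∀ b, ĝ z a b = 0) → a = 0
  torsion : ∀ u v, fderiv ℝ τ z u v - fderiv ℝ τ z v u
    = γ z (τ z v) (τ z u) - γ z (τ z u) (τ z v)
  metric : ∀ u a b, fderiv ℝ ĝ z u a b = ĝ z (γ z (τ z u) a) b + ĝ z a (γ z (τ z u) b)

/-- The connection γ pulled back by the frame is ∂ + τ⁻¹(∂τ + γ(τ, τ)); it is metric and torsion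
free, hence satisfies the Koszul formula for g. -/
theorem IsLeviCivitaFrame.christoffel_eq {g : E → E →L[ℝ] E →L[ℝ] ℝ} {τ : E → E →L[ℝ] V}
    {ĝ : E → V →L[ℝ] V →L[ℝ] ℝ} {γ : E → V →L[ℝ] V →L[ℝ] V} {z : E}
    (h : IsLeviCivitaFrame g τ ĝ γ z)
    (hg : ∀ᶠ z' in 𝓝 z, g z' = pullbackForm (ĝ z') (τ z')) (u v : E) :
    christoffel g z u v = (τ z).inverse (fderiv ℝ τ z u v + γ z (τ z u) (τ z v)) := by
  have hgz := hg.self_of_nhds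
  have hdg : DifferentiableAt ℝ g z := by
    refine DifferentiableAt.congr_of_eventuallyEq ?_ hg
    refine differentiableAt_clm_of_apply fun v => differentiableAt_clm_of_apply fun w => ?_
    simp only [pullbackForm_apply]
    have h1 := h.differentiableAt_metric
    have h2 := h.differentiableAt_frame
    exact (h1.clm_apply (h2.clm_apply (differentiableAt_const v))).clm_apply
      (h2.clm_apply (differentiableAt_const w))
  have hder : ∀ u v w, fderiv ℝ g z u v w = ĝ z (fderiv ℝ τ z u v + γ z (τ z u) (τ z v)) (τ z w)
      + ĝ z (fderiv ℝ τ z u w + γ z (τ z u) (τ z w)) (τ z v) := by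
    intro u v w
    have e1 : fderiv ℝ g z u v w = fderiv ℝ (fun z' => g z' v w) z u := by
      have := (hdg.hasFDerivAt.clm_apply (hasFDerivAt_const v z)).clm_apply (hasFDerivAt_const w z)
      rw [this.fderiv]; simp
    have e2 : (fun z' => g z' v w) =ᶠ[𝓝 z] fun z' => ĝ z' (τ z' v) (τ z' w) := by
      filter_upwards [hg] with z' hz'
      rw [hz', pullbackForm_apply]
    have hτv := h.differentiableAt_frame.hasFDerivAt.clm_apply (hasFDerivAt_const v z)
    have hτw := h.differentiableAt_frame.hasFDerivAt.clm_apply (hasFDerivAt_const w z)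
    rw [e1, e2.fderiv_eq,
      ((h.differentiableAt_metric.hasFDerivAt.clm_apply hτv).clm_apply hτw).fderiv]
    simp [h.metric]
    rw [h.symm (τ z v), h.symm (τ z v)]
    ring
  have hnd : ∀ v, (∀ w, g z v w = 0) → v = 0 := by
    intro v hv
    obtain ⟨e, he⟩ := h.isInvertible
    have : τ z v = 0 := by
      refine h.nondegenerate _ fun b => ?_
      have := hv (e.symm b)
      rw [hgz, pullbackForm_apply, ← he] at this
      rw [← he]
      simpa using this
    rw [← he] at this
    simpa using this
  refine KaluzaKlein.christoffel_eq (isInvertible_of_nondegenerate hnd) fun w => ?_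
  have hτ : τ z ((τ z).inverse (fderiv ℝ τ z u v + γ z (τ z u) (τ z v)))
      = fderiv ℝ τ z u v + γ z (τ z u) (τ z v) := by
    have := (h.isInvertible.inverse_apply_eq (y := fderiv ℝ τ z u v + γ z (τ z u) (τ z v))).1 rfl
    exact this.symm
  have t1 := h.torsion u v
  have t2 := h.torsion u w
  have t3 := h.torsion v w
  -- The torsion identity trades the three derivatives of τ taken in the wrong order for the other
  -- three; the Koszul formula is then an identity by cancellation.
  have k1 : fderiv ℝ τ z v u = fderiv ℝ τ z u v + γ z (τ z u) (τ z v) - γ z (τ z v) (τ z u) :=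
    eq_add_sub_of_sub_eq_sub t1
  have k2 : fderiv ℝ τ z w u = fderiv ℝ τ z u w + γ z (τ z u) (τ z w) - γ z (τ z w) (τ z u) :=
    eq_add_sub_of_sub_eq_sub t2
  have k3 : fderiv ℝ τ z w v = fderiv ℝ τ z v w + γ z (τ z v) (τ z w) - γ z (τ z w) (τ z v) :=
    eq_add_sub_of_sub_eq_sub t3
  rw [hder, hder, hder, hgz, pullbackForm_apply, hτ, k1, k2, k3]
  simp only [map_add, map_sub, add_apply, sub_apply]
  ring

/-- The Riemann tensor in a moving frame. -/
theorem riemannTensor_frame {g : E → E →L[ℝ] E →L[ℝ] ℝ} {τ : E → E →L[ℝ] V}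
    {ĝ : E → V →L[ℝ] V →L[ℝ] ℝ} {γ : E → V →L[ℝ] V →L[ℝ] V} {y : E}
    (h : ∀ᶠ z in 𝓝 y, IsLeviCivitaFrame g τ ĝ γ z)
    (hg : ∀ᶠ z in 𝓝 y, g z = pullbackForm (ĝ z) (τ z))
    (hτ : ContDiffAt ℝ 2 τ y) (hγ : DifferentiableAt ℝ γ y) (u v w : E) :
    τ y (riemannTensor g y u v w) =
      fderiv ℝ γ y u (τ y v) (τ y w) - fderiv ℝ γ y v (τ y u) (τ y w)
        + γ y (τ y u) (γ y (τ y v) (τ y w)) - γ y (τ y v) (γ y (τ y u) (τ y w))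
        + γ y (fderiv ℝ τ y u v - fderiv ℝ τ y v u) (τ y w) := by
  have hτ1 : DifferentiableAt ℝ τ y := h.self_of_nhds.differentiableAt_frame
  have hτ2 : DifferentiableAt ℝ (fderiv ℝ τ) y :=
    (hτ.fderiv_right (m := 1) (by norm_num)).differentiableAt (by norm_num)
  set N : E → E → E → V := fun v w z => fderiv ℝ τ z v w + γ z (τ z v) (τ z w) with hN
  set L : E → E → E → E := fun v w z => (τ z).inverse (N v w z) with hL
  have hchr : ∀ v w, (fun z => christoffel g z v w) =ᶠ[𝓝 y] L v w := by
    intro v w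
    filter_upwards [h, hg.eventually_nhds] with z hz hz'
    exact hz.christoffel_eq hz' v w
  have hchr' : ∀ v w, christoffel g y v w = L v w y := fun v w => (hchr v w).self_of_nhds
  -- Differentiating the identity τ(Γ(v, w)) = N(v, w) avoids a formula for the derivative of the
  -- inverse of τ; only its differentiability is used.
  have hτL : ∀ v w, (fun z => τ z (L v w z)) =ᶠ[𝓝 y] N v w := by
    intro v w
    filter_upwards [h] with z hz
    exact apply_inverse_of_isInvertible hz.isInvertible _
  have hN' : ∀ v w, HasFDerivAt (N v w) _ y := fun v w =>
    ((hτ2.hasFDerivAt.clm_apply (hasFDerivAt_const v y)).clm_apply (hasFDerivAt_const w y)).add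
    ((hγ.hasFDerivAt.clm_apply (hτ1.hasFDerivAt.clm_apply (hasFDerivAt_const v y))).clm_apply
      (hτ1.hasFDerivAt.clm_apply (hasFDerivAt_const w y)))
  have hLd : ∀ v w, DifferentiableAt ℝ (L v w) y := by
    intro v w
    have hi : DifferentiableAt ℝ (fun z => (τ z).inverse) y :=
      ((h.self_of_nhds.isInvertible.contDiffAt_map_inverse (n := 1)).differentiableAt
        (by norm_num)).comp y hτ1
    exact hi.clm_apply (hN' v w).differentiableAt
  have key : ∀ u v w, τ y (fderiv ℝ (fun z => christoffel g z v w) y u)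
      = fderiv ℝ (fderiv ℝ τ) y u v w + fderiv ℝ γ y u (τ y v) (τ y w)
        + γ y (fderiv ℝ τ y u v) (τ y w) + γ y (τ y v) (fderiv ℝ τ y u w)
        - fderiv ℝ τ y u (christoffel g y v w) := by
    intro u v w
    have h1 : fderiv ℝ (fun z => τ z (L v w z)) y u = fderiv ℝ (N v w) y u := by
      rw [(hτL v w).fderiv_eq]
    rw [(hτ1.hasFDerivAt.clm_apply (hLd v w).hasFDerivAt).fderiv, (hN' v w).fderiv] at h1
    rw [(hchr v w).fderiv_eq, hchr' v w]
    simp at h1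
    rw [eq_sub_iff_add_eq, h1]
    abel
  have hc : ∀ v w, τ y (christoffel g y v w) = fderiv ℝ τ y v w + γ y (τ y v) (τ y w) := by
    intro v w
    rw [hchr' v w]
    exact (hτL v w).self_of_nhds
  -- The second derivative of the frame enters only through its skew part in `u` and `v`, so it
  -- drops out.
  have hsymm : fderiv ℝ (fderiv ℝ τ) y u v = fderiv ℝ (fderiv ℝ τ) y v u :=
    (hτ.isSymmSndFDerivAt (by simp)) u v
  simp only [riemannTensor, map_add, map_sub, key, hc, hsymm, sub_apply]
  abel

/-- The frame formula is visibly trilinear and τ is injective at `y`. Linearity is needed before any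
trace of the curvature can be computed in a basis other than `Module.finBasis`. -/
theorem isLinearMap_riemannTensor {g : E → E →L[ℝ] E →L[ℝ] ℝ} {τ : E → E →L[ℝ] V}
    {ĝ : E → V →L[ℝ] V →L[ℝ] ℝ} {γ : E → V →L[ℝ] V →L[ℝ] V} {y : E}
    (h : ∀ᶠ z in 𝓝 y, IsLeviCivitaFrame g τ ĝ γ z)
    (hg : ∀ᶠ z in 𝓝 y, g z = pullbackForm (ĝ z) (τ z))
    (hτ : ContDiffAt ℝ 2 τ y) (hγ : DifferentiableAt ℝ γ y) :
    (∀ v w, IsLinearMap ℝ fun u => riemannTensor g y u v w) ∧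
    (∀ u w, IsLinearMap ℝ fun v => riemannTensor g y u v w) ∧
    (∀ u v, IsLinearMap ℝ fun w => riemannTensor g y u v w) := by
  obtain ⟨e, he⟩ := h.self_of_nhds.isInvertible
  obtain ⟨h₁, h₂, h₃⟩ := isLinearMap_frameCurvature (γ y) (fderiv ℝ γ y) (τ y) (fderiv ℝ τ y)
    (R := fun u v w => τ y (riemannTensor g y u v w)) (riemannTensor_frame h hg hτ hγ)
  have hinj : Function.Injective (τ y) := by
    rw [← he]
    exact e.injective
  refine ⟨fun v w => ⟨fun a b => hinj ?_, fun c a => hinj ?_⟩,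
    fun u w => ⟨fun a b => hinj ?_, fun c a => hinj ?_⟩,
    fun u v => ⟨fun a b => hinj ?_, fun c a => hinj ?_⟩⟩
  · exact ((h₁ v w).map_add a b).trans ((τ y).map_add _ _).symm
  · exact ((h₁ v w).map_smul c a).trans ((τ y).map_smul _ _).symm
  · exact ((h₂ u w).map_add a b).trans ((τ y).map_add _ _).symm
  · exact ((h₂ u w).map_smul c a).trans ((τ y).map_smul _ _).symm
  · exact ((h₃ u v).map_add a b).trans ((τ y).map_add _ _).symm
  · exact ((h₃ u v).map_smul c a).trans ((τ y).map_smul _ _).symm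

end Frame

/-! ### Christoffel symbols of a smooth metric, and coordinates as a special case of a moving frame.
-/

section Christoffel
open Filter Topology

set_option maxSynthPendingDepth 3

theorem fderiv_clm_apply_const {D E F : Type*} [NormedAddCommGroup D] [NormedSpace ℝ D]
    [NormedAddCommGroup E] [NormedSpace ℝ E] [NormedAddCommGroup F] [NormedSpace ℝ F]
    {f : D → E →L[ℝ] F} {x : D} (hf : DifferentiableAt ℝ f x) (u : D) (v : E) :
    fderiv ℝ (fun z => f z v) x u = fderiv ℝ f x u v := by
  rw [(hf.hasFDerivAt.clm_apply (hasFDerivAt_const v x)).fderiv]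
  simp

theorem fderiv_clm_apply_const₂ {D E E' F : Type*} [NormedAddCommGroup D] [NormedSpace ℝ D]
    [NormedAddCommGroup E] [NormedSpace ℝ E] [NormedAddCommGroup E'] [NormedSpace ℝ E']
    [NormedAddCommGroup F] [NormedSpace ℝ F]
    {f : D → E →L[ℝ] E' →L[ℝ] F} {x : D} (hf : DifferentiableAt ℝ f x) (u : D) (v : E) (w : E') :
    fderiv ℝ (fun z => f z v w) x u = fderiv ℝ f x u v w := by
  rw [fderiv_clm_apply_const (f := fun z => f z v) (hf.clm_apply (differentiableAt_const v)),
    fderiv_clm_apply_const hf]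

variable {E : Type*} [NormedAddCommGroup E] [NormedSpace ℝ E]

/-- The germ at `y` of a smooth pseudo-Riemannian metric on a vector space. -/
structure IsMetricAt (g : E → E →L[ℝ] E →L[ℝ] ℝ) (y : E) : Prop where
  contDiffAt : ContDiffAt ℝ 2 g y
  symm : ∀ᶠ z in 𝓝 y, ∀ v w, g z v w = g z w v
  nondegenerate : ∀ᶠ z in 𝓝 y, ∀ v, (∀ w, g z v w = 0) → v = 0

theorem IsMetricAt.differentiableAt {g : E → E →L[ℝ] E →L[ℝ] ℝ} {y : E} (h : IsMetricAt g y) :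
    DifferentiableAt ℝ g y := h.contDiffAt.differentiableAt (by norm_num)

/-- The identities that follow are themselves differentiated, so they must hold near `y` and not
only at `y`. -/
theorem IsMetricAt.eventually {g : E → E →L[ℝ] E →L[ℝ] ℝ} {y : E} (h : IsMetricAt g y) :
    ∀ᶠ z in 𝓝 y, IsMetricAt g z := by
  filter_upwards [h.contDiffAt.eventually (by simp), h.symm.eventually_nhds,
    h.nondegenerate.eventually_nhds] with z h1 h2 h3
  exact ⟨h1, h2, h3⟩

theorem christoffelForm_apply (T : E →L[ℝ] E →L[ℝ] E →L[ℝ] ℝ) (u v w : E) :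
    ((1 / 2 : ℝ) • (T u v + T v u - (T.flip u).flip v)) w
      = 1 / 2 * (T u v w + T v u w - T w u v) := rfl

theorem add_apply₁ (T : E →L[ℝ] E →L[ℝ] E →L[ℝ] ℝ) (u u' v w : E) :
    T (u + u') v w = T u v w + T u' v w := by rw [T.map_add]; rfl

theorem add_apply₂ (T : E →L[ℝ] E →L[ℝ] E →L[ℝ] ℝ) (u v v' w : E) :
    T u (v + v') w = T u v w + T u v' w := by rw [(T u).map_add]; rfl

theorem smul_apply₁ (T : E →L[ℝ] E →L[ℝ] E →L[ℝ] ℝ) (c : ℝ) (u v w : E) :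
    T (c • u) v w = c * T u v w := by rw [T.map_smul]; rfl

theorem smul_apply₂ (T : E →L[ℝ] E →L[ℝ] E →L[ℝ] ℝ) (c : ℝ) (u v w : E) :
    T u (c • v) w = c * T u v w := by rw [(T u).map_smul]; rfl

theorem IsMetricAt.fderiv_symm {g : E → E →L[ℝ] E →L[ℝ] ℝ} {y : E}
    (h : IsMetricAt g y) (u v w : E) : fderiv ℝ g y u v w = fderiv ℝ g y u w v := by
  rw [← fderiv_clm_apply_const₂ h.differentiableAt, ← fderiv_clm_apply_const₂ h.differentiableAt]
  have : (fun z => g z v w) =ᶠ[𝓝 y] fun z => g z w v := by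
    filter_upwards [h.symm] with z hz using hz v w
  rw [this.fderiv_eq]

variable [FiniteDimensional ℝ E]

/-- The Christoffel symbols as a continuous bilinear map. -/
def christoffelMap (g : E → E →L[ℝ] E →L[ℝ] ℝ) (y : E) : E →L[ℝ] E →L[ℝ] E :=
  (LinearMap.mk₂ ℝ (christoffel g y)
    (fun u u' v => by
      rw [christoffel, christoffel, christoffel, ← ContinuousLinearMap.map_add]
      congr 1
      ext w
      rw [add_apply, christoffelForm_apply, christoffelForm_apply, christoffelForm_apply,
        add_apply₁, add_apply₂, add_apply₂]
      ring)
    (fun c u v => by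
      rw [christoffel, christoffel, ← ContinuousLinearMap.map_smul]
      congr 1
      ext w
      change _ = c * (1 / 2 * (fderiv ℝ g y u v w + fderiv ℝ g y v u w - fderiv ℝ g y w u v))
      rw [christoffelForm_apply,
        smul_apply₁, smul_apply₂, smul_apply₂]
      ring)
    (fun u v v' => by
      rw [christoffel, christoffel, christoffel, ← ContinuousLinearMap.map_add]
      congr 1
      ext w
      rw [add_apply, christoffelForm_apply, christoffelForm_apply, christoffelForm_apply,
        add_apply₁, add_apply₂, map_add]
      ring)
    (fun c u v => by
      rw [christoffel, christoffel, ← ContinuousLinearMap.map_smul]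
      congr 1
      ext w
      change _ = c * (1 / 2 * (fderiv ℝ g y u v w + fderiv ℝ g y v u w - fderiv ℝ g y w u v))
      rw [christoffelForm_apply,
        smul_apply₁, smul_apply₂, map_smul, smul_eq_mul]
      ring)).toContinuousBilinearMap

theorem christoffelMap_apply (g : E → E →L[ℝ] E →L[ℝ] ℝ) (y u v : E) :
    christoffelMap g y u v = christoffel g y u v := rfl

theorem IsMetricAt.isInvertible {g : E → E →L[ℝ] E →L[ℝ] ℝ} {y : E} (h : IsMetricAt g y) :
    (g y).IsInvertible := isInvertible_of_nondegenerate h.nondegenerate.self_of_nhds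

theorem IsMetricAt.differentiableAt_inverse {g : E → E →L[ℝ] E →L[ℝ] ℝ} {y : E}
    (h : IsMetricAt g y) : DifferentiableAt ℝ (fun z => (g z).inverse) y :=
  ((h.isInvertible.contDiffAt_map_inverse (n := 1)).differentiableAt (by norm_num)).comp y
    h.differentiableAt

theorem IsMetricAt.differentiableAt_christoffelMap {g : E → E →L[ℝ] E →L[ℝ] ℝ} {y : E}
    (h : IsMetricAt g y) : DifferentiableAt ℝ (christoffelMap g) y := by
  refine differentiableAt_clm_of_apply fun u => differentiableAt_clm_of_apply fun v => ?_
  simp only [christoffelMap_apply, christoffel]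
  have h2 : DifferentiableAt ℝ (fderiv ℝ g) y :=
    (h.contDiffAt.fderiv_right (m := 1) (by norm_num)).differentiableAt (by norm_num)
  refine h.differentiableAt_inverse.clm_apply (DifferentiableAt.fun_const_smul ?_ _)
  refine differentiableAt_clm_of_apply fun w => ?_
  have key : ∀ a b c : E, DifferentiableAt ℝ (fun z => fderiv ℝ g z a b c) y := fun a b c =>
    ((h2.clm_apply (differentiableAt_const a)).clm_apply (differentiableAt_const b)).clm_apply
      (differentiableAt_const c)
  exact ((key u v w).add (key v u w)).sub (key w u v)

theorem IsMetricAt.christoffel_comm {g : E → E →L[ℝ] E →L[ℝ] ℝ} {y : E}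
    (h : IsMetricAt g y) (u v : E) : christoffel g y u v = christoffel g y v u := by
  refine christoffel_eq h.isInvertible fun w => ?_
  rw [two_mul_apply_christoffel h.isInvertible, h.fderiv_symm w u v]
  ring

/-- Compatibility of the connection with the metric: two Koszul formulas with the last two arguments
exchanged add up to it. -/
theorem IsMetricAt.fderiv_eq {g : E → E →L[ℝ] E →L[ℝ] ℝ} {y : E}
    (h : IsMetricAt g y) (u v w : E) : fderiv ℝ g y u v w
      = g y (christoffel g y u v) w + g y v (christoffel g y u w) := by
  rw [h.symm.self_of_nhds v]
  have h1 := two_mul_apply_christoffel h.isInvertible u v w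
  have h2 := two_mul_apply_christoffel h.isInvertible u w v
  have h3 := h.fderiv_symm u v w
  have h4 := h.fderiv_symm v u w
  have h5 := h.fderiv_symm w u v
  linarith

/-- The coordinate frame is the identity, whose derivative vanishes; the frame results then apply to
the base metric in coordinates. -/
theorem IsMetricAt.isLeviCivitaFrame {g : E → E →L[ℝ] E →L[ℝ] ℝ} {y : E} (h : IsMetricAt g y) :
    IsLeviCivitaFrame g (fun _ => ContinuousLinearMap.id ℝ E) g (christoffelMap g) y where
  differentiableAt_metric := h.differentiableAt
  differentiableAt_frame := differentiableAt_const _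
  isInvertible := ⟨ContinuousLinearEquiv.refl ℝ E, rfl⟩
  symm := h.symm.self_of_nhds
  nondegenerate := h.nondegenerate.self_of_nhds
  torsion u v := by
    simp [christoffelMap_apply, h.christoffel_comm u v]
  metric u v w := by
    simp [christoffelMap_apply, h.fderiv_eq u v w]

theorem IsMetricAt.scalarCurvatureVec_eq_sum {g : E → E →L[ℝ] E →L[ℝ] ℝ} {y : E}
    (h : IsMetricAt g y) {ι : Type*} [Fintype ι] {b : Module.Basis ι ℝ E}
    (hb : IsOrthogonalBasis (fun v w => g y v w) b) :
    scalarCurvatureVec g y = ∑ j, ∑ i, (g y (b j) (b j))⁻¹ * (g y (b i) (b i))⁻¹ *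
      g y (riemannTensor g y (b i) (b j) (b j)) (b i) := by
  obtain ⟨h₁, h₂, h₃⟩ := isLinearMap_riemannTensor (h.eventually.mono fun _ hz =>
    hz.isLeviCivitaFrame) (Eventually.of_forall fun _ => rfl) contDiffAt_const
    h.differentiableAt_christoffelMap
  exact KaluzaKlein.scalarCurvatureVec_eq_sum h₁ h₂ h₃ hb

end Christoffel

/-! ### Bundle metrics in local coordinates -/

section LocalBundle
open Filter Topology

set_option maxSynthPendingDepth 3
set_option linter.unusedSectionVars false

variable {E : Type*} [NormedAddCommGroup E] [NormedSpace ℝ E]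
  {W : Type*} [NormedAddCommGroup W] [NormedSpace ℝ W]
  {A : Type*} [NormedAddCommGroup A] [NormedSpace ℝ A]
  {pr : E → W} {θ : E → E →L[ℝ] A} {h : W → W →L[ℝ] W →L[ℝ] ℝ} {K : A →L[ℝ] A →L[ℝ] ℝ}
  {B : A →L[ℝ] A →L[ℝ] A} {y : E}

/-- The coframe `(dpr, θ)`. -/
def bundleFrame (pr : E → W) (θ : E → E →L[ℝ] A) (z : E) : E →L[ℝ] W × A :=
  (fderiv ℝ pr z).prod (θ z)

/-- The block metric `h ⊕ K` along `pr`. -/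
def blockMetric (pr : E → W) (h : W → W →L[ℝ] W →L[ℝ] ℝ) (K : A →L[ℝ] A →L[ℝ] ℝ) (z : E) :
    W × A →L[ℝ] W × A →L[ℝ] ℝ :=
  pullbackForm (h (pr z)) (ContinuousLinearMap.fst ℝ W A) +
    pullbackForm K (ContinuousLinearMap.snd ℝ W A)

theorem blockMetric_apply (a b : W × A) (z : E) :
    blockMetric pr h K z a b = h (pr z) a.1 b.1 + K a.2 b.2 := rfl

/-- The germ at `y` of the data of a bundle metric in local coordinates: a submersion `pr`, a
connection form `θ`, a metric `h` on the base and an inner product `K` on the fibre, such that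
`dθ(u, v) = B(θ u, θ v)` when `u` is vertical. -/
structure IsLocalBundle (pr : E → W) (θ : E → E →L[ℝ] A) (h : W → W →L[ℝ] W →L[ℝ] ℝ)
    (K : A →L[ℝ] A →L[ℝ] ℝ) (B : A →L[ℝ] A →L[ℝ] A) (y : E) : Prop where
  contDiffAt_proj : ContDiffAt ℝ 3 pr y
  contDiffAt_form : ContDiffAt ℝ 2 θ y
  metric : IsMetricAt h (pr y)
  bijective : ∀ᶠ z in 𝓝 y, Function.Bijective (bundleFrame pr θ z)
  symm : ∀ a b, K a b = K b a
  pos : ∀ a, a ≠ 0 → 0 < K a a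
  skew : ∀ a b c, K (B a b) c = - K b (B a c)
  vertical : ∀ᶠ z in 𝓝 y, ∀ u v, fderiv ℝ pr z u = 0 →
    fderiv ℝ θ z u v - fderiv ℝ θ z v u = B (θ z u) (θ z v)

theorem IsLocalBundle.eventually (hb : IsLocalBundle pr θ h K B y) :
    ∀ᶠ z in 𝓝 y, IsLocalBundle pr θ h K B z := by
  filter_upwards [hb.contDiffAt_proj.eventually (by simp), hb.contDiffAt_form.eventually (by simp),
    hb.contDiffAt_proj.continuousAt.eventually hb.metric.eventually, hb.bijective.eventually_nhds,
    hb.vertical.eventually_nhds] with z h1 h2 h3 h4 h5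
  exact ⟨h1, h2, h3, h4, hb.symm, hb.pos, hb.skew, h5⟩

theorem IsLocalBundle.differentiableAt_proj (hb : IsLocalBundle pr θ h K B y) :
    DifferentiableAt ℝ pr y := hb.contDiffAt_proj.differentiableAt (by norm_num)

theorem IsLocalBundle.differentiableAt_form (hb : IsLocalBundle pr θ h K B y) :
    DifferentiableAt ℝ θ y := hb.contDiffAt_form.differentiableAt (by norm_num)

theorem IsLocalBundle.differentiableAt_fderiv_proj (hb : IsLocalBundle pr θ h K B y) :
    DifferentiableAt ℝ (fderiv ℝ pr) y :=
  (hb.contDiffAt_proj.fderiv_right (m := 2) (by norm_num)).differentiableAt (by norm_num)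

theorem IsLocalBundle.differentiableAt_fderiv_form (hb : IsLocalBundle pr θ h K B y) :
    DifferentiableAt ℝ (fderiv ℝ θ) y :=
  (hb.contDiffAt_form.fderiv_right (m := 1) (by norm_num)).differentiableAt (by norm_num)

variable [FiniteDimensional ℝ E]

theorem IsLocalBundle.contDiffAt_frame (hb : IsLocalBundle pr θ h K B y) :
    ContDiffAt ℝ 2 (bundleFrame pr θ) y := by
  refine contDiffAt_clm_of_apply fun v => ?_
  exact ((hb.contDiffAt_proj.fderiv_right (m := 2) (by norm_num)).clm_apply
    contDiffAt_const).prodMk (hb.contDiffAt_form.clm_apply contDiffAt_const)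

theorem IsLocalBundle.differentiableAt_frame (hb : IsLocalBundle pr θ h K B y) :
    DifferentiableAt ℝ (bundleFrame pr θ) y := hb.contDiffAt_frame.differentiableAt (by norm_num)

theorem IsLocalBundle.isInvertible (hb : IsLocalBundle pr θ h K B y) :
    (bundleFrame pr θ y).IsInvertible := isInvertible_of_bijective hb.bijective.self_of_nhds

theorem IsLocalBundle.fderiv_frame (hb : IsLocalBundle pr θ h K B y) (u v : E) :
    fderiv ℝ (bundleFrame pr θ) y u v = (fderiv ℝ (fderiv ℝ pr) y u v, fderiv ℝ θ y u v) := by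
  rw [← fderiv_clm_apply_const hb.differentiableAt_frame]
  have h1 := hb.differentiableAt_fderiv_proj.clm_apply (differentiableAt_const v)
  have h2 := hb.differentiableAt_form.clm_apply (differentiableAt_const v)
  have : (fun z => bundleFrame pr θ z v) = fun z => (fderiv ℝ pr z v, θ z v) := rfl
  rw [this, h1.fderiv_prodMk h2, ContinuousLinearMap.prod_apply,
    fderiv_clm_apply_const hb.differentiableAt_fderiv_proj,
    fderiv_clm_apply_const hb.differentiableAt_form]

/-- The base part of the coframe is exact, so d(dpr) = 0 by symmetry of second derivatives and only
dθ remains. -/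
theorem IsLocalBundle.extDeriv_frame (hb : IsLocalBundle pr θ h K B y) (u v : E) :
    fderiv ℝ (bundleFrame pr θ) y u v - fderiv ℝ (bundleFrame pr θ) y v u
      = (0, fderiv ℝ θ y u v - fderiv ℝ θ y v u) := by
  have hs : fderiv ℝ (fderiv ℝ pr) y u v = fderiv ℝ (fderiv ℝ pr) y v u :=
    (hb.contDiffAt_proj.isSymmSndFDerivAt (by simp; norm_num)) u v
  rw [hb.fderiv_frame, hb.fderiv_frame, hs]
  simp

/-- The horizontal lift of vectors of the base. -/
def localLift (pr : E → W) (θ : E → E →L[ℝ] A) (z : E) : W →L[ℝ] E :=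
  (bundleFrame pr θ z).inverse ∘L ContinuousLinearMap.inl ℝ W A

theorem IsLocalBundle.frame_localLift (hb : IsLocalBundle pr θ h K B y) (u : W) :
    bundleFrame pr θ y (localLift pr θ y u) = (u, 0) :=
  apply_inverse_of_isInvertible hb.isInvertible _

variable [FiniteDimensional ℝ W]

/-- The curvature `dθ` on horizontal lifts. -/
def localCurvature (pr : E → W) (θ : E → E →L[ℝ] A) (z : E) : W →L[ℝ] W →L[ℝ] A :=
  (LinearMap.mk₂ ℝ (fun u v => fderiv ℝ θ z (localLift pr θ z u) (localLift pr θ z v)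
      - fderiv ℝ θ z (localLift pr θ z v) (localLift pr θ z u))
    (fun u u' v => by simp only [map_add, add_apply]; abel)
    (fun c u v => by simp only [map_smul, smul_apply, smul_sub])
    (fun u v v' => by simp only [map_add, add_apply]; abel)
    (fun c u v => by simp only [map_smul, smul_apply, smul_sub])).toContinuousBilinearMap

theorem localCurvature_apply (pr : E → W) (θ : E → E →L[ℝ] A) (z : E) (u v : W) :
    localCurvature pr θ z u v = fderiv ℝ θ z (localLift pr θ z u) (localLift pr θ z v)
      - fderiv ℝ θ z (localLift pr θ z v) (localLift pr θ z u) := rfl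

theorem localCurvature_swap (pr : E → W) (θ : E → E →L[ℝ] A) (z : E) (u v : W) :
    localCurvature pr θ z v u = - localCurvature pr θ z u v := by
  simp [localCurvature_apply]

theorem localCurvature_self (pr : E → W) (θ : E → E →L[ℝ] A) (z : E) (u : W) :
    localCurvature pr θ z u u = 0 := by
  simp [localCurvature_apply]

theorem IsLocalBundle.differentiableAt_localLift (hb : IsLocalBundle pr θ h K B y) (u : W) :
    DifferentiableAt ℝ (fun z => localLift pr θ z u) y := by
  have : DifferentiableAt ℝ (fun z => (bundleFrame pr θ z).inverse) y :=
    ((hb.isInvertible.contDiffAt_map_inverse (n := 1)).differentiableAt (by norm_num)).comp y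
      hb.differentiableAt_frame
  exact this.clm_apply (differentiableAt_const _)

theorem IsLocalBundle.differentiableAt_localCurvature (hb : IsLocalBundle pr θ h K B y) :
    DifferentiableAt ℝ (localCurvature pr θ) y := by
  refine differentiableAt_clm_of_apply fun u => differentiableAt_clm_of_apply fun v => ?_
  have h1 := hb.differentiableAt_fderiv_form
  have h2 := hb.differentiableAt_localLift
  exact ((h1.clm_apply (h2 u)).clm_apply (h2 v)).sub ((h1.clm_apply (h2 v)).clm_apply (h2 u))

/-- The structure equation `dθ = F + B(θ, θ)`. -/
theorem IsLocalBundle.structure_equation (hb : IsLocalBundle pr θ h K B y) (u v : E) :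
    fderiv ℝ θ y u v - fderiv ℝ θ y v u
      = localCurvature pr θ y (fderiv ℝ pr y u) (fderiv ℝ pr y v) + B (θ y u) (θ y v) := by
  have hdecomp : ∀ u : E, fderiv ℝ pr y (u - localLift pr θ y (fderiv ℝ pr y u)) = 0 ∧
      θ y (localLift pr θ y (fderiv ℝ pr y u)) = 0 := by
    intro u
    have := hb.frame_localLift (fderiv ℝ pr y u)
    have h1 : fderiv ℝ pr y (localLift pr θ y (fderiv ℝ pr y u)) = fderiv ℝ pr y u :=
      congrArg Prod.fst this
    exact ⟨by rw [map_sub, h1, sub_self], congrArg Prod.snd this⟩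
  set σu := localLift pr θ y (fderiv ℝ pr y u) with hσu
  set σv := localLift pr θ y (fderiv ℝ pr y v) with hσv
  have hθ : θ y σu = 0 := (hdecomp u).2
  -- Split off vertical parts one argument at a time. The first split gives dθ(u, v) - dθ(σu, v) =
  -- B(θu, θv); the second shows dθ(σv, σu) = dθ(v, σu), since θ(σu) = 0.
  have e1 := hb.vertical.self_of_nhds (u - σu) v (hdecomp u).1
  have e2 := hb.vertical.self_of_nhds (v - σv) σu (hdecomp v).1
  rw [localCurvature_apply, ← hσu, ← hσv]
  simp only [map_sub, sub_apply, hθ, map_zero, sub_zero] at e1 e2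
  rw [← e1, ← sub_eq_zero]
  rw [← sub_eq_zero] at e2
  rw [← neg_eq_zero, ← e2]
  abel

/-- Each `a` is the value of θ on a vertical vector `u`, and dθ(u, u) = 0. -/
theorem IsLocalBundle.alternating (hb : IsLocalBundle pr θ h K B y) (a : A) : B a a = 0 := by
  obtain ⟨u, hu⟩ := hb.bijective.self_of_nhds.2 (0, a)
  have h1 : fderiv ℝ pr y u = 0 := congrArg Prod.fst hu
  have h2 : θ y u = a := congrArg Prod.snd hu
  have := hb.vertical.self_of_nhds u u h1
  rw [h2, sub_self] at this
  exact this.symm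

theorem IsLocalBundle.swap (hb : IsLocalBundle pr θ h K B y) (a b : A) : B b a = - B a b := by
  have := hb.alternating (a + b)
  simp only [map_add, add_apply, hb.alternating, zero_add, add_zero] at this
  rwa [eq_neg_iff_add_eq_zero]

variable [FiniteDimensional ℝ A]

/-- The adjoint of the curvature: `h(F*(u, b), w) = K(F(u, w), b)`. -/
def curvatureAdjoint (pr : E → W) (θ : E → E →L[ℝ] A) (h : W → W →L[ℝ] W →L[ℝ] ℝ)
    (K : A →L[ℝ] A →L[ℝ] ℝ) (z : E) : W →L[ℝ] A →L[ℝ] W :=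
  (LinearMap.mk₂ ℝ (fun u b => (h (pr z)).inverse ((K.flip b) ∘L localCurvature pr θ z u))
    (fun u u' b => by rw [map_add, ContinuousLinearMap.comp_add, map_add])
    (fun c u b => by rw [map_smul, ContinuousLinearMap.comp_smul, map_smul])
    (fun u b b' => by rw [map_add, ContinuousLinearMap.add_comp, map_add])
    (fun c u b => by rw [map_smul, ContinuousLinearMap.smul_comp, map_smul])
    ).toContinuousBilinearMap

theorem IsLocalBundle.apply_curvatureAdjoint (hb : IsLocalBundle pr θ h K B y) (u w : W) (b : A) :
    h (pr y) (curvatureAdjoint pr θ h K y u b) w = K (localCurvature pr θ y u w) b := by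
  have : h (pr y) (curvatureAdjoint pr θ h K y u b) = (K.flip b) ∘L localCurvature pr θ y u :=
    apply_inverse_of_isInvertible hb.metric.isInvertible _
  rw [this]
  rfl

theorem IsLocalBundle.differentiableAt_curvatureAdjoint (hb : IsLocalBundle pr θ h K B y) (u : W)
    (b : A) : DifferentiableAt ℝ (fun z => curvatureAdjoint pr θ h K z u b) y := by
  have h1 : DifferentiableAt ℝ (fun z => (h (pr z)).inverse) y :=
    hb.metric.differentiableAt_inverse.comp y hb.differentiableAt_proj
  exact h1.clm_apply ((differentiableAt_const _).clm_comp
    (hb.differentiableAt_localCurvature.clm_apply (differentiableAt_const u)))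

/-- The Levi-Civita connection of a bundle metric in the frame `(dpr, θ)`. -/
def bundleConnection (pr : E → W) (θ : E → E →L[ℝ] A) (h : W → W →L[ℝ] W →L[ℝ] ℝ)
    (K : A →L[ℝ] A →L[ℝ] ℝ) (B : A →L[ℝ] A →L[ℝ] A) (z : E) : W × A →L[ℝ] W × A →L[ℝ] W × A :=
  (LinearMap.mk₂ ℝ (fun a b => (christoffelMap h (pr z) a.1 b.1
        + (1 / 2 : ℝ) • curvatureAdjoint pr θ h K z a.1 b.2
        + (1 / 2 : ℝ) • curvatureAdjoint pr θ h K z b.1 a.2,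
      -((1 / 2 : ℝ) • localCurvature pr θ z a.1 b.1) - (1 / 2 : ℝ) • B a.2 b.2))
    (fun a a' b => by
      ext <;> simp only [Prod.fst_add, Prod.snd_add, map_add, add_apply] <;> module)
    (fun c a b => by
      ext <;> simp only [Prod.smul_fst, Prod.smul_snd, map_smul, smul_apply] <;> module)
    (fun a b b' => by
      ext <;> simp only [Prod.fst_add, Prod.snd_add, map_add, add_apply] <;> module)
    (fun c a b => by
      ext <;> simp only [Prod.smul_fst, Prod.smul_snd, map_smul, smul_apply] <;> module)
    ).toContinuousBilinearMap

theorem bundleConnection_apply (z : E) (a b : W × A) : bundleConnection pr θ h K B z a b =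
    (christoffel h (pr z) a.1 b.1 + (1 / 2 : ℝ) • curvatureAdjoint pr θ h K z a.1 b.2
        + (1 / 2 : ℝ) • curvatureAdjoint pr θ h K z b.1 a.2,
      -((1 / 2 : ℝ) • localCurvature pr θ z a.1 b.1) - (1 / 2 : ℝ) • B a.2 b.2) := rfl

theorem IsLocalBundle.differentiableAt_christoffel (hb : IsLocalBundle pr θ h K B y) (u v : W) :
    DifferentiableAt ℝ (fun z => christoffel h (pr z) u v) y := by
  have h1 : DifferentiableAt ℝ (fun z => christoffelMap h (pr z)) y :=
    hb.metric.differentiableAt_christoffelMap.comp y hb.differentiableAt_proj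
  exact (h1.clm_apply (differentiableAt_const u)).clm_apply (differentiableAt_const v)

theorem IsLocalBundle.differentiableAt_bundleConnection (hb : IsLocalBundle pr θ h K B y) :
    DifferentiableAt ℝ (bundleConnection pr θ h K B) y := by
  refine differentiableAt_clm_of_apply fun a => differentiableAt_clm_of_apply fun b => ?_
  simp only [bundleConnection_apply]
  refine DifferentiableAt.prodMk ?_ ?_
  · exact ((hb.differentiableAt_christoffel _ _).add
      ((hb.differentiableAt_curvatureAdjoint _ _).fun_const_smul _)).add
      ((hb.differentiableAt_curvatureAdjoint _ _).fun_const_smul _)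
  · exact ((((hb.differentiableAt_localCurvature.clm_apply (differentiableAt_const _)).clm_apply
      (differentiableAt_const _)).fun_const_smul _).neg).sub (differentiableAt_const _)

theorem IsLocalBundle.differentiableAt_blockMetric (hb : IsLocalBundle pr θ h K B y) :
    DifferentiableAt ℝ (blockMetric pr h K) y := by
  refine differentiableAt_clm_of_apply fun a => differentiableAt_clm_of_apply fun b => ?_
  simp only [blockMetric_apply]
  have h1 : DifferentiableAt ℝ (fun z => h (pr z)) y :=
    hb.metric.differentiableAt.comp y hb.differentiableAt_proj
  exact ((h1.clm_apply (differentiableAt_const _)).clm_apply (differentiableAt_const _)).add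
    (differentiableAt_const _)

theorem IsLocalBundle.fderiv_comp_proj {F : Type*} [NormedAddCommGroup F] [NormedSpace ℝ F]
    (hb : IsLocalBundle pr θ h K B y) {f : W → F} (hf : DifferentiableAt ℝ f (pr y)) (u : E) :
    fderiv ℝ (fun z => f (pr z)) y u = fderiv ℝ f (pr y) (fderiv ℝ pr y u) := by
  have := (hf.hasFDerivAt.comp y hb.differentiableAt_proj.hasFDerivAt).fderiv
  exact congrArg (fun l => l u) this

/-- Vanishing torsion asks that the fibre component have skew part -½(F + B) and the base component
be symmetric. Compatibility with h ⊕ K then makes the ½F* terms cancel the -½F term, and the B term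
cancels because B is skew for K. -/
theorem IsLocalBundle.isLeviCivitaFrame (hb : IsLocalBundle pr θ h K B y)
    (g : E → E →L[ℝ] E →L[ℝ] ℝ) :
    IsLeviCivitaFrame g (bundleFrame pr θ) (blockMetric pr h K) (bundleConnection pr θ h K B) y where
  differentiableAt_metric := hb.differentiableAt_blockMetric
  differentiableAt_frame := hb.differentiableAt_frame
  isInvertible := hb.isInvertible
  symm a b := by
    rw [blockMetric_apply, blockMetric_apply, hb.symm, hb.metric.symm.self_of_nhds]
  nondegenerate a ha := by
    have h1 : a.1 = 0 := by
      refine hb.metric.nondegenerate.self_of_nhds _ fun w => ?_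
      simpa [blockMetric_apply] using ha (w, 0)
    have h2 : a.2 = 0 := by
      by_contra hne
      have := ha (0, a.2)
      simp only [blockMetric_apply, map_zero, zero_add] at this
      exact (hb.pos _ hne).ne' this
    exact Prod.ext h1 h2
  torsion u v := by
    rw [hb.extDeriv_frame, hb.structure_equation, bundleConnection_apply, bundleConnection_apply]
    simp only [bundleFrame, ContinuousLinearMap.prod_apply]
    rw [hb.metric.christoffel_comm (fderiv ℝ pr y v), localCurvature_swap pr θ y (fderiv ℝ pr y u),
      hb.swap (θ y u)]
    ext <;> simp only [Prod.fst_sub, Prod.snd_sub] <;> module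
  metric u a b := by
    have h1 : fderiv ℝ (blockMetric pr h K) y u a b
        = fderiv ℝ h (pr y) (fderiv ℝ pr y u) a.1 b.1 := by
      rw [← fderiv_clm_apply_const₂ hb.differentiableAt_blockMetric]
      simp only [blockMetric_apply, fderiv_add_const]
      rw [hb.fderiv_comp_proj (f := fun x => h x a.1 b.1), fderiv_clm_apply_const₂
        hb.metric.differentiableAt]
      exact (hb.metric.differentiableAt.clm_apply (differentiableAt_const _)).clm_apply
        (differentiableAt_const _)
    rw [h1, hb.metric.fderiv_eq, blockMetric_apply, blockMetric_apply, bundleConnection_apply,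
      bundleConnection_apply]
    simp only [bundleFrame, ContinuousLinearMap.prod_apply, map_add, map_sub, map_neg, map_smul,
      add_apply, sub_apply, neg_apply, smul_apply, hb.apply_curvatureAdjoint]
    rw [hb.metric.symm.self_of_nhds a.1 (curvatureAdjoint _ _ _ _ _ _ _),
      hb.metric.symm.self_of_nhds a.1 (curvatureAdjoint _ _ _ _ _ _ _),
      hb.apply_curvatureAdjoint, hb.apply_curvatureAdjoint, localCurvature_swap pr θ y a.1 b.1,
      hb.skew, hb.symm a.2 (localCurvature _ _ _ _ _)]
    simp only [map_neg, neg_apply, smul_eq_mul]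
    ring

end LocalBundle

/-! ### The square norm of a vector-valued bilinear map in an orthogonal basis. -/

section DoubleTrace

/-- A continuous bilinear form as a bilinear form. -/
def toLinForm {V : Type*} [NormedAddCommGroup V] [NormedSpace ℝ V] (g : V →L[ℝ] V →L[ℝ] ℝ) :
    V →ₗ[ℝ] V →ₗ[ℝ] ℝ := (ContinuousLinearMap.coeLM ℝ) ∘ₗ g.toLinearMap

theorem metricTrace_metricTrace_eq_sum {V A : Type*} [NormedAddCommGroup V] [NormedSpace ℝ V]
    [FiniteDimensional ℝ V] [NormedAddCommGroup A] [NormedSpace ℝ A]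
    (g : V →L[ℝ] V →L[ℝ] ℝ) (K : A →L[ℝ] A →L[ℝ] ℝ) (F : V →L[ℝ] V →L[ℝ] A)
    {ι : Type*} [Fintype ι] {b : Module.Basis ι ℝ V}
    (hb : IsOrthogonalBasis (fun v w => g v w) b) :
    metricTrace (fun u u' => g u u') (fun u u' =>
      metricTrace (fun v v' => g v v') (fun v v' => K (F u v) (F u' v')))
      = ∑ i, ∑ j, (g (b i) (b i))⁻¹ * (g (b j) (b j))⁻¹ * K (F (b i) (b j)) (F (b i) (b j)) := by
  have hb' : IsOrthogonalBasis (fun v w => toLinForm g v w) b := hb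
  have h1 : ∀ u u', metricTrace (fun v v' => g v v') (fun v v' => K (F u v) (F u' v'))
      = ∑ j, (g (b j) (b j))⁻¹ * K (F u (b j)) (F u' (b j)) := fun u u' =>
    metricTrace_eq_sum (toLinForm g) (LinearMap.mk₂ ℝ (fun v v' => K (F u v) (F u' v'))
      (by simp) (by simp) (by simp) (by simp)) hb'
  simp only [h1]
  refine (metricTrace_eq_sum (toLinForm g) (LinearMap.mk₂ ℝ
    (fun u u' => ∑ j, (g (b j) (b j))⁻¹ * K (F u (b j)) (F u' (b j)))
    (by simp [mul_add, Finset.sum_add_distrib])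
    (by intros; simp only [map_smul, smul_apply, Finset.mul_sum, smul_eq_mul]
        exact Finset.sum_congr rfl fun _ _ => by ring)
    (by simp [mul_add, Finset.sum_add_distrib])
    (by intros; simp only [map_smul, smul_apply, Finset.mul_sum, smul_eq_mul]
        exact Finset.sum_congr rfl fun _ _ => by ring)) hb').trans ?_
  refine Finset.sum_congr rfl fun i _ => ?_
  rw [LinearMap.mk₂_apply, Finset.mul_sum]
  exact Finset.sum_congr rfl fun _ _ => (mul_assoc _ _ _).symm

end DoubleTrace

/-! ### Curvature of a bundle metric in local coordinates: O'Neill's formulas and their sum. -/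

section LocalBundle
open Filter Topology

set_option maxSynthPendingDepth 3
set_option linter.unusedSectionVars false

variable {E : Type*} [NormedAddCommGroup E] [NormedSpace ℝ E] [FiniteDimensional ℝ E]
  {W : Type*} [NormedAddCommGroup W] [NormedSpace ℝ W] [FiniteDimensional ℝ W]
  {A : Type*} [NormedAddCommGroup A] [NormedSpace ℝ A] [FiniteDimensional ℝ A]
  {pr : E → W} {θ : E → E →L[ℝ] A} {h : W → W →L[ℝ] W →L[ℝ] ℝ} {K : A →L[ℝ] A →L[ℝ] ℝ}
  {B : A →L[ℝ] A →L[ℝ] A} {y : E}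

theorem bundleConnection_inl_inl (z : E) (u v : W) :
    bundleConnection pr θ h K B z (u, 0) (v, 0)
      = (christoffel h (pr z) u v, -((1 / 2 : ℝ) • localCurvature pr θ z u v)) := by
  simp [bundleConnection_apply]

theorem bundleConnection_inl_inr (z : E) (u : W) (b : A) :
    bundleConnection pr θ h K B z (u, 0) (0, b)
      = ((1 / 2 : ℝ) • curvatureAdjoint pr θ h K z u b, 0) := by
  simp [bundleConnection_apply, ← christoffelMap_apply]

theorem bundleConnection_inr_inl (z : E) (a : A) (v : W) :
    bundleConnection pr θ h K B z (0, a) (v, 0)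
      = ((1 / 2 : ℝ) • curvatureAdjoint pr θ h K z v a, 0) := by
  simp [bundleConnection_apply, ← christoffelMap_apply]

theorem bundleConnection_inr_inr (z : E) (a b : A) :
    bundleConnection pr θ h K B z (0, a) (0, b) = (0, -((1 / 2 : ℝ) • B a b)) := by
  simp [bundleConnection_apply, ← christoffelMap_apply]

theorem IsLocalBundle.fderiv_christoffel (hb : IsLocalBundle pr θ h K B y) (u : E) (v w : W) :
    fderiv ℝ (fun z => christoffel h (pr z) v w) y u
      = fderiv ℝ (fun x => christoffel h x v w) (pr y) (fderiv ℝ pr y u) :=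
  hb.fderiv_comp_proj (f := fun x => christoffel h x v w)
    ((hb.metric.differentiableAt_christoffelMap.clm_apply (differentiableAt_const v)).clm_apply
      (differentiableAt_const w)) u

theorem IsLocalBundle.fderiv_connection_inl_inl (hb : IsLocalBundle pr θ h K B y) (u : E)
    (v w : W) : fderiv ℝ (bundleConnection pr θ h K B) y u (v, 0) (w, 0)
      = (fderiv ℝ (fun x => christoffel h x v w) (pr y) (fderiv ℝ pr y u),
        -((1 / 2 : ℝ) • fderiv ℝ (localCurvature pr θ) y u v w)) := by
  rw [← fderiv_clm_apply_const₂ hb.differentiableAt_bundleConnection]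
  simp only [bundleConnection_inl_inl]
  have h1 : DifferentiableAt ℝ (fun z => localCurvature pr θ z v w) y :=
    (hb.differentiableAt_localCurvature.clm_apply (differentiableAt_const v)).clm_apply
      (differentiableAt_const w)
  rw [(hb.differentiableAt_christoffel v w).fderiv_prodMk (h1.fun_const_smul (1 / 2 : ℝ)).fun_neg,
    ContinuousLinearMap.prod_apply, hb.fderiv_christoffel]
  congr 1
  rw [fderiv_fun_neg, fderiv_fun_const_smul h1, neg_apply, smul_apply,
    fderiv_clm_apply_const₂ hb.differentiableAt_localCurvature]

theorem IsLocalBundle.fderiv_localCurvature_self (hb : IsLocalBundle pr θ h K B y) (u : E)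
    (v : W) : fderiv ℝ (localCurvature pr θ) y u v v = 0 := by
  rw [← fderiv_clm_apply_const₂ hb.differentiableAt_localCurvature]
  simp [localCurvature_self]

theorem IsLocalBundle.fderiv_connection_inl_inr (hb : IsLocalBundle pr θ h K B y) (u : E)
    (v : W) (b : A) : fderiv ℝ (bundleConnection pr θ h K B) y u (v, 0) (0, b)
      = ((1 / 2 : ℝ) • fderiv ℝ (fun z => curvatureAdjoint pr θ h K z v b) y u, 0) := by
  rw [← fderiv_clm_apply_const₂ hb.differentiableAt_bundleConnection]
  simp only [bundleConnection_inl_inr]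
  have h1 := hb.differentiableAt_curvatureAdjoint v b
  rw [(h1.fun_const_smul (1 / 2 : ℝ)).fderiv_prodMk (differentiableAt_const _),
    ContinuousLinearMap.prod_apply, fderiv_fun_const_smul h1]
  simp

theorem IsLocalBundle.fderiv_connection_inr_inl (hb : IsLocalBundle pr θ h K B y) (u : E)
    (v : W) (b : A) : fderiv ℝ (bundleConnection pr θ h K B) y u (0, b) (v, 0)
      = ((1 / 2 : ℝ) • fderiv ℝ (fun z => curvatureAdjoint pr θ h K z v b) y u, 0) := by
  rw [← fderiv_clm_apply_const₂ hb.differentiableAt_bundleConnection]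
  simp only [bundleConnection_inr_inl]
  have h1 := hb.differentiableAt_curvatureAdjoint v b
  rw [(h1.fun_const_smul (1 / 2 : ℝ)).fderiv_prodMk (differentiableAt_const _),
    ContinuousLinearMap.prod_apply, fderiv_fun_const_smul h1]
  simp

theorem IsLocalBundle.fderiv_connection_inr_inr (hb : IsLocalBundle pr θ h K B y) (u : E)
    (a b : A) : fderiv ℝ (bundleConnection pr θ h K B) y u (0, a) (0, b) = 0 := by
  rw [← fderiv_clm_apply_const₂ hb.differentiableAt_bundleConnection]
  simp only [bundleConnection_inr_inr]
  simp

/-- The function h(F*(v, b), v) = K(F(v, v), b) vanishes near `y`, and h ∘ pr has zero derivative in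
a vertical direction, so only the derivative of F* survives. This removes the derivative of the
connection from the mixed curvatures. -/
theorem IsLocalBundle.apply_fderiv_curvatureAdjoint_self (hb : IsLocalBundle pr θ h K B y) {u : E}
    (hu : fderiv ℝ pr y u = 0) (v : W) (b : A) :
    h (pr y) (fderiv ℝ (fun z => curvatureAdjoint pr θ h K z v b) y u) v = 0 := by
  have h1 : (fun z => h (pr z) (curvatureAdjoint pr θ h K z v b) v) =ᶠ[𝓝 y] fun _ => 0 := by
    filter_upwards [hb.eventually] with z hz
    rw [hz.apply_curvatureAdjoint, localCurvature_self, map_zero, zero_apply]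
  have h2 : DifferentiableAt ℝ (fun z => h (pr z)) y :=
    hb.metric.differentiableAt.comp y hb.differentiableAt_proj
  have h3 := hb.differentiableAt_curvatureAdjoint v b
  have h4 : fderiv ℝ (fun z => h (pr z) (curvatureAdjoint pr θ h K z v b) v) y u = 0 := by
    rw [h1.fderiv_eq]
    simp
  rw [((h2.hasFDerivAt.clm_apply h3.hasFDerivAt).clm_apply (hasFDerivAt_const v y)).fderiv] at h4
  have h5 : fderiv ℝ (fun z => h (pr z)) y u = 0 := by
    rw [hb.fderiv_comp_proj hb.metric.differentiableAt, hu, map_zero]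
  simpa [h5] using h4

/-- The curvature of a bundle metric applied to `(u, v, v, u)`. -/
theorem IsLocalBundle.apply_riemannTensor (hb : IsLocalBundle pr θ h K B y)
    {g : E → E →L[ℝ] E →L[ℝ] ℝ}
    (hg : ∀ᶠ z in 𝓝 y, g z = pullbackForm (blockMetric pr h K z) (bundleFrame pr θ z)) (u v : E)
    {a b : W × A} (ha : bundleFrame pr θ y u = a) (hv : bundleFrame pr θ y v = b) :
    g y (riemannTensor g y u v v) u = blockMetric pr h K y
      (fderiv ℝ (bundleConnection pr θ h K B) y u b b
        - fderiv ℝ (bundleConnection pr θ h K B) y v a b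
        + bundleConnection pr θ h K B y a (bundleConnection pr θ h K B y b b)
        - bundleConnection pr θ h K B y b (bundleConnection pr θ h K B y a b)
        + bundleConnection pr θ h K B y (0, localCurvature pr θ y a.1 b.1 + B a.2 b.2) b) a := by
  have h1 : fderiv ℝ pr y u = a.1 := congrArg Prod.fst ha
  have h2 : fderiv ℝ pr y v = b.1 := congrArg Prod.fst hv
  have h3 : θ y u = a.2 := congrArg Prod.snd ha
  have h4 : θ y v = b.2 := congrArg Prod.snd hv
  rw [hg.self_of_nhds, pullbackForm_apply, riemannTensor_frame
    (hb.eventually.mono fun _ hz => hz.isLeviCivitaFrame g) hg hb.contDiffAt_frame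
    hb.differentiableAt_bundleConnection, hb.extDeriv_frame, hb.structure_equation, ha, hv,
    h1, h2, h3, h4]

variable {g : E → E →L[ℝ] E →L[ℝ] ℝ}

/-- The term γ(b, γ(a, b)) contributes -¼|F(a, b)|², and the term with the vertical part F(a, b) of
dτ contributes -½|F(a, b)|². Derivatives of F are vertical and do not pair with `a`. -/
theorem IsLocalBundle.apply_riemannTensor_inl_inl (hb : IsLocalBundle pr θ h K B y)
    (hg : ∀ᶠ z in 𝓝 y, g z = pullbackForm (blockMetric pr h K z) (bundleFrame pr θ z)) {u v : E}
    {a b : W} (ha : bundleFrame pr θ y u = (a, 0)) (hv : bundleFrame pr θ y v = (b, 0)) :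
    g y (riemannTensor g y u v v) u = h (pr y) (riemannTensor h (pr y) a b b) a
      - 3 / 4 * K (localCurvature pr θ y a b) (localCurvature pr θ y a b) := by
  have h1 : fderiv ℝ pr y u = a := congrArg Prod.fst ha
  have h2 : fderiv ℝ pr y v = b := congrArg Prod.fst hv
  rw [hb.apply_riemannTensor hg u v ha hv, hb.fderiv_connection_inl_inl,
    hb.fderiv_connection_inl_inl, h1, h2]
  simp only [blockMetric_apply, bundleConnection_apply, riemannTensor, localCurvature_self,
    map_add, map_sub, map_neg, map_smul, map_zero, add_apply,
    sub_apply, smul_apply, smul_eq_mul, hb.apply_curvatureAdjoint, neg_zero, smul_zero, sub_zero,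
    add_zero, zero_apply]
  rw [localCurvature_swap pr θ y a b]
  simp only [map_neg, neg_apply, ← christoffelMap_apply, map_zero, zero_apply, smul_apply,
    smul_eq_mul, hb.apply_curvatureAdjoint]
  rw [localCurvature_swap pr θ y a b]
  simp only [map_neg, neg_apply]
  ring

/-- Only -γ(b, γ(a, b)) = -¼F*(F*(a, b), b) survives: B(b, b) = 0, and the derivative of F*(a, b)
along the fibre is orthogonal to `a`. -/
theorem IsLocalBundle.apply_riemannTensor_inl_inr (hb : IsLocalBundle pr θ h K B y)
    (hg : ∀ᶠ z in 𝓝 y, g z = pullbackForm (blockMetric pr h K z) (bundleFrame pr θ z)) {u v : E}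
    {a : W} {b : A} (ha : bundleFrame pr θ y u = (a, 0)) (hv : bundleFrame pr θ y v = (0, b)) :
    g y (riemannTensor g y u v v) u = 1 / 4 *
      h (pr y) (curvatureAdjoint pr θ h K y a b) (curvatureAdjoint pr θ h K y a b) := by
  have h2 : fderiv ℝ pr y v = 0 := congrArg Prod.fst hv
  rw [hb.apply_riemannTensor hg u v ha hv, hb.fderiv_connection_inr_inr,
    hb.fderiv_connection_inl_inr]
  have h3 := hb.apply_fderiv_curvatureAdjoint_self h2 a b
  simp only [bundleConnection_inr_inr, bundleConnection_inl_inr, bundleConnection_inr_inl,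
    hb.alternating, blockMetric_apply, map_add, map_sub, map_smul,
    map_zero, add_apply, sub_apply, smul_apply, smul_eq_mul, h3, neg_zero, smul_zero,
    zero_apply, hb.apply_curvatureAdjoint, ← Prod.zero_eq_mk]
  rw [localCurvature_swap pr θ y a, map_neg, neg_apply, ← hb.apply_curvatureAdjoint]
  ring

/-- Computed directly instead of by the pair symmetry of the Riemann tensor. Only the fibre
component pairs with `a`; there F(b, b) = 0 and its derivative drop out, leaving ¼K(F(b, F*(b, a)),
a). -/
theorem IsLocalBundle.apply_riemannTensor_inr_inl (hb : IsLocalBundle pr θ h K B y)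
    (hg : ∀ᶠ z in 𝓝 y, g z = pullbackForm (blockMetric pr h K z) (bundleFrame pr θ z)) {u v : E}
    {a : A} {b : W} (ha : bundleFrame pr θ y u = (0, a)) (hv : bundleFrame pr θ y v = (b, 0)) :
    g y (riemannTensor g y u v v) u = 1 / 4 *
      h (pr y) (curvatureAdjoint pr θ h K y b a) (curvatureAdjoint pr θ h K y b a) := by
  rw [hb.apply_riemannTensor hg u v ha hv, hb.fderiv_connection_inl_inl,
    hb.fderiv_connection_inr_inl, bundleConnection_inl_inl, bundleConnection_inr_inl,
    bundleConnection_inl_inl, localCurvature_self, hb.fderiv_localCurvature_self]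
  simp only [smul_zero, neg_zero, bundleConnection_inr_inl, blockMetric_apply, Prod.snd_add,
    Prod.snd_sub, map_zero, zero_apply, zero_add, ← Prod.zero_eq_mk, sub_zero, zero_sub,
    map_smul, smul_apply, smul_eq_mul, ← hb.apply_curvatureAdjoint,
    add_zero, neg_neg]
  ring

/-- The terms add up to (-¼ + ½)B(b, B(a, b)), and skewness of B moves one `b` across K. The Jacobi
identity is not needed. -/
theorem IsLocalBundle.apply_riemannTensor_inr_inr (hb : IsLocalBundle pr θ h K B y)
    (hg : ∀ᶠ z in 𝓝 y, g z = pullbackForm (blockMetric pr h K z) (bundleFrame pr θ z)) {u v : E}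
    {a b : A} (ha : bundleFrame pr θ y u = (0, a)) (hv : bundleFrame pr θ y v = (0, b)) :
    g y (riemannTensor g y u v v) u = 1 / 4 * K (B a b) (B a b) := by
  rw [hb.apply_riemannTensor hg u v ha hv, hb.fderiv_connection_inr_inr,
    hb.fderiv_connection_inr_inr, bundleConnection_inr_inr, bundleConnection_inr_inr,
    bundleConnection_inr_inr, hb.alternating]
  simp only [map_zero, zero_add, smul_zero, neg_zero, bundleConnection_inr_inr,
    blockMetric_apply, sub_zero, zero_sub,
    ← Prod.zero_eq_mk, map_neg, map_smul, add_apply, neg_apply, smul_apply,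
    smul_eq_mul, map_add]
  rw [hb.swap b (B a b), map_neg, neg_apply, hb.skew b (B a b), hb.swap a b]
  simp only [map_neg]
  ring

theorem IsLocalBundle.exists_basis (hb : IsLocalBundle pr θ h K B y)
    (hg : g y = pullbackForm (blockMetric pr h K y) (bundleFrame pr θ y))
    {ι κ : Type*} [Fintype ι] [Fintype κ] {bW : Module.Basis ι ℝ W} {bA : Module.Basis κ ℝ A}
    (hW : IsOrthogonalBasis (fun v w => h (pr y) v w) bW)
    (hA : IsOrthogonalBasis (fun v w => K v w) bA) :
    ∃ b : Module.Basis (ι ⊕ κ) ℝ E, IsOrthogonalBasis (fun v w => g y v w) b ∧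
      (∀ i, bundleFrame pr θ y (b (Sum.inl i)) = (bW i, 0)) ∧
      (∀ k, bundleFrame pr θ y (b (Sum.inr k)) = (0, bA k)) := by
  obtain ⟨e, he⟩ := hb.isInvertible
  refine ⟨(bW.prod bA).map e.symm.toLinearEquiv, ?_, ?_⟩
  · constructor
    · rintro (i | i) (j | j) hij <;> simp only [hg, pullbackForm_apply, ← he]
      · simpa [blockMetric_apply] using hW.ortho i j (by simpa using hij)
      · simp [blockMetric_apply]
      · simp [blockMetric_apply]
      · simpa [blockMetric_apply] using hA.ortho i j (by simpa using hij)
    · rintro (i | i) <;> simp only [hg, pullbackForm_apply, ← he]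
      · simpa [blockMetric_apply] using hW.self_ne i
      · simpa [blockMetric_apply] using hA.self_ne i
  · simp [← he]

/-- The scalar curvature of a bundle metric in local coordinates. -/
theorem IsLocalBundle.scalarCurvatureVec_eq (hb : IsLocalBundle pr θ h K B y)
    (hg : ∀ᶠ z in 𝓝 y, g z = pullbackForm (blockMetric pr h K z) (bundleFrame pr θ z)) :
    scalarCurvatureVec g y = scalarCurvatureVec h (pr y)
      - 1 / 4 * metricTrace (fun u u' => h (pr y) u u') (fun u u' =>
          metricTrace (fun v v' => h (pr y) v v') (fun v v' =>
            K (localCurvature pr θ y u v) (localCurvature pr θ y u' v')))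
      + 1 / 4 * metricTrace (fun a a' => K a a') (fun a a' =>
          metricTrace (fun b b' => K b b') (fun b b' => K (B a b) (B a' b'))) := by
  obtain ⟨bW, hW⟩ := exists_isOrthogonalBasis (toLinForm (h (pr y)))
    hb.metric.symm.self_of_nhds hb.metric.nondegenerate.self_of_nhds
  obtain ⟨bA, hA⟩ := exists_isOrthogonalBasis (toLinForm K) hb.symm (fun v hv => by
    by_contra hne
    exact (hb.pos v hne).ne' (hv v))
  obtain ⟨b, hbo, hbW, hbA⟩ := hb.exists_basis hg.self_of_nhds hW hA
  have hbW' : ∀ i, g y (b (Sum.inl i)) (b (Sum.inl i)) = h (pr y) (bW i) (bW i) := fun i => by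
    rw [hg.self_of_nhds, pullbackForm_apply, hbW, blockMetric_apply]
    simp
  have hbA' : ∀ i, g y (b (Sum.inr i)) (b (Sum.inr i)) = K (bA i) (bA i) := fun i => by
    rw [hg.self_of_nhds, pullbackForm_apply, hbA, blockMetric_apply]
    simp
  obtain ⟨h₁, h₂, h₃⟩ := isLinearMap_riemannTensor
    (hb.eventually.mono fun _ hz => hz.isLeviCivitaFrame g) hg hb.contDiffAt_frame
    hb.differentiableAt_bundleConnection
  rw [scalarCurvatureVec_eq_sum h₁ h₂ h₃ hbo, hb.metric.scalarCurvatureVec_eq_sum hW,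
    metricTrace_metricTrace_eq_sum (h (pr y)) K (localCurvature pr θ y) hW,
    metricTrace_metricTrace_eq_sum K K B hA]
  simp only [Fintype.sum_sum_type, hbW', hbA', hb.apply_riemannTensor_inl_inl hg (hbW _) (hbW _),
    hb.apply_riemannTensor_inl_inr hg (hbW _) (hbA _),
    hb.apply_riemannTensor_inr_inl hg (hbA _) (hbW _),
    hb.apply_riemannTensor_inr_inr hg (hbA _) (hbA _)]
  set F := localCurvature pr θ y
  set S := curvatureAdjoint pr θ h K y
  have hS : ∀ i k, h (pr y) (S (bW i) (bA k)) (S (bW i) (bA k))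
      = ∑ j, (h (pr y) (bW j) (bW j))⁻¹ * (K (F (bW i) (bW j)) (bA k)) ^ 2 := fun i k => by
    refine (IsOrthogonalBasis.apply_eq_sum (g := toLinForm (h (pr y))) hW _ _).trans ?_
    refine Finset.sum_congr rfl fun j _ => ?_
    rw [← hb.apply_curvatureAdjoint, pow_two]
    rfl
  have hF : ∀ i j, K (F (bW i) (bW j)) (F (bW i) (bW j))
      = ∑ k, (K (bA k) (bA k))⁻¹ * (K (F (bW i) (bW j)) (bA k)) ^ 2 := fun i j => by
    refine (IsOrthogonalBasis.apply_eq_sum (g := toLinForm K) hA _ _).trans ?_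
    refine Finset.sum_congr rfl fun k _ => ?_
    rw [pow_two]
    rfl
  -- F(u, ·) and F*(u, ·) are adjoint, so they have the same Hilbert-Schmidt norm: by Parseval in
  -- either basis, both sides are weighted sums of the squares K(F(w_i, w_j), a_k)².
  have hSF : ∑ i, ∑ k, (h (pr y) (bW i) (bW i))⁻¹ * (K (bA k) (bA k))⁻¹ *
        h (pr y) (S (bW i) (bA k)) (S (bW i) (bA k))
      = ∑ i, ∑ j, (h (pr y) (bW i) (bW i))⁻¹ * (h (pr y) (bW j) (bW j))⁻¹ *
        K (F (bW i) (bW j)) (F (bW i) (bW j)) := by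
    refine Finset.sum_congr rfl fun i _ => ?_
    simp only [hS, hF, Finset.mul_sum]
    rw [Finset.sum_comm]
    exact Finset.sum_congr rfl fun j _ => Finset.sum_congr rfl fun k _ => by ring
  have hFF : ∑ j, ∑ i, (h (pr y) (bW j) (bW j))⁻¹ * (h (pr y) (bW i) (bW i))⁻¹ *
        K (F (bW i) (bW j)) (F (bW i) (bW j))
      = ∑ i, ∑ j, (h (pr y) (bW i) (bW i))⁻¹ * (h (pr y) (bW j) (bW j))⁻¹ *
        K (F (bW i) (bW j)) (F (bW i) (bW j)) := by
    rw [Finset.sum_comm]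
    exact Finset.sum_congr rfl fun j _ => Finset.sum_congr rfl fun k _ => by ring
  have hBB : ∑ j, ∑ i, (K (bA j) (bA j))⁻¹ * (K (bA i) (bA i))⁻¹ *
        K (B (bA i) (bA j)) (B (bA i) (bA j))
      = ∑ i, ∑ j, (K (bA i) (bA i))⁻¹ * (K (bA j) (bA j))⁻¹ *
        K (B (bA i) (bA j)) (B (bA i) (bA j)) := by
    rw [Finset.sum_comm]
    exact Finset.sum_congr rfl fun j _ => Finset.sum_congr rfl fun k _ => by ring
  have hSF' : ∑ k, ∑ i, (K (bA k) (bA k))⁻¹ * (h (pr y) (bW i) (bW i))⁻¹ *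
        h (pr y) (S (bW i) (bA k)) (S (bW i) (bA k))
      = ∑ i, ∑ k, (h (pr y) (bW i) (bW i))⁻¹ * (K (bA k) (bA k))⁻¹ *
        h (pr y) (S (bW i) (bA k)) (S (bW i) (bA k)) := by
    rw [Finset.sum_comm]
    exact Finset.sum_congr rfl fun j _ => Finset.sum_congr rfl fun k _ => by ring
  have pull : ∀ (c x z : ℝ), c * (1 / 4 * x) = 1 / 4 * (c * x) := fun c x _ => by ring
  have pull' : ∀ (c x : ℝ), c * (3 / 4 * x) = 3 / 4 * (c * x) := fun c x => by ring
  -- The horizontal pairs give -¾ and the mixed pairs, in both orders, give ¼ + ¼ of the same double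
  -- sum of |F|²: in all -¼.
  simp only [Finset.sum_add_distrib, mul_sub, Finset.sum_sub_distrib, pull _ _ 0, pull',
    ← Finset.mul_sum, hFF, hBB, hSF', hSF]
  ring

end LocalBundle

/-! ### Coordinate expressions -/

section Charts
open Filter Topology

set_option maxSynthPendingDepth 3
set_option linter.unusedSectionVars false

variable {E : Type*} [NormedAddCommGroup E] [NormedSpace ℝ E]
  {H : Type*} [TopologicalSpace H] {I : ModelWithCorners ℝ E H} [I.Boundaryless]
  {M : Type*} [TopologicalSpace M] [ChartedSpace H M] [IsManifold I ∞ M]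

theorem contMDiffAt_extChartAt_symm {x₀ : M} {y : E} (hy : y ∈ (extChartAt I x₀).target) :
    ContMDiffAt 𝓘(ℝ, E) I ∞ (extChartAt I x₀).symm y :=
  (contMDiffOn_extChartAt_symm x₀).contMDiffAt (extChartAt_target_mem_nhds' hy)

theorem mdifferentiableAt_extChartAt_symm {x₀ : M} {y : E} (hy : y ∈ (extChartAt I x₀).target) :
    MDifferentiableAt 𝓘(ℝ, E) I (extChartAt I x₀).symm y :=
  (contMDiffAt_extChartAt_symm hy).mdifferentiableAt (by simp)

theorem eventually_mem_target (x₀ : M) {y : E} (hy : y ∈ (extChartAt I x₀).target) :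
    ∀ᶠ z in 𝓝 y, z ∈ (extChartAt I x₀).target := extChartAt_target_mem_nhds' hy

/-- The derivative of the inverse of the chart at `x₀`. -/
def chartDeriv (I : ModelWithCorners ℝ E H) (x₀ : M) (y : E) :
    E →L[ℝ] TangentSpace I ((extChartAt I x₀).symm y) :=
  mfderiv 𝓘(ℝ, E) I (extChartAt I x₀).symm y

theorem mfderiv_extChartAt_chartDeriv {x₀ : M} {y : E} (hy : y ∈ (extChartAt I x₀).target)
    (u : E) : (mfderiv I 𝓘(ℝ, E) (extChartAt I x₀) ((extChartAt I x₀).symm y)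
      (chartDeriv I x₀ y u) : E) = u := by
  have := mfderiv_extChartAt_comp_mfderivWithin_extChartAt_symm (I := I) hy
  rw [I.range_eq_univ, mfderivWithin_univ] at this
  exact congrArg (fun l => l u) this

theorem chartDeriv_mfderiv_extChartAt {x₀ : M} {y : E} (hy : y ∈ (extChartAt I x₀).target)
    (v : TangentSpace I ((extChartAt I x₀).symm y)) :
    chartDeriv I x₀ y (mfderiv I 𝓘(ℝ, E) (extChartAt I x₀) ((extChartAt I x₀).symm y) v) = v := by
  have := mfderivWithin_extChartAt_symm_comp_mfderiv_extChartAt (I := I) hy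
  rw [I.range_eq_univ, mfderivWithin_univ] at this
  exact congrArg (fun l => l v) this

theorem chartDeriv_bijective {x₀ : M} {y : E} (hy : y ∈ (extChartAt I x₀).target) :
    Function.Bijective (chartDeriv I x₀ y) :=
  ⟨Function.LeftInverse.injective (mfderiv_extChartAt_chartDeriv hy),
    Function.RightInverse.surjective (chartDeriv_mfderiv_extChartAt hy)⟩

/-- The tangent space at `x₀` is by definition the model space read through the preferred chart at
`x₀`, so this derivative is the identity. -/
theorem chartDeriv_self (x₀ : M) (u : E) :
    (chartDeriv I x₀ (extChartAt I x₀ x₀) u : E) = u := by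
  have := mfderivWithin_range_extChartAt_symm (I := I) (x := x₀)
  rw [I.range_eq_univ, mfderivWithin_univ] at this
  exact congrArg (fun l => l u) this

/-- Coordinate vector fields are smooth: they are images of constant fields under the tangent map of
the inverse chart. Smooth tensors therefore have smooth components. -/
theorem contMDiffAt_chartDeriv {x₀ : M} {y : E} (hy : y ∈ (extChartAt I x₀).target) (u : E) :
    ContMDiffAt 𝓘(ℝ, E) I.tangent ∞ (fun z => (TotalSpace.mk' E ((extChartAt I x₀).symm z)
      (chartDeriv I x₀ z u) : TangentBundle I M)) y := by
  have : IsManifold I 1 M := IsManifold.of_le (n := ∞) (by simp)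
  have ho := isOpen_extChartAt_target (I := I) x₀
  have h1 := (contMDiffOn_extChartAt_symm (I := I) (n := ∞) x₀).contMDiffOn_tangentMapWithin
    (m := ∞) (by simp) ho.uniqueMDiffOn
  have h2 : ContMDiff 𝓘(ℝ, E) 𝓘(ℝ, E).tangent ∞
      (fun z => (TotalSpace.mk' E z u : TangentBundle 𝓘(ℝ, E) E)) := fun z =>
    contMDiffAt_vectorSpace_iff_contDiffAt.2 contDiffAt_const
  have h3 := h1.comp (s := (extChartAt I x₀).target) h2.contMDiffOn (fun z hz => hz)
  refine (h3.contMDiffAt (ho.mem_nhds hy)).congr_of_eventuallyEq ?_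
  filter_upwards [ho.mem_nhds hy] with z hz
  simp only [Function.comp, tangentMapWithin]
  rw [mfderivWithin_of_isOpen ho hz]
  rfl

variable [FiniteDimensional ℝ E]

theorem contDiffAt_oneFormInChart {F : Type*} [NormedAddCommGroup F] [NormedSpace ℝ F]
    {θ : ∀ x : M, TangentSpace I x →L[ℝ] F}
    (hθ : ContMDiff I.tangent 𝓘(ℝ, F) ∞ (fun v : TangentBundle I M => θ v.proj v.snd))
    {x₀ : M} {y : E} (hy : y ∈ (extChartAt I x₀).target) :
    ContDiffAt ℝ ∞ (oneFormInChart I θ x₀) y := by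
  refine contDiffAt_clm_of_apply fun u => ?_
  rw [← contMDiffAt_iff_contDiffAt]
  exact hθ.contMDiffAt.comp y (contMDiffAt_chartDeriv hy u)

theorem isMetricAt_metricInChart (h : PseudoRiemannianMetric I M) {x₀ : M} {y : E}
    (hy : y ∈ (extChartAt I x₀).target) : IsMetricAt (metricInChart I h.inner x₀) y where
  contDiffAt := by
    refine ContDiffAt.of_le (n := ∞) ?_ (WithTop.coe_le_coe.2 le_top)
    refine contDiffAt_clm_of_apply fun u => contDiffAt_clm_of_apply fun v => ?_
    rw [← contMDiffAt_iff_contDiffAt]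
    have : ContMDiffAt 𝓘(ℝ, E) (I.prod 𝓘(ℝ, ℝ)) ∞ (fun z => TotalSpace.mk' ℝ
        (E := Bundle.Trivial M ℝ) ((extChartAt I x₀).symm z)
        (h.inner ((extChartAt I x₀).symm z) (chartDeriv I x₀ z u) (chartDeriv I x₀ z v))) y := by
      apply ContMDiffAt.clm_bundle_apply₂ (F₁ := E) (F₂ := E)
      · exact h.contMDiff.contMDiffAt.comp y (contMDiffAt_extChartAt_symm hy)
      · exact contMDiffAt_chartDeriv hy u
      · exact contMDiffAt_chartDeriv hy v
    rw [contMDiffAt_totalSpace] at this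
    exact this.2
  symm := Eventually.of_forall fun z v w => h.symm _ _ _
  nondegenerate := by
    filter_upwards [eventually_mem_target x₀ hy] with z hz v hv
    have hb := chartDeriv_bijective hz
    have : chartDeriv I x₀ z v = 0 := by
      refine h.nondegenerate _ _ fun w => ?_
      obtain ⟨w', rfl⟩ := hb.2 w
      exact hv w'
    exact hb.1 (this.trans (map_zero _).symm)

end Charts

/-! ### The exterior derivative of a connection form on vertical vectors -/

section ActionForm
open Filter Topology

set_option maxSynthPendingDepth 3
set_option linter.unusedSectionVars false

/-- If the pull-back of `θ` by an action `F` is `ρ(s) ξ + c(s) θ(v)`, then `dθ(X, v) = (∂_X c)(θ v)`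
for the fundamental vector fields `X` of the action. -/
theorem extDeriv_of_action {D E A : Type*} [NormedAddCommGroup D] [NormedSpace ℝ D]
    [NormedAddCommGroup E] [NormedSpace ℝ E] [NormedAddCommGroup A] [NormedSpace ℝ A]
    {F : D × E → E} {a : D} {z : E} (hF : ContDiffAt ℝ 2 F (a, z))
    (hid : ∀ᶠ y in 𝓝 z, F (a, y) = y) {θ : E → E →L[ℝ] A} (hθ : DifferentiableAt ℝ θ z)
    {ρ : D → D → A} {c : D → A → A}
    (h₁ : ∀ᶠ q in 𝓝 (a, z), ∀ ξ, θ (F q) (fderiv ℝ F q (ξ, 0)) = ρ q.1 ξ)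
    (h₂ : ∀ᶠ q in 𝓝 (a, z), ∀ v, θ (F q) (fderiv ℝ F q (0, v)) = c q.1 (θ q.2 v))
    (X : D) (v : E) :
    DifferentiableAt ℝ (fun s => c s (θ z v)) a ∧
    fderiv ℝ θ z (fderiv ℝ F (a, z) (X, 0)) v - fderiv ℝ θ z v (fderiv ℝ F (a, z) (X, 0))
      = fderiv ℝ (fun s => c s (θ z v)) a X := by
  have hFz : F (a, z) = z := hid.self_of_nhds
  have hF1 : DifferentiableAt ℝ F (a, z) := hF.differentiableAt (by norm_num)
  have hF2 : DifferentiableAt ℝ (fderiv ℝ F) (a, z) :=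
    (hF.fderiv_right (m := 1) (by norm_num)).differentiableAt (by norm_num)
  have hl : HasFDerivAt (fun s : D => (s, z)) (ContinuousLinearMap.inl ℝ D E) a :=
    hasFDerivAt_prodMk_left a z
  have hr : HasFDerivAt (fun s : E => (a, s)) (ContinuousLinearMap.inr ℝ D E) z :=
    hasFDerivAt_prodMk_right a z
  have hθ' : HasFDerivAt θ (fderiv ℝ θ z) (F (a, z)) := by rw [hFz]; exact hθ.hasFDerivAt
  have hψ : ∀ p : D × E, HasFDerivAt (fun q => θ (F q) (fderiv ℝ F q p)) _ (a, z) := fun p =>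
    (hθ'.comp (a, z) hF1.hasFDerivAt).clm_apply
      (hF2.hasFDerivAt.clm_apply (hasFDerivAt_const p (a, z)))
  -- At the parameter `a`, the coordinate of the unit, the action is the identity near `z`.
  have hv : fderiv ℝ F (a, z) (0, v) = v := by
    have e1 : (fun y => F (a, y)) =ᶠ[𝓝 z] id := hid
    have e2 := (HasFDerivAt.comp z (g := F) (f := fun s : E => (a, s)) hF1.hasFDerivAt hr).fderiv
    have e3 : fderiv ℝ (F ∘ fun s : E => (a, s)) z = ContinuousLinearMap.id ℝ E := by
      rw [← fderiv_id (x := z)]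
      exact e1.fderiv_eq
    rw [e2] at e3
    simpa using congrArg (fun l => l v) e3
  -- θ takes a value on the fundamental field of X that does not depend on the point, so its
  -- derivative along `v` vanishes.
  have k1 : fderiv ℝ θ z v (fderiv ℝ F (a, z) (X, 0))
      + θ z (fderiv ℝ (fderiv ℝ F) (a, z) (0, v) (X, 0)) = 0 := by
    have e1 : (fun s : E => θ (F (a, s)) (fderiv ℝ F (a, s) (X, 0))) =ᶠ[𝓝 z] fun _ => ρ a X := by
      filter_upwards [hr.continuousAt.eventually h₁] with s hs using hs X
    have e2 := HasFDerivAt.comp z (g := fun q => θ (F q) (fderiv ℝ F q (X, 0)))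
      (f := fun s : E => (a, s)) (hψ (X, 0)) hr
    have e3 := e2.fderiv.symm.trans e1.fderiv_eq
    have e4 := congrArg (fun l : E →L[ℝ] A => l v) e3
    simp only [fderiv_const_apply] at e4
    simpa [hv, hFz, add_comm] using e4
  have e5 : (fun s => c s (θ z v)) =ᶠ[𝓝 a] fun s => θ (F (s, z)) (fderiv ℝ F (s, z) (0, v)) := by
    filter_upwards [hl.continuousAt.eventually h₂] with s hs using (hs v).symm
  -- The derivative in the group direction, the analogue of L_X θ. Subtracting `k1` gives Cartan's
  -- formula; the two mixed second derivatives of the action agree and cancel.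
  have k2 := (HasFDerivAt.comp a (g := fun q => θ (F q) (fderiv ℝ F q (0, v)))
    (f := fun s : D => (s, z)) (hψ (0, v)) hl).congr_of_eventuallyEq e5
  have hsymm : fderiv ℝ (fderiv ℝ F) (a, z) (X, 0) (0, v)
      = fderiv ℝ (fderiv ℝ F) (a, z) (0, v) (X, 0) := (hF.isSymmSndFDerivAt (by simp)) _ _
  refine ⟨k2.differentiableAt, ?_⟩
  rw [k2.fderiv]
  simp [hv, hFz, hsymm]
  rw [eq_neg_of_add_eq_zero_left k1]
  abel

end ActionForm

/-! ### Derivatives of a Lie group action along orbits. -/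

section LieGroupAction
open Filter Topology

set_option maxSynthPendingDepth 3
set_option linter.unusedSectionVars false

variable {EG : Type*} [NormedAddCommGroup EG] [NormedSpace ℝ EG] [FiniteDimensional ℝ EG]
  {HG : Type*} [TopologicalSpace HG] (IG : ModelWithCorners ℝ EG HG) [IG.Boundaryless]
  {G : Type*} [TopologicalSpace G] [ChartedSpace HG G] [Group G] [LieGroup IG ∞ G]

variable (G) in
/-- The derivative at `1` of the adjoint representation, in the chart at `1`. -/
def adjointBracket : EG →L[ℝ] EG →L[ℝ] EG :=
  fderiv ℝ (fun s => (adjointRep IG ((extChartAt IG (1 : G)).symm s) : EG →L[ℝ] EG))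
    (extChartAt IG (1 : G) 1)

/-- The right Maurer-Cartan form of a Lie group. -/
def rightMaurerCartan (g : G) : TangentSpace IG g →L[ℝ] GroupLieAlgebra IG G :=
  (mfderiv IG IG (fun a : G => a * g⁻¹) g : EG →L[ℝ] EG)

variable {EP : Type*} [NormedAddCommGroup EP] [NormedSpace ℝ EP] [FiniteDimensional ℝ EP]
  {HP : Type*} [TopologicalSpace HP] (IP : ModelWithCorners ℝ EP HP) [IP.Boundaryless]
  {P : Type*} [TopologicalSpace P] [ChartedSpace HP P] [IsManifold IP ∞ P] [MulAction G P]

/-- The action in the charts at `1` and `p`. -/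
def actionInChart (p : P) (q : EG × EP) : EP :=
  extChartAt IP p ((extChartAt IG (1 : G)).symm q.1 • (extChartAt IP p).symm q.2)

variable {IG IP}

theorem mdifferentiableAt_smul_left (hact : ContMDiff (IG.prod IP) IP ∞ (fun q : G × P => q.1 • q.2))
    (g : G) (p : P) : MDifferentiableAt IG IP (fun k : G => k • p) g :=
  ((hact.comp (contMDiff_id.prodMk contMDiff_const)).contMDiffAt).mdifferentiableAt (by simp)

theorem mdifferentiableAt_smul_right
    (hact : ContMDiff (IG.prod IP) IP ∞ (fun q : G × P => q.1 • q.2))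
    (g : G) (p : P) : MDifferentiableAt IP IP (fun q : P => g • q) p :=
  ((hact.comp (contMDiff_const.prodMk contMDiff_id)).contMDiffAt).mdifferentiableAt (by simp)

theorem mdifferentiableAt_mul_right' (g k : G) : MDifferentiableAt IG IG (fun a : G => a * k) g :=
  (contMDiff_mul_right (I := IG) (n := ∞)).contMDiffAt.mdifferentiableAt (by simp)

/-- Write k • p = (k g⁻¹) • (g • p): a tangent vector at `g` becomes one at 1 by right translation,
and then acts infinitesimally at `g • p`. -/
theorem mfderiv_smul_left (hact : ContMDiff (IG.prod IP) IP ∞ (fun q : G × P => q.1 • q.2))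
    (g : G) (p : P) (η : TangentSpace IG g) :
    (mfderiv IG IP (fun k : G => k • p) g η : EP)
      = fundamental IP IG (g • p) (rightMaurerCartan IG g η) := by
  have h : (fun k : G => k • p) = (fun k : G => k • (g • p)) ∘ (fun a : G => a * g⁻¹) := by
    ext k
    simp [smul_smul]
  have h1 : ∀ k : G, k = (1 : G) → (mfderiv IG IP (fun k' : G => k' • (g • p)) k : EG →L[ℝ] EP)
      = fundamental (G := G) IP IG (g • p) := by
    rintro k rfl
    rfl
  have := mfderiv_comp_of_eq (I := IG) (I' := IG) (I'' := IP) (x := g) (y := 1)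
    (f := fun a : G => a * g⁻¹)
    (mdifferentiableAt_smul_left hact 1 (g • p)) (mdifferentiableAt_mul_right' g g⁻¹) (by simp)
  rw [← h] at this
  exact (congrArg (fun l => l η) this).trans (congrArg
    (fun l : EG →L[ℝ] EP => l (rightMaurerCartan IG g η)) (h1 _ (mul_inv_cancel g)))

end LieGroupAction

/-! ### The action in charts, and dω on fundamental vectors. -/

section LieGroupAction
open Filter Topology

set_option maxSynthPendingDepth 3
set_option linter.unusedSectionVars false

variable {EG : Type*} [NormedAddCommGroup EG] [NormedSpace ℝ EG] [FiniteDimensional ℝ EG]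
  {HG : Type*} [TopologicalSpace HG] {IG : ModelWithCorners ℝ EG HG} [IG.Boundaryless]
  {G : Type*} [TopologicalSpace G] [ChartedSpace HG G] [Group G] [LieGroup IG ∞ G]
  {EP : Type*} [NormedAddCommGroup EP] [NormedSpace ℝ EP] [FiniteDimensional ℝ EP]
  {HP : Type*} [TopologicalSpace HP] {IP : ModelWithCorners ℝ EP HP} [IP.Boundaryless]
  {P : Type*} [TopologicalSpace P] [ChartedSpace HP P] [IsManifold IP ∞ P] [MulAction G P]

/-- The chain rule that turns an ordinary derivative of a chart expression back into a derivative on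
the manifold. -/
theorem chartDeriv_fderiv {D : Type*} [NormedAddCommGroup D] [NormedSpace ℝ D] {f : D → EP}
    {m : D → P} {p : P} {s : D} (hf : DifferentiableAt ℝ f s)
    (hs : f s ∈ (extChartAt IP p).target)
    (h : ∀ᶠ s' in 𝓝 s, (extChartAt IP p).symm (f s') = m s') (ξ : D) :
    (chartDeriv IP p (f s) (fderiv ℝ f s ξ) : EP) = mfderiv 𝓘(ℝ, D) IP m s ξ := by
  have h1 := mfderiv_comp (I := 𝓘(ℝ, D)) (I' := 𝓘(ℝ, EP)) (I'' := IP) s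
    (mdifferentiableAt_extChartAt_symm hs) hf.mdifferentiableAt
  have h2 : (extChartAt IP p).symm ∘ f =ᶠ[𝓝 s] m := h
  rw [mfderiv_eq_fderiv] at h1
  have h3 := h2.mfderiv_eq (I := 𝓘(ℝ, D)) (I' := IP)
  exact (congrArg (fun l : D →L[ℝ] EP => l ξ) h1.symm).trans
    (congrArg (fun l : D →L[ℝ] EP => l ξ) h3)

theorem eventually_smul_mem_source
    (hact : ContMDiff (IG.prod IP) IP ∞ (fun q : G × P => q.1 • q.2)) {p : P} {q : EG × EP}
    (h₁ : q.1 ∈ (extChartAt IG (1 : G)).target) (h₂ : q.2 ∈ (extChartAt IP p).target)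
    (h₃ : (extChartAt IG (1 : G)).symm q.1 • (extChartAt IP p).symm q.2 ∈ (extChartAt IP p).source) :
    ∀ᶠ q' in 𝓝 q, q'.1 ∈ (extChartAt IG (1 : G)).target ∧ q'.2 ∈ (extChartAt IP p).target ∧
      (extChartAt IG (1 : G)).symm q'.1 • (extChartAt IP p).symm q'.2
        ∈ (extChartAt IP p).source := by
  have c1 : ContinuousAt (fun q' : EG × EP => (extChartAt IG (1 : G)).symm q'.1) q :=
    (contMDiffAt_extChartAt_symm h₁).continuousAt.comp continuousAt_fst
  have c2 : ContinuousAt (fun q' : EG × EP => (extChartAt IP p).symm q'.2) q :=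
    (contMDiffAt_extChartAt_symm h₂).continuousAt.comp continuousAt_snd
  have c3 := ContinuousAt.comp (f := fun q' : EG × EP =>
    ((extChartAt IG (1 : G)).symm q'.1, (extChartAt IP p).symm q'.2)) (x := q)
    hact.continuous.continuousAt (c1.prodMk c2)
  exact (continuousAt_fst.eventually (eventually_mem_target _ h₁)).and
    ((continuousAt_snd.eventually (eventually_mem_target _ h₂)).and
      (c3.eventually ((isOpen_extChartAt_source (I := IP) p).mem_nhds h₃)))

theorem contDiffAt_actionInChart
    (hact : ContMDiff (IG.prod IP) IP ∞ (fun q : G × P => q.1 • q.2)) {p : P} {q : EG × EP}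
    (h₁ : q.1 ∈ (extChartAt IG (1 : G)).target) (h₂ : q.2 ∈ (extChartAt IP p).target)
    (h₃ : (extChartAt IG (1 : G)).symm q.1 • (extChartAt IP p).symm q.2 ∈ (extChartAt IP p).source) :
    ContDiffAt ℝ ∞ (actionInChart IG (G := G) IP p) q := by
  rw [← contMDiffAt_iff_contDiffAt]
  have c1 : ContMDiffAt 𝓘(ℝ, EG × EP) IG ∞
      (fun q' : EG × EP => (extChartAt IG (1 : G)).symm q'.1) q :=
    (contMDiffAt_extChartAt_symm h₁).comp q contDiff_fst.contMDiff.contMDiffAt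
  have c2 : ContMDiffAt 𝓘(ℝ, EG × EP) IP ∞
      (fun q' : EG × EP => (extChartAt IP p).symm q'.2) q :=
    (contMDiffAt_extChartAt_symm h₂).comp q contDiff_snd.contMDiff.contMDiffAt
  have c3 := ContMDiffAt.comp (f := fun q' : EG × EP =>
    ((extChartAt IG (1 : G)).symm q'.1, (extChartAt IP p).symm q'.2)) q
    hact.contMDiffAt (c1.prodMk c2)
  rw [extChartAt_source] at h₃
  exact (contMDiffAt_extChartAt' h₃).comp q c3

theorem chartDeriv_fderiv_actionInChart_left
    (hact : ContMDiff (IG.prod IP) IP ∞ (fun q : G × P => q.1 • q.2)) {p : P} {q : EG × EP}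
    (h₁ : q.1 ∈ (extChartAt IG (1 : G)).target) (h₂ : q.2 ∈ (extChartAt IP p).target)
    (h₃ : (extChartAt IG (1 : G)).symm q.1 • (extChartAt IP p).symm q.2 ∈ (extChartAt IP p).source)
    (ξ : EG) : (chartDeriv IP p (actionInChart IG (G := G) IP p q)
      (fderiv ℝ (actionInChart IG (G := G) IP p) q (ξ, 0)) : EP)
      = mfderiv IG IP (fun k : G => k • (extChartAt IP p).symm q.2)
        ((extChartAt IG (1 : G)).symm q.1) (chartDeriv IG (1 : G) q.1 ξ) := by
  have hF := (contDiffAt_actionInChart hact h₁ h₂ h₃).differentiableAt (by simp)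
  have hl : HasFDerivAt (fun s : EG => (s, q.2)) (ContinuousLinearMap.inl ℝ EG EP) q.1 :=
    hasFDerivAt_prodMk_left q.1 q.2
  have hc := HasFDerivAt.comp q.1 (g := actionInChart IG (G := G) IP p)
    (f := fun s : EG => (s, q.2)) hF.hasFDerivAt hl
  have h4 := chartDeriv_fderiv (IP := IP) (p := p)
    (m := fun s => (extChartAt IG (1 : G)).symm s • (extChartAt IP p).symm q.2)
    hc.differentiableAt ((extChartAt IP p).map_source h₃) (by
      filter_upwards [hl.continuousAt.eventually (eventually_smul_mem_source hact h₁ h₂ h₃)]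
        with s hs using (extChartAt IP p).left_inv hs.2.2) ξ
  rw [hc.fderiv] at h4
  have h5 := mfderiv_comp (I := 𝓘(ℝ, EG)) (I' := IG) (I'' := IP) q.1
    (mdifferentiableAt_smul_left hact _ ((extChartAt IP p).symm q.2))
    (mdifferentiableAt_extChartAt_symm h₁)
  exact h4.trans (congrArg (fun l : EG →L[ℝ] EP => l ξ) h5)

theorem chartDeriv_fderiv_actionInChart_right
    (hact : ContMDiff (IG.prod IP) IP ∞ (fun q : G × P => q.1 • q.2)) {p : P} {q : EG × EP}
    (h₁ : q.1 ∈ (extChartAt IG (1 : G)).target) (h₂ : q.2 ∈ (extChartAt IP p).target)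
    (h₃ : (extChartAt IG (1 : G)).symm q.1 • (extChartAt IP p).symm q.2 ∈ (extChartAt IP p).source)
    (v : EP) : (chartDeriv IP p (actionInChart IG (G := G) IP p q)
      (fderiv ℝ (actionInChart IG (G := G) IP p) q (0, v)) : EP)
      = mfderiv IP IP (fun p' : P => (extChartAt IG (1 : G)).symm q.1 • p')
        ((extChartAt IP p).symm q.2) (chartDeriv IP p q.2 v) := by
  have hF := (contDiffAt_actionInChart hact h₁ h₂ h₃).differentiableAt (by simp)
  have hl : HasFDerivAt (fun s : EP => (q.1, s)) (ContinuousLinearMap.inr ℝ EG EP) q.2 :=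
    hasFDerivAt_prodMk_right q.1 q.2
  have hc := HasFDerivAt.comp q.2 (g := actionInChart IG (G := G) IP p)
    (f := fun s : EP => (q.1, s)) hF.hasFDerivAt hl
  have h4 := chartDeriv_fderiv (IP := IP) (p := p)
    (m := fun s => (extChartAt IG (1 : G)).symm q.1 • (extChartAt IP p).symm s)
    hc.differentiableAt ((extChartAt IP p).map_source h₃) (by
      filter_upwards [hl.continuousAt.eventually (eventually_smul_mem_source hact h₁ h₂ h₃)]
        with s hs using (extChartAt IP p).left_inv hs.2.2) v
  rw [hc.fderiv] at h4
  have h5 := mfderiv_comp (I := 𝓘(ℝ, EP)) (I' := IP) (I'' := IP) q.2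
    (mdifferentiableAt_smul_right hact ((extChartAt IG (1 : G)).symm q.1) _)
    (mdifferentiableAt_extChartAt_symm h₂)
  exact h4.trans (congrArg (fun l : EP →L[ℝ] EP => l v) h5)

variable {conn : ∀ p : P, TangentSpace IP p →L[ℝ] GroupLieAlgebra IG G}

/-- The exterior derivative of a connection form on fundamental vectors, in a chart of `P`. -/
theorem IsConnectionForm.extDeriv_inChart (hconn : IsConnectionForm IP IG conn)
    (hact : ContMDiff (IG.prod IP) IP ∞ (fun q : G × P => q.1 • q.2)) {p : P} {z : EP}
    (hz : z ∈ (extChartAt IP p).target) {u : EP} {X : EG}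
    (hu : (chartDeriv IP p z u : EP) = fundamental (G := G) IP IG ((extChartAt IP p).symm z) X) (v : EP) :
    DifferentiableAt ℝ (fun s => (adjointRep IG ((extChartAt IG (1 : G)).symm s)
      (oneFormInChart IP (F := EG) conn p z v) : EG)) (extChartAt IG (1 : G) 1) ∧
    fderiv ℝ (oneFormInChart IP (F := EG) conn p) z u v
      - fderiv ℝ (oneFormInChart IP (F := EG) conn p) z v u
      = fderiv ℝ (fun s => (adjointRep IG ((extChartAt IG (1 : G)).symm s)
      (oneFormInChart IP (F := EG) conn p z v) : EG)) (extChartAt IG (1 : G) 1) X := by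
  set a := extChartAt IG (1 : G) 1 with ha
  have h₁ : ((a, z) : EG × EP).1 ∈ (extChartAt IG (1 : G)).target := mem_extChartAt_target 1
  have hone : (extChartAt IG (1 : G)).symm a = 1 := extChartAt_to_inv 1
  have h₃ : (extChartAt IG (1 : G)).symm ((a, z) : EG × EP).1 •
      (extChartAt IP p).symm ((a, z) : EG × EP).2 ∈ (extChartAt IP p).source := by
    simp only [hone, one_smul]
    exact (extChartAt IP p).map_target hz
  have hev := eventually_smul_mem_source hact h₁ hz h₃
  have hF := contDiffAt_actionInChart hact h₁ hz h₃
  have hθ := contDiffAt_oneFormInChart (F := EG) (θ := conn) hconn.contMDiff hz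
  -- All tangent spaces are definitionally the model space, so equal base points may be exchanged
  -- with the vector kept as an element of `EP`. The same device recurs wherever a point returns
  -- from a chart.
  have hcast : ∀ (p' p'' : P) (w : EP), p' = p'' → (conn p' w : EG) = conn p'' w := by
    rintro p' _ w rfl
    rfl
  have key := extDeriv_of_action (F := actionInChart IG (G := G) IP p) (a := a) (z := z)
    (hF.of_le (WithTop.coe_le_coe.2 le_top)) (by
      filter_upwards [eventually_mem_target p hz] with y hy
      simp only [actionInChart, hone, one_smul]
      exact (extChartAt IP p).right_inv hy)
    (hθ.differentiableAt (by simp))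
    (ρ := fun s ξ => rightMaurerCartan IG ((extChartAt IG (1 : G)).symm s) (chartDeriv IG (1 : G) s ξ))
    (c := fun s Y => adjointRep IG ((extChartAt IG (1 : G)).symm s) Y)
    (by
      filter_upwards [hev] with q hq ξ
      have e1 := chartDeriv_fderiv_actionInChart_left hact hq.1 hq.2.1 hq.2.2 ξ
      rw [mfderiv_smul_left hact] at e1
      refine (hcast _ (((extChartAt IG (1 : G)).symm q.1) • (extChartAt IP p).symm q.2) _
        ((extChartAt IP p).left_inv hq.2.2)).trans ?_
      refine (congrArg (fun w : EP => (conn _ w : EG)) e1).trans ?_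
      exact hconn.apply_fundamental _ _)
    (by
      filter_upwards [hev] with q hq v
      have e1 := chartDeriv_fderiv_actionInChart_right hact hq.1 hq.2.1 hq.2.2 v
      refine (hcast _ (((extChartAt IG (1 : G)).symm q.1) • (extChartAt IP p).symm q.2) _
        ((extChartAt IP p).left_inv hq.2.2)).trans ?_
      refine (congrArg (fun w : EP => (conn _ w : EG)) e1).trans ?_
      exact hconn.equivariant _ _ _) X v
  -- The derivative of the action at the unit is the infinitesimal action, so `u` is the coordinate
  -- form of the fundamental vector of `X`.
  have hu' : fderiv ℝ (actionInChart IG (G := G) IP p) (a, z) (X, 0) = u := by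
    have e1 := chartDeriv_fderiv_actionInChart_left hact h₁ hz h₃ X
    have e2 : actionInChart IG (G := G) IP p (a, z) = z := by
      simp only [actionInChart, hone, one_smul]
      exact (extChartAt IP p).right_inv hz
    have e3 : ∀ g : G, g = (1 : G) → (mfderiv IG IP (fun k : G => k • (extChartAt IP p).symm z) g :
        EG →L[ℝ] EP) = fundamental (G := G) IP IG ((extChartAt IP p).symm z) := by
      rintro g rfl
      rfl
    have e4 : (chartDeriv IG (1 : G) a X : EG) = X := chartDeriv_self (1 : G) X
    rw [e2] at e1
    refine (chartDeriv_bijective hz).1 ?_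
    refine e1.trans (Eq.trans ?_ hu.symm)
    refine (congrArg (fun l : EG →L[ℝ] EP => l (chartDeriv IG (1 : G) a X)) (e3 _ hone)).trans ?_
    exact congrArg (fun x : EG => (fundamental (G := G) IP IG ((extChartAt IP p).symm z) x : EP)) e4
  rw [hu'] at key
  exact key

end LieGroupAction

/-! ### The bracket as derivative of Ad, and the vertical and horizontal directions of a principal
bundle. -/

section PrincipalBundle
open Filter Topology

set_option maxSynthPendingDepth 3
set_option linter.unusedSectionVars false

variable {EG : Type*} [NormedAddCommGroup EG] [NormedSpace ℝ EG] [FiniteDimensional ℝ EG]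
  {HG : Type*} [TopologicalSpace HG] {IG : ModelWithCorners ℝ EG HG} [IG.Boundaryless]
  {G : Type*} [TopologicalSpace G] [ChartedSpace HG G] [Group G] [LieGroup IG ∞ G]
  {EP : Type*} [NormedAddCommGroup EP] [NormedSpace ℝ EP] [FiniteDimensional ℝ EP]
  {HP : Type*} [TopologicalSpace HP] {IP : ModelWithCorners ℝ EP HP} [IP.Boundaryless]
  {P : Type*} [TopologicalSpace P] [ChartedSpace HP P] [IsManifold IP ∞ P] [MulAction G P]
  {conn : ∀ p : P, TangentSpace IP p →L[ℝ] GroupLieAlgebra IG G}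

/-- Equivariance expresses Ad(s)Y through the connection form pulled back by the action, which is
smooth; Y is realised as the value of the form on a fundamental vector. Without this, the `fderiv`
in `adjointBracket` could be its default value 0. -/
theorem IsConnectionForm.differentiableAt_adjointRep (hconn : IsConnectionForm IP IG conn)
    (hact : ContMDiff (IG.prod IP) IP ∞ (fun q : G × P => q.1 • q.2)) (p : P) :
    DifferentiableAt ℝ (fun s => (adjointRep IG ((extChartAt IG (1 : G)).symm s) : EG →L[ℝ] EG))
      (extChartAt IG (1 : G) 1) := by
  refine differentiableAt_clm_of_apply (E := EG) (F := EG) (f := fun s =>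
    (adjointRep IG ((extChartAt IG (1 : G)).symm s) : EG →L[ℝ] EG)) fun Y => ?_
  have hz : extChartAt IP p p ∈ (extChartAt IP p).target := mem_extChartAt_target p
  have h1 := (hconn.extDeriv_inChart hact hz (u := 0) (X := 0)
    (((chartDeriv IP p _).map_zero).trans (ContinuousLinearMap.map_zero _).symm)
    (fundamental (G := G) IP IG p Y)).1
  have h2 : (oneFormInChart IP (F := EG) conn p (extChartAt IP p p)
      (fundamental (G := G) IP IG p Y) : EG) = Y := by
    have hcast : ∀ (p' : P) (w : EP), p' = p → (conn p' w : EG) = conn p w := by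
      rintro p' w rfl
      rfl
    refine (hcast _ _ (extChartAt_to_inv p)).trans ?_
    refine (congrArg (fun w : EP => (conn p w : EG)) (chartDeriv_self p _)).trans ?_
    exact hconn.apply_fundamental p Y
  rw [h2] at h1
  exact h1

theorem IsConnectionForm.extDeriv_eq_adjointBracket (hconn : IsConnectionForm IP IG conn)
    (hact : ContMDiff (IG.prod IP) IP ∞ (fun q : G × P => q.1 • q.2)) {p : P} {z : EP}
    (hz : z ∈ (extChartAt IP p).target) {u : EP} {X : EG}
    (hu : (chartDeriv IP p z u : EP) = fundamental (G := G) IP IG ((extChartAt IP p).symm z) X)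
    (v : EP) : fderiv ℝ (oneFormInChart IP (F := EG) conn p) z u v
      - fderiv ℝ (oneFormInChart IP (F := EG) conn p) z v u
      = adjointBracket IG G X (oneFormInChart IP (F := EG) conn p z v) := by
  refine (hconn.extDeriv_inChart hact hz hu v).2.trans ?_
  exact fderiv_clm_apply_const (E := EG) (F := EG) (f := fun s =>
    (adjointRep IG ((extChartAt IG (1 : G)).symm s) : EG →L[ℝ] EG)) (hconn.differentiableAt_adjointRep hact p) X _

theorem adjointRep_one (X : EG) : (adjointRep IG (1 : G) X : EG) = X := by
  have : (fun a : G => (1 : G) * a * 1⁻¹) = id := by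
    ext a
    simp
  have h : (adjointRep IG (1 : G) : EG →L[ℝ] EG) = mfderiv IG IG (fun a : G => 1 * a * 1⁻¹) 1 := rfl
  rw [this, mfderiv_id] at h
  exact congrArg (fun l : EG →L[ℝ] EG => l X) h

/-- Differentiate K(Ad(s)Y, Ad(s)Z) = K(Y, Z) at the unit in the direction X. -/
theorem adjointBracket_skew
    (hd : DifferentiableAt ℝ (fun s => (adjointRep IG ((extChartAt IG (1 : G)).symm s) :
      EG →L[ℝ] EG)) (extChartAt IG (1 : G) 1))
    {K : EG →L[ℝ] EG →L[ℝ] ℝ} (hK : IsAdInvariantInner (G := G) IG K) (X Y Z : EG) :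
    K (adjointBracket IG G X Y) Z = - K Y (adjointBracket IG G X Z) := by
  set c : EG → EG →L[ℝ] EG := fun s => (adjointRep IG ((extChartAt IG (1 : G)).symm s) :
    EG →L[ℝ] EG) with hc
  have hone : ∀ W : EG, c (extChartAt IG (1 : G) 1) W = W := by
    intro W
    have : ∀ g : G, g = 1 → (adjointRep IG g W : EG) = W := by
      rintro g rfl
      exact adjointRep_one W
    exact this _ (extChartAt_to_inv 1)
  have h1 : (fun s => K (c s Y) (c s Z)) = fun _ => K Y Z := by
    ext s
    exact hK.ad_invariant _ Y Z
  have h2 := ((K.hasFDerivAt.comp _ (hd.hasFDerivAt.clm_apply (hasFDerivAt_const Y _))).clm_apply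
    (hd.hasFDerivAt.clm_apply (hasFDerivAt_const Z _))).fderiv
  have h3 : fderiv ℝ (fun s => K (c s Y) (c s Z)) (extChartAt IG (1 : G) 1) = 0 := by
    rw [h1]
    simp
  have h4 := congrArg (fun l : EG →L[ℝ] ℝ => l X) (h2.symm.trans h3)
  have h5 : K Y (adjointBracket IG G X Z) + K (adjointBracket IG G X Y) Z = 0 := by
    have e1 := hone Y
    have e2 := hone Z
    have e3 : fderiv ℝ c (extChartAt IG (1 : G) 1) = adjointBracket IG G := rfl
    generalize extChartAt IG (1 : G) 1 = a at e1 e2 e3 h4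
    rw [← e3]
    simp [e1, e2] at h4
    exact h4
  linarith

variable {EM : Type*} [NormedAddCommGroup EM] [NormedSpace ℝ EM]
  {HM : Type*} [TopologicalSpace HM] {IM : ModelWithCorners ℝ EM HM}
  {M : Type*} [TopologicalSpace M] [ChartedSpace HM M] [IsManifold IM ∞ M] {proj : P → M}

theorem IsPrincipalBundle.mdifferentiableAt_proj (hproj : IsPrincipalBundle IP IM IG G proj)
    (p : P) : MDifferentiableAt IP IM proj p :=
  hproj.contMDiff_proj.contMDiffAt.mdifferentiableAt (by simp)

theorem IsPrincipalBundle.mfderiv_proj_fundamental (hproj : IsPrincipalBundle IP IM IG G proj)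
    (p : P) (X : EG) : (mfderiv IP IM proj p (fundamental (G := G) IP IG p X) : EM) = 0 := by
  have h1 : proj ∘ (fun g : G => g • p) = fun _ => proj p := by
    ext g
    exact hproj.proj_smul g p
  have h2 := mfderiv_comp_of_eq (I := IG) (I' := IP) (I'' := IM) (x := (1 : G)) (y := p)
    (f := fun g : G => g • p) (g := proj)
    (hproj.mdifferentiableAt_proj p) (mdifferentiableAt_smul_left hproj.contMDiff_smul 1 p)
    (one_smul G p)
  rw [h1, mfderiv_const] at h2
  have h3 : ∀ p' : P, p' = p → (mfderiv IP IM proj p' : EP →L[ℝ] EM) = mfderiv IP IM proj p := by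
    rintro p' rfl
    rfl
  refine (congrArg (fun l : EP →L[ℝ] EM => l (fundamental (G := G) IP IG p X))
    (h3 _ (one_smul G p))).symm.trans ?_
  exact (congrArg (fun l : EG →L[ℝ] EM => l X) h2).symm

/-- A trivialization provides a smooth local section through `p`, whose derivative is a right
inverse. -/
theorem IsPrincipalBundle.surjective_mfderiv_proj (hproj : IsPrincipalBundle IP IM IG G proj)
    (p : P) : Function.Surjective (mfderiv IP IM proj p) := by
  obtain ⟨U, Φ, hU, hx, hs, ht, hΦ, hΦs, h1, h2⟩ := hproj.exists_trivialization (proj p)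
  have hp : p ∈ Φ.source := by rw [hs]; exact hx
  have hΦp : Φ p = (proj p, (Φ p).2) := Prod.ext (h1 p hp) rfl
  set σ : M → P := fun x => Φ.symm (x, (Φ p).2) with hσ
  have hσp : σ (proj p) = p := by
    rw [hσ]
    simp only
    rw [← hΦp, Φ.left_inv hp]
  have hσd : ContMDiffAt IM IP ∞ σ (proj p) := by
    refine ContMDiffAt.comp (proj p) (f := fun x : M => (x, (Φ p).2)) (g := Φ.symm) ?_
      (contMDiffAt_id.prodMk (contMDiffAt_const (I' := IG)))
    exact hΦs.contMDiffAt (Φ.open_target.mem_nhds (by rw [ht]; exact ⟨hx, Set.mem_univ _⟩))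
  have hid : proj ∘ σ =ᶠ[𝓝 (proj p)] id := by
    filter_upwards [hU.mem_nhds hx] with x hxU
    have : (x, (Φ p).2) ∈ Φ.target := by rw [ht]; exact ⟨hxU, Set.mem_univ _⟩
    rw [Function.comp, ← h1 _ (Φ.map_target this), Φ.right_inv this]
    rfl
  have h3 := mfderiv_comp_of_eq (I := IM) (I' := IP) (I'' := IM) (x := proj p) (y := p)
    (f := σ) (g := proj) (hproj.mdifferentiableAt_proj p) (hσd.mdifferentiableAt (by simp)) hσp
  have h4 : (mfderiv IM IM (proj ∘ σ) (proj p) : EM →L[ℝ] EM) = ContinuousLinearMap.id ℝ EM :=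
    (hid.mfderiv_eq (I := IM) (I' := IM)).trans mfderiv_id
  have h5 : ∀ p' : P, p' = p → (mfderiv IP IM proj p' : EP →L[ℝ] EM) = mfderiv IP IM proj p := by
    rintro p' rfl
    rfl
  intro w
  refine ⟨(mfderiv IM IP σ (proj p) w : EP), ?_⟩
  refine (congrArg (fun l : EP →L[ℝ] EM => l (mfderiv IM IP σ (proj p) w)) (h5 _ hσp)).symm.trans ?_
  exact (congrArg (fun l : EM →L[ℝ] EM => l w) h3).symm.trans
    (congrArg (fun l : EM →L[ℝ] EM => l w) h4)

/-- Vertical vectors are fundamental: near `p` a point is q = k(q) • σ(π q), with σ a local section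
through `p`, k smooth and k(p) = 1. Differentiating, v is the fundamental vector of dk(v) plus dσ(dπ
v), and the latter is 0. -/
theorem IsPrincipalBundle.exists_fundamental_eq (hproj : IsPrincipalBundle IP IM IG G proj)
    (p : P) (v : EP) (hv : (mfderiv IP IM proj p v : EM) = 0) :
    ∃ X : EG, (fundamental (G := G) IP IG p X : EP) = v := by
  obtain ⟨U, Φ, hU, hx, hs, ht, hΦ, hΦs, h1, h2⟩ := hproj.exists_trivialization (proj p)
  have hp : p ∈ Φ.source := by rw [hs]; exact hx
  have hΦp : Φ p = (proj p, (Φ p).2) := Prod.ext (h1 p hp) rfl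
  set a := (Φ p).2 with ha
  set σ : M → P := fun x => Φ.symm (x, a) with hσ
  set k : P → G := fun q => (Φ q).2 * a⁻¹ with hk
  have hσp : σ (proj p) = p := by
    rw [hσ]
    simp only
    rw [← hΦp, Φ.left_inv hp]
  have hkp : k p = 1 := by simp [hk, ha]
  have hσd : ContMDiffAt IM IP ∞ σ (proj p) := by
    refine ContMDiffAt.comp (proj p) (f := fun x : M => (x, a)) (g := Φ.symm) ?_
      (contMDiffAt_id.prodMk (contMDiffAt_const (I' := IG)))
    exact hΦs.contMDiffAt (Φ.open_target.mem_nhds (by rw [ht]; exact ⟨hx, Set.mem_univ _⟩))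
  have hkd : ContMDiffAt IP IG ∞ k p := by
    have e1 : ContMDiffAt IP (IM.prod IG) ∞ Φ p := hΦ.contMDiffAt (Φ.open_source.mem_nhds hp)
    exact (contMDiff_mul_right (I := IG) (n := ∞) (a := a⁻¹)).contMDiffAt.comp p
      (contMDiff_snd.contMDiffAt.comp p e1)
  have hmk : MDifferentiableAt IP IG k p := hkd.mdifferentiableAt (by simp)
  have hσπ : ContMDiffAt IP IP ∞ (σ ∘ proj) p := hσd.comp p hproj.contMDiff_proj.contMDiffAt
  have hmσ : MDifferentiableAt IP IP (σ ∘ proj) p := hσπ.mdifferentiableAt (by simp)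
  have hid : (fun q : P => k q • (σ ∘ proj) q) =ᶠ[𝓝 p] id := by
    filter_upwards [Φ.open_source.mem_nhds hp] with q hq
    have hqU : proj q ∈ U := by rw [hs] at hq; exact hq
    have hqt : (proj q, a) ∈ Φ.target := by rw [ht]; exact ⟨hqU, Set.mem_univ _⟩
    have e1 : σ (proj q) ∈ Φ.source := Φ.map_target hqt
    have e2 : proj (σ (proj q)) = proj q := by
      rw [← h1 _ e1, hσ]
      simp only
      rw [Φ.right_inv hqt]
    have e3 : k q • σ (proj q) ∈ Φ.source := by
      rw [hs, Set.mem_preimage, hproj.proj_smul, e2]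
      exact hqU
    refine Φ.injOn e3 hq (Prod.ext ?_ ?_)
    · rw [id_eq, h1 _ e3, h1 _ hq, hproj.proj_smul, e2]
    · rw [id_eq, h2 _ e1, hσ]
      simp only
      rw [Φ.right_inv hqt]
      simp [hk]
  have hm : MDifferentiableAt (IG.prod IP) IP (fun q : G × P => q.1 • q.2) (k p, (σ ∘ proj) p) :=
    hproj.contMDiff_smul.contMDiffAt.mdifferentiableAt (by simp)
  have h3 := mfderiv_comp (I := IP) (I' := IG.prod IP) (I'' := IP) p
    (f := fun q => (k q, (σ ∘ proj) q)) hm (hmk.prodMk hmσ)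
  have h4 : (mfderiv IP IP (fun q : P => k q • (σ ∘ proj) q) p : EP →L[ℝ] EP)
      = ContinuousLinearMap.id ℝ EP := (hid.mfderiv_eq (I := IP) (I' := IP)).trans mfderiv_id
  have h5 : (mfderiv IP IP (σ ∘ proj) p v : EP) = 0 := by
    have := mfderiv_comp (I := IP) (I' := IM) (I'' := IP) p (f := proj)
      (hσd.mdifferentiableAt (by simp)) (hproj.mdifferentiableAt_proj p)
    refine (congrArg (fun l : EP →L[ℝ] EP => l v) this).trans ?_
    refine (congrArg (fun w : EM => (mfderiv IM IP σ (proj p) w : EP)) hv).trans ?_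
    exact ContinuousLinearMap.map_zero _
  refine ⟨(mfderiv IP IG k p v : EG), ?_⟩
  have h6 := congrArg (fun l : EP →L[ℝ] EP => l v) h3
  have h7 := mfderiv_prod_eq_add_apply (v := (mfderiv IP (IG.prod IP)
    (fun q => (k q, (σ ∘ proj) q)) p v)) hm
  have h8 : (mfderiv IP (IG.prod IP) (fun q => (k q, (σ ∘ proj) q)) p : EP →L[ℝ] EG × EP)
      = (mfderiv IP IG k p : EP →L[ℝ] EG).prod (mfderiv IP IP (σ ∘ proj) p : EP →L[ℝ] EP) :=
    hmk.mfderiv_prod hmσ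
  have h9 : ∀ (g : G) (q : P), g = 1 → q = p → (mfderiv IG IP (fun g' : G => g' • q) g :
      EG →L[ℝ] EP) = fundamental (G := G) IP IG p := by
    rintro g q rfl rfl
    rfl
  have h10 := congrArg (fun l : EP →L[ℝ] EP => l v) h4
  have h11 := congrArg (fun l : EP →L[ℝ] EG × EP => l v) h8
  have h12 := congrArg Prod.fst h11
  have h13 : (mfderiv IP (IG.prod IP) (fun q => (k q, (σ ∘ proj) q)) p v : EG × EP).2 = 0 :=
    (congrArg Prod.snd h11).trans h5
  -- The product rule for k • (σ ∘ π): the first summand is the fundamental vector, the second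
  -- vanishes by `h13`.
  refine Eq.trans ?_ (h7.symm.trans (h6.symm.trans h10))
  refine (Eq.trans ?_ (add_zero _)).symm
  refine congrArg₂ (fun x y : EP => x + y) ?_ ?_
  · refine (congrArg (fun l : EG →L[ℝ] EP => l (mfderiv IP (IG.prod IP)
      (fun q => (k q, (σ ∘ proj) q)) p v : EG × EP).1) (h9 _ _ hkp hσp)).trans ?_
    exact congrArg (fun w : EG => (fundamental (G := G) IP IG p w : EP)) h12
  · refine (congrArg (fun w : EP => (mfderiv IP IP (fun z : P => k p • z) ((σ ∘ proj) p) w : EP))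
      h13).trans ?_
    exact ContinuousLinearMap.map_zero _

end PrincipalBundle

/-! ### The bundle metric in charts -/

section BundleInChart
open Filter Topology

set_option maxSynthPendingDepth 3
set_option linter.unusedSectionVars false

variable {EG : Type*} [NormedAddCommGroup EG] [NormedSpace ℝ EG] [FiniteDimensional ℝ EG]
  {HG : Type*} [TopologicalSpace HG] {IG : ModelWithCorners ℝ EG HG} [IG.Boundaryless]
  {G : Type*} [TopologicalSpace G] [ChartedSpace HG G] [Group G] [LieGroup IG ∞ G]
  {EP : Type*} [NormedAddCommGroup EP] [NormedSpace ℝ EP] [FiniteDimensional ℝ EP]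
  {HP : Type*} [TopologicalSpace HP] {IP : ModelWithCorners ℝ EP HP} [IP.Boundaryless]
  {P : Type*} [TopologicalSpace P] [ChartedSpace HP P] [IsManifold IP ∞ P] [MulAction G P]
  {EM : Type*} [NormedAddCommGroup EM] [NormedSpace ℝ EM] [FiniteDimensional ℝ EM]
  {HM : Type*} [TopologicalSpace HM] {IM : ModelWithCorners ℝ EM HM} [IM.Boundaryless]
  {M : Type*} [TopologicalSpace M] [ChartedSpace HM M] [IsManifold IM ∞ M] {proj : P → M}
  {conn : ∀ p : P, TangentSpace IP p →L[ℝ] GroupLieAlgebra IG G}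

variable (IP IM) in
/-- The projection in the charts at `p` and `proj p`. -/
def projInChart (proj : P → M) (p : P) (z : EP) : EM :=
  extChartAt IM (proj p) (proj ((extChartAt IP p).symm z))

variable (IP IM) in
/-- The set of points of the chart at `p` whose projections lie in the chart at `proj p`. -/
def bundleChartDomain (proj : P → M) (p : P) : Set EP :=
  {z | z ∈ (extChartAt IP p).target ∧
    proj ((extChartAt IP p).symm z) ∈ (extChartAt IM (proj p)).source}

theorem mem_bundleChartDomain (p : P) :
    extChartAt IP p p ∈ bundleChartDomain IP IM proj p :=
  ⟨mem_extChartAt_target p, by rw [extChartAt_to_inv]; exact mem_extChartAt_source _⟩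

theorem IsPrincipalBundle.eventually_mem_bundleChartDomain
    (hproj : IsPrincipalBundle IP IM IG G proj) {p : P} {z : EP}
    (hz : z ∈ bundleChartDomain IP IM proj p) :
    ∀ᶠ z' in 𝓝 z, z' ∈ bundleChartDomain IP IM proj p := by
  have c : ContinuousAt (fun z' => proj ((extChartAt IP p).symm z')) z :=
    ContinuousAt.comp (g := proj) hproj.contMDiff_proj.continuous.continuousAt
      (contMDiffAt_extChartAt_symm hz.1).continuousAt
  filter_upwards [eventually_mem_target p hz.1,
    c.eventually (extChartAt_source_mem_nhds' (I := IM) hz.2)] with z' h1 h2 using ⟨h1, h2⟩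

theorem IsPrincipalBundle.contDiffAt_projInChart
    (hproj : IsPrincipalBundle IP IM IG G proj) {p : P} {z : EP}
    (hz : z ∈ bundleChartDomain IP IM proj p) :
    ContDiffAt ℝ ∞ (projInChart IP IM proj p) z := by
  rw [← contMDiffAt_iff_contDiffAt]
  exact (contMDiffAt_extChartAt' (I := IM) (n := ∞)
    (by rw [← extChartAt_source IM]; exact hz.2)).comp z
    (hproj.contMDiff_proj.contMDiffAt.comp z (contMDiffAt_extChartAt_symm hz.1))

theorem projInChart_mem_target {p : P} {z : EP} (hz : z ∈ bundleChartDomain IP IM proj p) :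
    projInChart IP IM proj p z ∈ (extChartAt IM (proj p)).target :=
  (extChartAt IM (proj p)).map_source hz.2

theorem symm_projInChart {p : P} {z : EP} (hz : z ∈ bundleChartDomain IP IM proj p) :
    (extChartAt IM (proj p)).symm (projInChart IP IM proj p z)
      = proj ((extChartAt IP p).symm z) := (extChartAt IM (proj p)).left_inv hz.2

theorem IsPrincipalBundle.chartDeriv_fderiv_projInChart
    (hproj : IsPrincipalBundle IP IM IG G proj) {p : P} {z : EP}
    (hz : z ∈ bundleChartDomain IP IM proj p) (u : EP) :
    (chartDeriv IM (proj p) (projInChart IP IM proj p z)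
      (fderiv ℝ (projInChart IP IM proj p) z u) : EM)
      = mfderiv IP IM proj ((extChartAt IP p).symm z) (chartDeriv IP p z u) := by
  have h1 := chartDeriv_fderiv (IP := IM) (p := proj p)
    (m := fun z' => proj ((extChartAt IP p).symm z'))
    ((hproj.contDiffAt_projInChart hz).differentiableAt (by simp)) (projInChart_mem_target hz)
    (by
      filter_upwards [hproj.eventually_mem_bundleChartDomain hz] with z' hz'
      exact symm_projInChart hz') u
  have h2 := mfderiv_comp (I := 𝓘(ℝ, EP)) (I' := IP) (I'' := IM) z (g := proj)
    (f := (extChartAt IP p).symm)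
    (hproj.mdifferentiableAt_proj _) (mdifferentiableAt_extChartAt_symm hz.1)
  exact h1.trans (congrArg (fun l : EP →L[ℝ] EM => l u) h2)

theorem IsPrincipalBundle.mfderiv_proj_eq_zero_iff
    (hproj : IsPrincipalBundle IP IM IG G proj) {p : P} {z : EP}
    (hz : z ∈ bundleChartDomain IP IM proj p) (u : EP) :
    (mfderiv IP IM proj ((extChartAt IP p).symm z) (chartDeriv IP p z u) : EM) = 0 ↔
      fderiv ℝ (projInChart IP IM proj p) z u = 0 := by
  have h := hproj.chartDeriv_fderiv_projInChart hz u
  constructor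
  · intro h0
    exact (chartDeriv_bijective (projInChart_mem_target hz)).1
      ((h.trans h0).trans (ContinuousLinearMap.map_zero _).symm)
  · intro h0
    refine h.symm.trans ?_
    rw [h0]
    exact (chartDeriv IM (proj p) (projInChart IP IM proj p z)).map_zero

theorem IsPrincipalBundle.bijective_bundleFrame
    (hproj : IsPrincipalBundle IP IM IG G proj) (hconn : IsConnectionForm IP IG conn)
    {p : P} {z : EP} (hz : z ∈ bundleChartDomain IP IM proj p) :
    Function.Bijective (bundleFrame (projInChart IP IM proj p)
      (oneFormInChart IP (F := EG) conn p) z) := by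
  constructor
  · rw [injective_iff_map_eq_zero]
    intro u hu
    have h1 : fderiv ℝ (projInChart IP IM proj p) z u = 0 := congrArg Prod.fst hu
    have h2 : (conn ((extChartAt IP p).symm z) (chartDeriv IP p z u) : EG) = 0 :=
      congrArg Prod.snd hu
    obtain ⟨X, hX⟩ := hproj.exists_fundamental_eq _ _ ((hproj.mfderiv_proj_eq_zero_iff hz u).2 h1)
    have h3 : X = 0 := ((hconn.apply_fundamental _ X).symm.trans
      (congrArg (fun w : EP => (conn ((extChartAt IP p).symm z) w : EG)) hX)).trans h2
    refine (chartDeriv_bijective hz.1).1 (hX.symm.trans ?_)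
    rw [h3]
    exact (ContinuousLinearMap.map_zero _).trans (ContinuousLinearMap.map_zero _).symm
  · rintro ⟨w, a⟩
    obtain ⟨e, he⟩ := hproj.surjective_mfderiv_proj ((extChartAt IP p).symm z)
      (chartDeriv IM (proj p) (projInChart IP IM proj p z) w : EM)
    let c : EG := conn ((extChartAt IP p).symm z) e
    -- A vertical correction to the lift `e`: it changes the value of the form from `c` to `a` and
    -- leaves the projection alone.
    let X : EG := a - c
    obtain ⟨u, hu⟩ := (chartDeriv_bijective hz.1).2
      (e + fundamental (G := G) IP IG ((extChartAt IP p).symm z) X)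
    refine ⟨u, Prod.ext ?_ ?_⟩
    · refine (chartDeriv_bijective (projInChart_mem_target hz)).1 ?_
      refine (hproj.chartDeriv_fderiv_projInChart hz u).trans ?_
      rw [hu]
      refine ((mfderiv IP IM proj ((extChartAt IP p).symm z)).map_add _ _).trans ?_
      refine (congrArg₂ (fun x y : EM => x + y) he (hproj.mfderiv_proj_fundamental _ X)).trans ?_
      exact add_zero _
    · refine (congrArg (fun w : EP => (conn ((extChartAt IP p).symm z) w : EG)) hu).trans ?_
      refine (ContinuousLinearMap.map_add _ _ _).trans ?_
      refine (congrArg (fun y : EG => c + y)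
        (hconn.apply_fundamental _ X)).trans ?_
      exact add_sub_cancel _ _

theorem IsPrincipalBundle.isLocalBundle
    (hproj : IsPrincipalBundle IP IM IG G proj) (hconn : IsConnectionForm IP IG conn)
    (h : PseudoRiemannianMetric IM M) {K : EG →L[ℝ] EG →L[ℝ] ℝ}
    (hK : IsAdInvariantInner (G := G) IG K) (p : P) :
    IsLocalBundle (projInChart IP IM proj p) (oneFormInChart IP (F := EG) conn p)
      (metricInChart IM h.inner (proj p)) K (adjointBracket IG G) (extChartAt IP p p) where
  contDiffAt_proj := (hproj.contDiffAt_projInChart (mem_bundleChartDomain p)).of_le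
    (WithTop.coe_le_coe.2 le_top)
  contDiffAt_form := (contDiffAt_oneFormInChart (F := EG) (θ := conn) hconn.contMDiff
    (mem_extChartAt_target p)).of_le (WithTop.coe_le_coe.2 le_top)
  metric := isMetricAt_metricInChart h (projInChart_mem_target (mem_bundleChartDomain p))
  bijective := by
    filter_upwards [hproj.eventually_mem_bundleChartDomain (mem_bundleChartDomain p)] with z hz
    exact hproj.bijective_bundleFrame hconn hz
  symm := hK.symm
  pos := hK.pos
  skew := adjointBracket_skew (hconn.differentiableAt_adjointRep hproj.contMDiff_smul p) hK
  vertical := by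
    filter_upwards [hproj.eventually_mem_bundleChartDomain (mem_bundleChartDomain p)] with z hz u v hu
    obtain ⟨X, hX⟩ := hproj.exists_fundamental_eq _ _ ((hproj.mfderiv_proj_eq_zero_iff hz u).2 hu)
    have h3 : oneFormInChart IP (F := EG) conn p z u = X :=
      (congrArg (fun w : EP => (conn ((extChartAt IP p).symm z) w : EG)) hX.symm).trans
        (hconn.apply_fundamental _ X)
    rw [h3]
    exact hconn.extDeriv_eq_adjointBracket hproj.contMDiff_smul hz.1 hX.symm v

theorem IsPrincipalBundle.bundleMetric_inChart
    (hproj : IsPrincipalBundle IP IM IG G proj)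
    (h : ∀ x : M, TangentSpace IM x →L[ℝ] TangentSpace IM x →L[ℝ] ℝ) (K : EG →L[ℝ] EG →L[ℝ] ℝ)
    {p : P} {z : EP} (hz : z ∈ bundleChartDomain IP IM proj p) :
    metricInChart IP (bundleMetric (G := G) IP IM IG proj h K conn) p z
      = pullbackForm (blockMetric (projInChart IP IM proj p) (metricInChart IM h (proj p)) K z)
        (bundleFrame (projInChart IP IM proj p) (oneFormInChart IP (F := EG) conn p) z) := by
  ext u v
  have hcast : ∀ (x x' : M) (a b a' b' : EM), x = x' → a = a' → b = b' →
      (h x a b : ℝ) = h x' a' b' := by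
    rintro x _ a b _ _ rfl rfl rfl
    rfl
  refine congrArg₂ (fun x y : ℝ => x + y) ?_ rfl
  exact hcast _ _ _ _ _ _ (symm_projInChart hz).symm
    (hproj.chartDeriv_fderiv_projInChart hz u).symm
    (hproj.chartDeriv_fderiv_projInChart hz v).symm

/-- At the centre of the charts, coordinates are the identity on tangent spaces, so the local frame
is (dπ, ω) itself and its inverse gives `horizontalLift`. -/
theorem IsPrincipalBundle.bundleFrame_self
    (hproj : IsPrincipalBundle IP IM IG G proj) (p : P) :
    (bundleFrame (projInChart IP IM proj p) (oneFormInChart IP (F := EG) conn p)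
      (extChartAt IP p p) : EP →L[ℝ] EM × EG)
    = ((mfderiv IP IM proj p : EP →L[ℝ] EM).prod (conn p : EP →L[ℝ] EG)) := by
  have hz := mem_bundleChartDomain (IP := IP) (IM := IM) (proj := proj) p
  ext u : 1
  refine Prod.ext ?_ ?_
  · have hcast : ∀ (p' p'' : P) (u' u'' : EP), p' = p'' → u' = u'' →
        (mfderiv IP IM proj p' u' : EM) = mfderiv IP IM proj p'' u'' := by
      rintro p' _ u' _ rfl rfl
      rfl
    have h1 := hproj.chartDeriv_fderiv_projInChart hz u
    have h2 : projInChart IP IM proj p (extChartAt IP p p) = extChartAt IM (proj p) (proj p) :=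
      congrArg (fun q => extChartAt IM (proj p) (proj q)) (extChartAt_to_inv (I := IP) p)
    rw [h2] at h1
    refine (chartDeriv_self (I := IM) (proj p) _).symm.trans (h1.trans ?_)
    exact hcast _ _ _ _ (extChartAt_to_inv p) (chartDeriv_self p u)
  · have hcast : ∀ (p' p'' : P) (u' u'' : EP), p' = p'' → u' = u'' →
        (conn p' u' : EG) = conn p'' u'' := by
      rintro p' _ u' _ rfl rfl
      rfl
    exact hcast _ _ _ _ (extChartAt_to_inv p) (chartDeriv_self p u)

theorem metricInChart_self (h : ∀ x : M, TangentSpace IM x →L[ℝ] TangentSpace IM x →L[ℝ] ℝ)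
    (x : M) (u v : EM) : metricInChart IM h x (extChartAt IM x x) u v = h x u v := by
  have hcast : ∀ (x x' : M) (a b a' b' : EM), x = x' → a = a' → b = b' →
      (h x a b : ℝ) = h x' a' b' := by
    rintro x _ a b _ _ rfl rfl rfl
    rfl
  exact hcast _ _ _ _ _ _ (extChartAt_to_inv x) (chartDeriv_self x u) (chartDeriv_self x v)

/-- Horizontal lifts are fixed by `horizontalProj`, since the form vanishes on them, and they
coincide with the lifts taken in the chart. -/
theorem IsPrincipalBundle.curvatureForm_horizontalLift
    (hproj : IsPrincipalBundle IP IM IG G proj) (hconn : IsConnectionForm IP IG conn)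
    (p : P) (u v : EM) :
    (curvatureForm IP IG conn p (horizontalLift IP IM IG proj conn p u)
      (horizontalLift IP IM IG proj conn p v) : EG)
    = localCurvature (projInChart IP IM proj p) (oneFormInChart IP (F := EG) conn p)
      (extChartAt IP p p) u v := by
  have hz := mem_bundleChartDomain (IP := IP) (IM := IM) (proj := proj) p
  have hl : ∀ w : EM, (horizontalLift IP IM IG proj conn p w : EP)
      = localLift (projInChart IP IM proj p) (oneFormInChart IP (F := EG) conn p)
        (extChartAt IP p p) w := fun w =>
    (congrArg (fun l : EP →L[ℝ] EM × EG => l.inverse (w, 0)) (hproj.bundleFrame_self p)).symm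
  have hc : ∀ w : EM, (conn p (horizontalLift IP IM IG proj conn p w) : EG) = 0 := fun w => by
    have h1 := apply_inverse_of_isInvertible
      (isInvertible_of_bijective (hproj.bijective_bundleFrame hconn hz)) (w, 0)
    rw [hproj.bundleFrame_self p] at h1
    exact congrArg Prod.snd h1
  have hh : ∀ w : EM, (mfderiv IP 𝓘(ℝ, EP) (extChartAt IP p) p
      (horizontalProj IP IG conn p (horizontalLift IP IM IG proj conn p w)) : EP)
      = localLift (projInChart IP IM proj p) (oneFormInChart IP (F := EG) conn p)
        (extChartAt IP p p) w := fun w => by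
    rw [← hl, horizontalProj]
    have e1 : (fundamental (G := G) IP IG p (conn p (horizontalLift IP IM IG proj conn p w)) : EP)
        = 0 := by
      refine (congrArg (fun X : EG => (fundamental (G := G) IP IG p X : EP)) (hc w)).trans ?_
      exact ContinuousLinearMap.map_zero _
    have e2 : (mfderiv IP 𝓘(ℝ, EP) (extChartAt IP p) p : EP →L[ℝ] EP)
        = ContinuousLinearMap.id ℝ EP := mfderiv_extChartAt_self
    refine (congrArg (fun l : EP →L[ℝ] EP => l _) e2).trans ?_
    let l : EP := horizontalLift IP IM IG proj conn p w
    exact (congrArg (fun x : EP => l - x) e1).trans (sub_zero l)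
  rw [localCurvature_apply, ← hh, ← hh]
  rfl

/-- The double trace runs over all ordered pairs and is twice `curvatureNormSq`, which turns the
coefficient -¼ into -½. -/
theorem IsPrincipalBundle.scalarCurvature_bundleMetric
    (hproj : IsPrincipalBundle IP IM IG G proj) (hconn : IsConnectionForm IP IG conn)
    (h : PseudoRiemannianMetric IM M) {K : EG →L[ℝ] EG →L[ℝ] ℝ}
    (hK : IsAdInvariantInner (G := G) IG K) (p : P) :
    scalarCurvature IP (bundleMetric (G := G) IP IM IG proj h.inner K conn) p
      = scalarCurvature IM h.inner (proj p)
        - 1 / 2 * curvatureNormSq (G := G) IP IM IG proj h.inner K conn p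
        + 1 / 4 * metricTrace (fun a a' => K a a') (fun a a' => metricTrace (fun b b' => K b b')
          (fun b b' => K (adjointBracket IG G a b) (adjointBracket IG G a' b'))) := by
  have h1 := (hproj.isLocalBundle hconn h hK p).scalarCurvatureVec_eq
    (g := metricInChart IP (bundleMetric (G := G) IP IM IG proj h.inner K conn) p) (by
      filter_upwards [hproj.eventually_mem_bundleChartDomain (mem_bundleChartDomain p)] with z hz
      exact hproj.bundleMetric_inChart h.inner K hz)
  have h2 : projInChart IP IM proj p (extChartAt IP p p) = extChartAt IM (proj p) (proj p) :=
    congrArg (fun q => extChartAt IM (proj p) (proj q)) (extChartAt_to_inv (I := IP) p)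
  have h3 : curvatureNormSq (G := G) IP IM IG proj h.inner K conn p
      = 1 / 2 * metricTrace (fun u u' : EM => h.inner (proj p) u u')
        (fun u u' => metricTrace (fun v v' : EM => h.inner (proj p) v v') (fun v v' =>
          K (localCurvature (projInChart IP IM proj p) (oneFormInChart IP (F := EG) conn p)
              (extChartAt IP p p) u v)
            (localCurvature (projInChart IP IM proj p) (oneFormInChart IP (F := EG) conn p)
              (extChartAt IP p p) u' v'))) := by
    simp only [← hproj.curvatureForm_horizontalLift hconn]
    rfl
  rw [h2] at h1
  simp only [metricInChart_self] at h1
  refine h1.trans ?_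
  rw [h3]
  unfold scalarCurvature
  ring

end BundleInChart

/-! ### The bi-invariant metric of a Lie group -/

section GroupMetric
open Filter Topology

set_option maxSynthPendingDepth 3
set_option linter.unusedSectionVars false

variable {EG : Type*} [NormedAddCommGroup EG] [NormedSpace ℝ EG] [FiniteDimensional ℝ EG]
  {HG : Type*} [TopologicalSpace HG] {IG : ModelWithCorners ℝ EG HG} [IG.Boundaryless]
  {G : Type*} [TopologicalSpace G] [ChartedSpace HG G] [Group G] [LieGroup IG ∞ G]

/-- The fibre over `x` is already read in the preferred chart at `x`, so the coordinate change there
is the identity. This lets a vector at g g⁻¹ be used as a vector at 1. -/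
theorem snd_trivializationAt_of_eq {x y : G} (hxy : y = x) (v : EG) :
    (trivializationAt EG (TangentSpace IG (M := G)) x (TotalSpace.mk' EG y v)).2 = v := by
  subst hxy
  have := IsManifold.of_le (I := IG) (M := G) (m := 1) (n := ∞) (by simp)
  rw [TangentBundle.trivializationAt_apply]
  exact (tangentBundleCore IG G).coordChange_self (achart HG y) y (mem_chart_source HG y) v

theorem contMDiff_rightMaurerCartan : ContMDiff (M' := EG) IG.tangent 𝓘(ℝ, EG) ∞
    (fun v : TangentBundle IG G => rightMaurerCartan IG v.proj v.snd) := by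
  have hG : IsManifold IG ∞ G := inferInstance
  -- The right Maurer-Cartan form is the tangent map of multiplication applied to (v, 0), with 0
  -- placed at g⁻¹, which exhibits it as a composite of smooth maps.
  let F₁ : TangentBundle IG G → TangentBundle IG G × TangentBundle IG G :=
    fun v => (v, TotalSpace.mk' EG v.proj⁻¹ 0)
  have S₁ : ContMDiff IG.tangent (IG.tangent.prod IG.tangent) ∞ F₁ := by
    refine contMDiff_id.prodMk ?_
    exact (contMDiff_zeroSection ℝ (TangentSpace IG (M := G))).comp
      ((contMDiff_inv IG ∞).comp (contMDiff_proj (TangentSpace IG (M := G))))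
  have S₂ : ContMDiff (IG.tangent.prod IG.tangent) (IG.prod IG).tangent ∞
    (equivTangentBundleProd IG G IG G).symm := contMDiff_equivTangentBundleProd_symm
  have S₃ : ContMDiff (IG.prod IG).tangent IG.tangent ∞
      (tangentMap (IG.prod IG) IG (fun q : G × G => q.1 * q.2)) :=
    (contMDiff_mul IG ∞).contMDiff_tangentMap (m := ∞) (by simp)
  have S := (S₃.comp S₂).comp S₁
  intro v
  have S' := (Bundle.contMDiffAt_totalSpace.1 (S v)).2
  refine S'.congr_of_eventuallyEq (Eventually.of_forall fun w => ?_)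
  have e1 : ((equivTangentBundleProd IG G IG G).symm (F₁ w)) =
    TotalSpace.mk' (EG × EG) (w.proj, w.proj⁻¹) ((w.snd, 0) : EG × EG) := rfl
  refine Eq.trans ?_ (snd_trivializationAt_of_eq (IG := IG) (x := v.proj * v.proj⁻¹)
    (y := w.proj * w.proj⁻¹) (by simp) (mfderiv (IG.prod IG) IG (fun q : G × G => q.1 * q.2)
      (w.proj, w.proj⁻¹) ((w.snd, 0) : EG × EG))).symm
  refine Eq.trans ?_ (mfderiv_prod_eq_add_apply (v := ((w.snd, 0) : EG × EG))
    ((contMDiff_mul IG ∞).mdifferentiableAt (by simp))).symm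
  refine ((congrArg₂ (fun x y : EG => x + y) rfl (ContinuousLinearMap.map_zero _)).trans
    (add_zero _)).symm

/-- For G acting on itself from the left, fundamental vectors are right translates, which this form
inverts; equivariance is (k a)(k g)⁻¹ = k (a g⁻¹) k⁻¹, differentiated at a = g. -/
theorem isConnectionForm_rightMaurerCartan :
    IsConnectionForm (P := G) IG IG (fun g => rightMaurerCartan IG g) where
  contMDiff := contMDiff_rightMaurerCartan
  apply_fundamental g X := by
    have h1 := mfderiv_comp_of_eq (I := IG) (I' := IG) (I'' := IG) (x := (1 : G)) (y := g)
      (f := fun k : G => k * g) (g := fun a : G => a * g⁻¹)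
      (mdifferentiableAt_mul_right' g g⁻¹) (mdifferentiableAt_mul_right' 1 g) (one_mul g)
    have h2 : (fun a : G => a * g⁻¹) ∘ (fun k : G => k * g) = id := by
      ext k
      simp
    rw [h2, mfderiv_id] at h1
    have h3 : ∀ g' : G, g' = g → (mfderiv IG IG (fun a : G => a * g⁻¹) g' : EG →L[ℝ] EG)
        = rightMaurerCartan IG g := by
      rintro g' rfl
      rfl
    refine (congrArg (fun l : EG →L[ℝ] EG => l (fundamental (G := G) IG IG g X))
      (h3 _ (one_mul g))).symm.trans ?_
    exact (congrArg (fun l : EG →L[ℝ] EG => l X) h1).symm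
  equivariant k g v := by
    have c1 : MDifferentiableAt IG IG (fun a : G => k * a * k⁻¹) 1 :=
      ((contMDiff_mul_right (I := IG) (n := ∞) (a := k⁻¹)).comp
        (contMDiff_mul_left (I := IG) (n := ∞) (a := k))).contMDiffAt.mdifferentiableAt (by simp)
    have c2 : MDifferentiableAt IG IG (fun a : G => k * a) g :=
      (contMDiff_mul_left (I := IG) (n := ∞)).contMDiffAt.mdifferentiableAt (by simp)
    have h1 := mfderiv_comp_of_eq (I := IG) (I' := IG) (I'' := IG) (x := g) (y := 1)
      (f := fun a : G => a * g⁻¹) (g := fun a : G => k * a * k⁻¹)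
      c1 (mdifferentiableAt_mul_right' g g⁻¹) (mul_inv_cancel g)
    have h2 := mfderiv_comp (I := IG) (I' := IG) (I'' := IG) g
      (f := fun a : G => k * a) (g := fun a : G => a * (k * g)⁻¹)
      (mdifferentiableAt_mul_right' (k * g) _) c2
    have h3 : (fun a : G => k * a * k⁻¹) ∘ (fun a : G => a * g⁻¹)
        = (fun a : G => a * (k * g)⁻¹) ∘ (fun a : G => k * a) := by
      ext a
      simp [mul_assoc]
    rw [h3] at h1
    have h4 : ∀ g' : G, g' = 1 → (mfderiv IG IG (fun a : G => k * a * k⁻¹) g' : EG →L[ℝ] EG)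
        = adjointRep IG k := by
      rintro g' rfl
      rfl
    refine (congrArg (fun l : EG →L[ℝ] EG => l v) h2).symm.trans ?_
    refine (congrArg (fun l : EG →L[ℝ] EG => l v) h1).trans ?_
    exact congrArg (fun l : EG →L[ℝ] EG => l (rightMaurerCartan IG g v))
      (h4 _ (mul_inv_cancel g))

/-- Right translation by g⁻¹ is conjugation by g after left translation by g⁻¹, so the two
Maurer-Cartan forms differ by Ad(g), which preserves K. -/
theorem groupMetric_apply {K : EG →L[ℝ] EG →L[ℝ] ℝ} (hK : IsAdInvariantInner (G := G) IG K)
    (g : G) (u v : EG) : groupMetric (G := G) IG K g u v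
      = K (rightMaurerCartan IG g u) (rightMaurerCartan IG g v) := by
  have c1 : MDifferentiableAt IG IG (fun a : G => g * a * g⁻¹) 1 :=
    ((contMDiff_mul_right (I := IG) (n := ∞) (a := g⁻¹)).comp
      (contMDiff_mul_left (I := IG) (n := ∞) (a := g))).contMDiffAt.mdifferentiableAt (by simp)
  have c2 : MDifferentiableAt IG IG (fun a : G => g⁻¹ * a) g :=
    (contMDiff_mul_left (I := IG) (n := ∞)).contMDiffAt.mdifferentiableAt (by simp)
  have h1 := mfderiv_comp_of_eq (I := IG) (I' := IG) (I'' := IG) (x := g) (y := 1)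
    (f := fun a : G => g⁻¹ * a) (g := fun a : G => g * a * g⁻¹) c1 c2 (inv_mul_cancel g)
  have h3 : (fun a : G => g * a * g⁻¹) ∘ (fun a : G => g⁻¹ * a) = (fun a : G => a * g⁻¹) := by
    ext a
    simp
  rw [h3] at h1
  have h4 : ∀ g' : G, g' = 1 → (mfderiv IG IG (fun a : G => g * a * g⁻¹) g' : EG →L[ℝ] EG)
      = adjointRep IG g := by
    rintro g' rfl
    rfl
  have h5 : ∀ w : EG, (rightMaurerCartan IG g w : EG)
      = adjointRep IG g (mfderiv IG IG (fun a : G => g⁻¹ * a) g w : EG) := fun w =>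
    (congrArg (fun l : EG →L[ℝ] EG => l w) h1).trans (congrArg (fun l : EG →L[ℝ] EG =>
      l (mfderiv IG IG (fun a : G => g⁻¹ * a) g w : EG)) (h4 _ (inv_mul_cancel g)))
  refine (hK.ad_invariant g _ _).symm.trans ?_
  exact congrArg₂ (fun x y : EG => K x y) (h5 u).symm (h5 v).symm

theorem fundamental_rightMaurerCartan (g : G) (η : EG) :
    (fundamental (G := G) IG IG g (rightMaurerCartan IG g η) : EG) = η := by
  have h1 := mfderiv_smul_left (G := G) (P := G) (IG := IG) (IP := IG) (contMDiff_mul IG ∞) g 1 η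
  have h2 : (fun k : G => k • (1 : G)) = id := by
    ext k
    simp
  rw [h2, mfderiv_id] at h1
  have h3 : ∀ g' : G, g' = g → (fundamental (G := G) IG IG g' : EG →L[ℝ] EG)
      = fundamental (G := G) IG IG g := by
    rintro g' rfl
    rfl
  exact ((h1.trans (congrArg (fun l : EG →L[ℝ] EG => l (rightMaurerCartan IG g η))
    (h3 _ (mul_one g))))).symm

theorem metricTrace_of_subsingleton {V : Type*} [AddCommGroup V] [Module ℝ V]
    [FiniteDimensional ℝ V] [Subsingleton V] (g B : V → V → ℝ) : metricTrace g B = 0 := by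
  have : IsEmpty (Fin (Module.finrank ℝ V)) := by
    rw [Module.finrank_zero_of_subsingleton]
    infer_instance
  simp [metricTrace]

/-- G as a bundle over a point: the base is the zero space, on which the zero form is nondegenerate,
every vector is vertical, and B is the same as for P. -/
theorem isLocalBundle_rightMaurerCartan {K : EG →L[ℝ] EG →L[ℝ] ℝ}
    (hK : IsAdInvariantInner (G := G) IG K) (g : G) :
    IsLocalBundle (W := PUnit.{1}) (fun _ => 0)
      (oneFormInChart IG (F := EG) (fun k : G => rightMaurerCartan IG k) g)
      (fun _ => 0) K (adjointBracket IG G) (extChartAt IG g g) where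
  contDiffAt_proj := contDiffAt_const
  contDiffAt_form := (contDiffAt_oneFormInChart (F := EG) contMDiff_rightMaurerCartan
    (mem_extChartAt_target g)).of_le (WithTop.coe_le_coe.2 le_top)
  metric := ⟨contDiffAt_const, Eventually.of_forall fun _ _ _ => rfl,
    Eventually.of_forall fun _ _ _ => rfl⟩
  bijective := by
    filter_upwards [eventually_mem_target g (mem_extChartAt_target (I := IG) g)] with z hz
    constructor
    · rw [injective_iff_map_eq_zero]
      intro u hu
      have h2 : (rightMaurerCartan IG ((extChartAt IG g).symm z) (chartDeriv IG g z u) : EG) = 0 :=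
        congrArg Prod.snd hu
      have h3 := (fundamental_rightMaurerCartan (IG := IG) ((extChartAt IG g).symm z)
        (chartDeriv IG g z u)).symm.trans (congrArg
        (fun X : EG => (fundamental (G := G) IG IG ((extChartAt IG g).symm z) X : EG)) h2)
      refine (chartDeriv_bijective hz).1 (h3.trans ?_)
      exact (fundamental (G := G) IG IG ((extChartAt IG g).symm z)).map_zero.trans
        (chartDeriv IG g z).map_zero.symm
    · rintro ⟨w, a⟩
      obtain ⟨u, hu⟩ := (chartDeriv_bijective hz).2
        (fundamental (G := G) IG IG ((extChartAt IG g).symm z) a)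
      refine ⟨u, Prod.ext rfl ?_⟩
      refine (congrArg (fun w : EG => (rightMaurerCartan IG ((extChartAt IG g).symm z) w : EG))
        hu).trans ?_
      exact isConnectionForm_rightMaurerCartan.apply_fundamental _ _
  symm := hK.symm
  pos := hK.pos
  skew := adjointBracket_skew
    (isConnectionForm_rightMaurerCartan.differentiableAt_adjointRep (contMDiff_mul IG ∞) g) hK
  vertical := by
    filter_upwards [eventually_mem_target g (mem_extChartAt_target (I := IG) g)] with z hz u v _
    exact isConnectionForm_rightMaurerCartan.extDeriv_eq_adjointBracket (contMDiff_mul IG ∞) hz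
      (fundamental_rightMaurerCartan (IG := IG) ((extChartAt IG g).symm z)
        (chartDeriv IG g z u)).symm v

theorem groupMetric_inChart {K : EG →L[ℝ] EG →L[ℝ] ℝ}
    (hK : IsAdInvariantInner (G := G) IG K) (g : G) (z : EG) :
    metricInChart IG (groupMetric (G := G) IG K) g z
      = pullbackForm (blockMetric (W := PUnit.{1}) (fun _ : EG => 0) (fun _ => 0) K z)
        (bundleFrame (W := PUnit.{1}) (fun _ => 0)
          (oneFormInChart IG (F := EG) (fun k : G => rightMaurerCartan IG k) g) z) := by
  ext u v
  refine (groupMetric_apply hK ((extChartAt IG g).symm z) (chartDeriv IG g z u)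
    (chartDeriv IG g z v)).trans ?_
  exact (zero_add _).symm

theorem scalarCurvature_groupMetric {K : EG →L[ℝ] EG →L[ℝ] ℝ}
    (hK : IsAdInvariantInner (G := G) IG K) (g : G) :
    scalarCurvature IG (groupMetric (G := G) IG K) g
      = 1 / 4 * metricTrace (fun a a' => K a a') (fun a a' => metricTrace (fun b b' => K b b')
          (fun b b' => K (adjointBracket IG G a b) (adjointBracket IG G a' b'))) := by
  have h1 := (isLocalBundle_rightMaurerCartan hK g).scalarCurvatureVec_eq
    (g := metricInChart IG (groupMetric (G := G) IG K) g) (Eventually.of_forall fun z => groupMetric_inChart hK g z)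
  refine h1.trans ?_
  -- Traces over the zero-dimensional base vanish, so neither its scalar curvature nor the F term
  -- contributes; the remaining term does not involve `g`.
  rw [scalarCurvatureVec, metricTrace_of_subsingleton, metricTrace_of_subsingleton]
  ring

end GroupMetric

end KaluzaKlein

end

theorem mainTheorem1
    {EP : Type*} [NormedAddCommGroup EP] [NormedSpace ℝ EP] [FiniteDimensional ℝ EP]
    {HP : Type*} [TopologicalSpace HP] (IP : ModelWithCorners ℝ EP HP) [IP.Boundaryless]
    {EM : Type*} [NormedAddCommGroup EM] [NormedSpace ℝ EM] [FiniteDimensional ℝ EM]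
    {HM : Type*} [TopologicalSpace HM] (IM : ModelWithCorners ℝ EM HM) [IM.Boundaryless]
    {EG : Type*} [NormedAddCommGroup EG] [NormedSpace ℝ EG] [FiniteDimensional ℝ EG]
    {HG : Type*} [TopologicalSpace HG] (IG : ModelWithCorners ℝ EG HG) [IG.Boundaryless]
    {P : Type*} [TopologicalSpace P] [ChartedSpace HP P] [IsManifold IP ∞ P]
    {M : Type*} [TopologicalSpace M] [ChartedSpace HM M] [IsManifold IM ∞ M]
    {G : Type*} [TopologicalSpace G] [ChartedSpace HG G] [Group G] [LieGroup IG ∞ G]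
    [CompactSpace G] [MulAction G P]
    (proj : P → M) (hproj : KaluzaKlein.IsPrincipalBundle IP IM IG G proj)
    (h : KaluzaKlein.PseudoRiemannianMetric IM M)
    (K : GroupLieAlgebra IG G →L[ℝ] GroupLieAlgebra IG G →L[ℝ] ℝ)
    (hK : KaluzaKlein.IsAdInvariantInner IG K)
    (conn : ∀ p : P, TangentSpace IP p →L[ℝ] GroupLieAlgebra IG G)
    (hconn : KaluzaKlein.IsConnectionForm IP IG conn)
    (p : P) (g : G) :
    KaluzaKlein.scalarCurvature IP (KaluzaKlein.bundleMetric IP IM IG proj h.inner K conn) p =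
      KaluzaKlein.scalarCurvature IM h.inner (proj p)
        - (1 / 2) * KaluzaKlein.curvatureNormSq IP IM IG proj h.inner K conn p
        + KaluzaKlein.scalarCurvature IG (KaluzaKlein.groupMetric IG K) g := by
  refine (hproj.scalarCurvature_bundleMetric hconn h hK p).trans ?_
  exact congrArg (fun r : ℝ => KaluzaKlein.scalarCurvature IM h.inner (proj p)
    - (1 / 2) * KaluzaKlein.curvatureNormSq IP IM IG proj h.inner K conn p + r)
    (KaluzaKlein.scalarCurvature_groupMetric hK g).symm
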